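/- **Setting.** Let $\Gamma=\bigcup_{\gamma\in\mathcal E}\gamma([0,1])\subset\mathbb R^N$ be an embedded network: $\mathcal E$ is a finite collection of $C^1$ curves $\gamma:[0,1]\to\mathbb R^N$ (arcs), with non-vanishing derivative and injective on $[0,1]$ (in particular there are no loops); with every $\gamma$ also the inverse arc $-\gamma(s)=\gamma(1-s)$ belongs to $\mathcal E$; and $\gamma((0,1))\cap\gamma'([0,1])=\emptyset$ whenever $\gamma'\neq\gamma$ and $\gamma'\neq-\gamma$. Let $\mathbf V$ be the set of end points of arcs (vertices), and assume that any two vertices are linked by a finite concatenation of arcs. For $x\in\mathbf V$ put $\Gamma_x=\{\gamma\in\mathcal E:\gamma(1)=x\}$. For each $\gamma\in\mathcal E$ let $H_\gamma:[0,1]\times\mathbb R\to\mathbb R$ be continuous, convex in $p$, coercive in $p$ uniformly in $s$ (that is, $H_\gamma(s,p)\to+\infty$ as $|p|\to\infty$, uniformly in $s$), and Lipschitz continuous in $p\in(-M,M)$ uniformly in $s$, for every $M>0$; and let $H_{-\gamma}(s,p)=H_\gamma(1-s,-p)$. Put $c_\gamma=-\max_{s}\min_{p}H_\gamma(s,p)$.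 A flux limiter is a function $x\mapsto c_x$ from $\mathbf V$ to $\mathbb R$ with $c_x\le\min_{\gamma\in\Gamma_x}c_\gamma$ for all $x\in\mathbf V$. Let $0\le T_0<T_1\le+\infty$. **Solutions.** Let $v:\Gamma\times[T_0,T_1)\to\mathbb R$ be continuous and write $(v\circ\gamma)(s,t)=v(\gamma(s),t)$. A $C^1$ function $\varphi$ is a supertangent (subtangent) to a function $w$ at a point if $w-\varphi$ has a local maximum (minimum) there; it is constrained to a set $C$ if the local maximum (minimum) is relative to $C$. The derivative in $s$ is denoted by $'$. * $v$ is a subsolution of (HJ$\Gamma$) in $(T_0,T_1)$ if for every $\gamma\in\mathcal E$ the function $v\circ\gamma$ is a viscosity subsolution of $w_t+H_\gamma(s,w')=0$ in $(0,1)\times(T_0,T_1)$, and for every $x\in\mathbf V$ and $t_0\in(T_0,T_1)$ all $C^1$ supertangents $\psi$ to $v(x,\cdot)$ at $t_0$ satisfy $\frac{d}{dt}\psi(t_0)\le c_x$. * $v$ is a supersolution of (HJ$\Gamma$) in $(T_0,T_1)$ if for every $\gamma\in\mathcal E$ the function $v\circ\gamma$ is a viscosity supersolution of the same equation in $(0,1)\times(T_0,T_1)$,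 and for every $x\in\mathbf V$ and $t_0\in(T_0,T_1)$ the following holds: if there is a $C^1$ subtangent $\phi$ to $v(x,\cdot)$ at $t_0$ with $\frac{d}{dt}\phi(t_0)<c_x$, then there is an arc $\gamma\in\Gamma_x$ such that all $C^1$ subtangents $\varphi$ to $v\circ\gamma$ at $(1,t_0)$ constrained to $[0,1]\times[T_0,T_1)$ satisfy $\varphi_t(1,t_0)+H_\gamma(1,\varphi'(1,t_0))\ge0$. * $v$ is a solution if it is both a subsolution and a supersolution. A function on $\Gamma$, or on $\Gamma\times[T_0,T_1)$, is called Lipschitz continuous if its composition with every arc is Lipschitz continuous on $[0,1]$, or on $[0,1]\times[T_0,T_1)$; equivalently, if it is Lipschitz continuous for the geodesic distance of $\Gamma$ (and the usual distance in time). **Proposition 6.8.** For every continuous $g:\Gamma\to\mathbb R$ and every flux limiter $c_x$ there is one and only one continuous solution $u:\Gamma\times[T_0,T_1)\to\mathbb R$ of (HJ$\Gamma$) in $(T_0,T_1)$ with $u(\cdot,T_0)=g$. It is uniformly continuous in $\Gamma\times[T_0,T_1)$. If $g$ is Lipschitz continuous, then $u$ is Lipschitz continuous in $\Gamma\times[T_0,T_1)$.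 -/

import Mathlib

open Set Topology

noncomputable section

/-- An embedded network in `ℝ^N` without loops. The oriented arcs are indexed by `E`; each curve is
used on `[0,1]` only. The family of arcs is closed under reversal of the orientation. -/
structure EmbeddedNetwork (E : Type*) (N : ℕ) where
  /-- the parametrization of each oriented arc -/
  arc : E → ℝ → EuclideanSpace ℝ (Fin N)
  /-- the inverse arc -/
  inv : E → E
  inv_inv : ∀ e, inv (inv e) = e
  arc_inv : ∀ e, ∀ s ∈ Icc (0 : ℝ) 1, arc (inv e) s = arc e (1 - s)
  /-- arcs are regular curves of class `C¹` -/
  arc_contDiffOn : ∀ e, ContDiffOn ℝ 1 (arc e) (Icc 0 1)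
  arc_deriv_ne_zero : ∀ e, ∀ s ∈ Icc (0 : ℝ) 1, derivWithin (arc e) (Icc 0 1) s ≠ 0
  /-- arcs are simple and are not loops (the two end points are distinct as well) -/
  arc_injOn : ∀ e, InjOn (arc e) (Icc 0 1)
  /-- arcs that are neither equal nor inverse to each other can meet at end points only -/
  arc_disjoint : ∀ e e', e ≠ e' → e ≠ inv e' → Disjoint (arc e '' Ioo 0 1) (arc e' '' Icc 0 1)
  /-- any two end points of arcs are linked by a finite concatenation of arcs -/
  connected : ∀ x ∈ range (fun e => arc e 1), ∀ y ∈ range (fun e => arc e 1),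
    Relation.ReflTransGen (fun a b => ∃ e, arc e 0 = a ∧ arc e 1 = b) x y

/-- The time interval `[T₀, T₁)`, where `T₁` may be `+∞`. -/
def timeIco (T₀ : ℝ) (T₁ : EReal) : Set ℝ := {t | T₀ ≤ t ∧ (t : EReal) < T₁}

/-- The time interval `(T₀, T₁)`, where `T₁` may be `+∞`. -/
def timeIoo (T₀ : ℝ) (T₁ : EReal) : Set ℝ := {t | T₀ < t ∧ (t : EReal) < T₁}

/-- `w` is a viscosity subsolution of `w_t + H(s, w') = 0` in `(0,1) × (T₀, T₁)`. -/
def IsViscositySubsolution (H : ℝ → ℝ → ℝ) (T₀ : ℝ) (T₁ : EReal) (w : ℝ × ℝ → ℝ) : Prop :=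
  ∀ s₀ ∈ Ioo (0 : ℝ) 1, ∀ t₀ ∈ timeIoo T₀ T₁, ∀ φ : ℝ × ℝ → ℝ, ContDiff ℝ 1 φ →
    IsLocalMax (fun q => w q - φ q) (s₀, t₀) →
    deriv (fun t => φ (s₀, t)) t₀ + H s₀ (deriv (fun s => φ (s, t₀)) s₀) ≤ 0

/-- `w` is a viscosity supersolution of `w_t + H(s, w') = 0` in `(0,1) × (T₀, T₁)`. -/
def IsViscositySupersolution (H : ℝ → ℝ → ℝ) (T₀ : ℝ) (T₁ : EReal) (w : ℝ × ℝ → ℝ) : Prop :=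
  ∀ s₀ ∈ Ioo (0 : ℝ) 1, ∀ t₀ ∈ timeIoo T₀ T₁, ∀ φ : ℝ × ℝ → ℝ, ContDiff ℝ 1 φ →
    IsLocalMin (fun q => w q - φ q) (s₀, t₀) →
    0 ≤ deriv (fun t => φ (s₀, t)) t₀ + H s₀ (deriv (fun s => φ (s, t₀)) s₀)

/-- `c_γ = - max_s min_p H_γ(s, p)`, with `s ∈ [0,1]` and `p ∈ ℝ`. For Hamiltonians continuous in
`(s, p)` and coercive in `p` uniformly in `s`, the supremum and the infimum below are attained. -/
def arcConstant (H : ℝ → ℝ → ℝ) : ℝ := -(⨆ s : Icc (0 : ℝ) 1, ⨅ p : ℝ, H s p)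

namespace EmbeddedNetwork

variable {E : Type*} {N : ℕ} (Γ : EmbeddedNetwork E N)

/-- The network as a subset of `ℝ^N`. -/
def carrier : Set (EuclideanSpace ℝ (Fin N)) := ⋃ e, Γ.arc e '' Icc 0 1

/-- The vertices: terminal points of arcs. Initial points are terminal points of inverse arcs. -/
def vertices : Set (EuclideanSpace ℝ (Fin N)) := range (fun e => Γ.arc e 1)

/-- The composition `u ∘ γ`, that is `(s, t) ↦ u(γ(s), t)`. -/
def pullback (u : EuclideanSpace ℝ (Fin N) × ℝ → ℝ) (e : E) : ℝ × ℝ → ℝ :=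
  fun q => u (Γ.arc e q.1, q.2)

/-- A Hamiltonian `{H_γ}` on the network: each `H_γ : [0,1] × ℝ → ℝ` is continuous, convex, coercive
(uniformly in `s`) and locally Lipschitz in `p` (uniformly in `s`), and
`H_{-γ}(s, p) = H_γ(1 - s, -p)`. -/
structure IsHamiltonian (H : E → ℝ → ℝ → ℝ) : Prop where
  inv : ∀ e, ∀ s ∈ Icc (0 : ℝ) 1, ∀ p, H (Γ.inv e) s p = H e (1 - s) (-p)
  continuousOn : ∀ e, ContinuousOn (fun q : ℝ × ℝ => H e q.1 q.2) (Icc 0 1 ×ˢ univ)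
  convex : ∀ e, ∀ s ∈ Icc (0 : ℝ) 1, ConvexOn ℝ univ (H e s)
  coercive : ∀ e, ∀ A : ℝ, ∃ R : ℝ, ∀ s ∈ Icc (0 : ℝ) 1, ∀ p : ℝ, R ≤ |p| → A ≤ H e s p
  locallyLipschitz : ∀ e, ∀ M : ℝ, 0 < M → ∃ C : ℝ, ∀ s ∈ Icc (0 : ℝ) 1,
    ∀ p ∈ Ioo (-M) M, ∀ q ∈ Ioo (-M) M, H e s p - H e s q ≤ C * |p - q|

/-- A flux limiter: `c_x ≤ min_{γ ∈ Γ_x} c_γ` at every vertex `x`, where `Γ_x` is the set of arcs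
ending at `x`. Only the values of `c` at vertices matter. -/
def IsFluxLimiter (H : E → ℝ → ℝ → ℝ) (c : EuclideanSpace ℝ (Fin N) → ℝ) : Prop :=
  ∀ x ∈ Γ.vertices, ∀ e, Γ.arc e 1 = x → c x ≤ arcConstant (H e)

/-- Continuous subsolutions of the problem on the network. -/
structure IsSubsolution (H : E → ℝ → ℝ → ℝ) (c : EuclideanSpace ℝ (Fin N) → ℝ)
    (T₀ : ℝ) (T₁ : EReal) (v : EuclideanSpace ℝ (Fin N) × ℝ → ℝ) : Prop where
  continuousOn : ContinuousOn v (Γ.carrier ×ˢ timeIco T₀ T₁)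
  arcs : ∀ e, IsViscositySubsolution (H e) T₀ T₁ (Γ.pullback v e)
  vertices : ∀ x ∈ Γ.vertices, ∀ t₀ ∈ timeIoo T₀ T₁, ∀ ψ : ℝ → ℝ, ContDiff ℝ 1 ψ →
    IsLocalMax (fun t => v (x, t) - ψ t) t₀ → deriv ψ t₀ ≤ c x

/-- Continuous supersolutions of the problem on the network. If some subtangent to `v(x, ·)` at `t₀`
has slope less than `c_x`, then a single arc `γ` ending at `x` has the supersolution property at
`(1, t₀)` for all subtangents to `v ∘ γ` constrained to `[0,1] × [T₀, T₁)`. -/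
structure IsSupersolution (H : E → ℝ → ℝ → ℝ) (c : EuclideanSpace ℝ (Fin N) → ℝ)
    (T₀ : ℝ) (T₁ : EReal) (v : EuclideanSpace ℝ (Fin N) × ℝ → ℝ) : Prop where
  continuousOn : ContinuousOn v (Γ.carrier ×ˢ timeIco T₀ T₁)
  arcs : ∀ e, IsViscositySupersolution (H e) T₀ T₁ (Γ.pullback v e)
  vertices : ∀ x ∈ Γ.vertices, ∀ t₀ ∈ timeIoo T₀ T₁,
    (∃ ψ : ℝ → ℝ, ContDiff ℝ 1 ψ ∧ IsLocalMin (fun t => v (x, t) - ψ t) t₀ ∧ deriv ψ t₀ < c x) →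
    ∃ e, Γ.arc e 1 = x ∧ ∀ φ : ℝ × ℝ → ℝ, ContDiff ℝ 1 φ →
      IsLocalMinOn (fun q => Γ.pullback v e q - φ q) (Icc 0 1 ×ˢ timeIco T₀ T₁) (1, t₀) →
      0 ≤ deriv (fun t => φ (1, t)) t₀ + H e 1 (deriv (fun s => φ (s, t₀)) 1)

/-- Continuous solutions of the problem on the network in `(T₀, T₁)`, with initial datum `g` at
time `T₀`. -/
structure IsSolution (H : E → ℝ → ℝ → ℝ) (c : EuclideanSpace ℝ (Fin N) → ℝ)
    (T₀ : ℝ) (T₁ : EReal) (g : EuclideanSpace ℝ (Fin N) → ℝ)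
    (v : EuclideanSpace ℝ (Fin N) × ℝ → ℝ) : Prop where
  sub : Γ.IsSubsolution H c T₀ T₁ v
  super : Γ.IsSupersolution H c T₀ T₁ v
  initial : ∀ x ∈ Γ.carrier, v (x, T₀) = g x

/-- A function on the network is Lipschitz continuous along the arcs; this is the same as being
Lipschitz continuous for the geodesic distance of the network. -/
def LipschitzSpace (g : EuclideanSpace ℝ (Fin N) → ℝ) : Prop :=
  ∃ K, ∀ e, LipschitzOnWith K (fun s => g (Γ.arc e s)) (Icc 0 1)

/-- A function on the network times `[T₀, T₁)` is Lipschitz continuous along the arcs and in time;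
this is the same as being Lipschitz continuous for the sum of the geodesic distance of the network
and the distance in time. -/
def LipschitzSpaceTime (T₀ : ℝ) (T₁ : EReal) (u : EuclideanSpace ℝ (Fin N) × ℝ → ℝ) : Prop :=
  ∃ K, ∀ e, LipschitzOnWith K (Γ.pullback u e) (Icc 0 1 ×ˢ timeIco T₀ T₁)

end EmbeddedNetwork

end

/-!
The solution is the largest subsolution with initial datum `g`, and the argument is a Perron method
made easy by convexity: everything rests on an integrated notion of subsolution.

*Integrated subsolutions.* For a convex Hamiltonian, a continuous `w` is a subsolution on an arc if
and only if it grows along each segment of direction `(v, 1)` at most at the rate `sup (p v - H(σ,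
p))`, taken over all `p` and over the `σ` in the range of the segment (`IsArcSub`). A viscosity
subsolution has this property by a penalization argument (`increment_le_of_supertangent`,
`IsViscositySubsolution.isArcSub`); for the converse, almost optimal speeds are chosen for which the
rate is stable in `σ` (`IsArcHamiltonian.exists_speed`, `IsArcSub.isViscositySubsolution`). At a
vertex `x` the condition on supertangents becomes growth at most at rate `c x`. In this form
subsolutions need no continuity, and are stable under suprema, time translations, concatenation in
time and averages.

*The maximal subsolution* is the pointwise supremum `maximalSub` of all integrated subsolutions
below `g` at time `T₀`, and is a subsolution itself. If `g` is Lipschitz continuous, then so is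
`maximalSub`: it lies above `g - C (t - T₀)`, hence decreases at most at rate `C` in time, and
the linear lower bound of `H` in `p` turns this into a bound in space
(`lipschitzSpaceTime_maximalSub`). Since `maximalSub` depends on `g` in a nonexpansive way, uniform
continuity follows for continuous `g` by Lipschitz approximation.

*Supersolution property.* A strict subtangent inside an arc would allow the maximal subsolution to
be lifted by a concave wedge. At a vertex `x`, assume that the trace has a subtangent of slope less
than `c x` and that each arc ending at `x` has a subtangent which violates the inequality.
These subtangents may have different time slopes. `IsViscositySupersolution.tilt` lowers all of them
to the least one, `b`, without changing the space slopes: the arcs then fit together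
continuously, and as `b < c x` the resulting affine functions lift the maximal subsolution around
`x` (`maximalSub_vertex`).

*Uniqueness.* A solution is an integrated subsolution, hence below `maximalSub`. Conversely, let
`u` be the maximal subsolution for a Lipschitz datum `g' ≤ g` close to `g`. Averaging `u` in time
and then in space along each arc gives a function of class `C¹` that is almost a subsolution; the
values at the end points are averages in time only, so that they agree at the vertices and still
grow at most at rate `c x` (`IsArcSub.exists_contDiff_approx_of_lipschitz`). These functions, made
strict, serve as test functions for a supersolution `v` simultaneously on all arcs at a vertex, so
`v ≥ u` follows without doubling of variables (`IsSupersolution.le_of_strict`,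
`IsIntegratedSub.le_of_isSupersolution`).
-/

section NetworkHJ

open Filter

/-! ### Growth along segments from supertangents -/

/-- If every supertangent to `w` in an open box has derivative at most `m` in the direction
`(v, 1)`, then `w` grows at most at rate `m` along segments of direction `(v, 1)`. A failure of the
conclusion is turned into a contact point near the segment by adding to the affine growth
an exponential barrier at the final time and a large quadratic penalty transversal to the
segment. -/
theorem increment_le_of_supertangent {w : ℝ → ℝ → ℝ} {a b t₀ t₁ v m : ℝ}
    (hw : ContinuousOn (fun q : ℝ × ℝ => w q.1 q.2) (Ioo a b ×ˢ Ioo t₀ t₁))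
    (hsup : ∀ s ∈ Ioo a b, ∀ t ∈ Ioo t₀ t₁, ∀ φ : ℝ × ℝ → ℝ, ContDiff ℝ 1 φ →
      IsLocalMax (fun q : ℝ × ℝ => w q.1 q.2 - φ q) (s, t) →
      deriv (fun r => φ (s, r)) t + v * deriv (fun r => φ (r, t)) s ≤ m)
    {s t l : ℝ} (hl : 0 ≤ l) (hs : s ∈ Ioo a b) (hs' : s + l * v ∈ Ioo a b)
    (ht : t ∈ Ioo t₀ t₁) (ht' : t + l ∈ Ioo t₀ t₁) :
    w (s + l * v) (t + l) ≤ w s t + l * m := by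
  by_contra! hcon
  have hl0 : 0 < l := by
    rcases hl.eq_or_lt with h | h
    · subst h; simp at hcon
    · exact h
  obtain ⟨m', hm, hm'⟩ : ∃ m', m < m' ∧ w s t + l * m' < w (s + l * v) (t + l) := by
    refine ⟨m + (w (s + l * v) (t + l) - (w s t + l * m)) / (2 * l), ?_, ?_⟩
    · have : 0 < (w (s + l * v) (t + l) - (w s t + l * m)) / (2 * l) := by
        apply div_pos <;> linarith
      linarith
    · have : l * ((w (s + l * v) (t + l) - (w s t + l * m)) / (2 * l))
          = (w (s + l * v) (t + l) - (w s t + l * m)) / 2 := by field_simp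
      rw [mul_add, this]; linarith
  -- a tube around the segment that stays in the box
  obtain ⟨r₀, hr₀, hr⟩ : ∃ r₀ > 0, ∀ σ ∈ Icc 0 l, ∀ r ∈ Icc (-r₀) r₀, s + σ * v + r ∈ Ioo a b := by
    refine ⟨min (min (s - a) (b - s)) (min (s + l * v - a) (b - (s + l * v))) / 2, ?_, ?_⟩
    · have := hs.1; have := hs.2; have := hs'.1; have := hs'.2
      apply half_pos; simp only [lt_min_iff]; refine ⟨⟨?_, ?_⟩, ?_, ?_⟩ <;> linarith
    · intro σ hσ r hr
      set d := min (min (s - a) (b - s)) (min (s + l * v - a) (b - (s + l * v))) with hd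
      have h1 : d ≤ s - a := (min_le_left _ _).trans (min_le_left _ _)
      have h2 : d ≤ b - s := (min_le_left _ _).trans (min_le_right _ _)
      have h3 : d ≤ s + l * v - a := (min_le_right _ _).trans (min_le_left _ _)
      have h4 : d ≤ b - (s + l * v) := (min_le_right _ _).trans (min_le_right _ _)
      have hdpos : 0 < d := by
        have := hs.1; have := hs.2; have := hs'.1; have := hs'.2
        simp only [hd, lt_min_iff]; refine ⟨⟨?_, ?_⟩, ?_, ?_⟩ <;> linarith
      obtain ⟨hσ0, hσl⟩ := hσ
      obtain ⟨hr1, hr2⟩ := hr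
      rcases le_total 0 v with hv | hv
      · have e1 : σ * v ≤ l * v := by gcongr
        have e2 : 0 ≤ σ * v := by positivity
        constructor <;> linarith
      · have e1 : l * v ≤ σ * v := mul_le_mul_of_nonpos_right hσl hv
        have e2 : σ * v ≤ 0 := mul_nonpos_of_nonneg_of_nonpos hσ0 hv
        constructor <;> linarith
  have htt : ∀ σ ∈ Icc 0 l, t + σ ∈ Ioo t₀ t₁ := fun σ hσ =>
    ⟨by linarith [ht.1, hσ.1], by linarith [ht'.2, hσ.2]⟩
  set G : ℝ × ℝ → ℝ := fun q => w (s + q.1 * v + q.2) (t + q.1) - w s t - m' * q.1 with hG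
  set R : Set (ℝ × ℝ) := Icc 0 l ×ˢ Icc (-r₀) r₀ with hR
  have hRc : IsCompact R := isCompact_Icc.prod isCompact_Icc
  have hGc : ContinuousOn G R := by
    have h1 : ContinuousOn (fun q : ℝ × ℝ => w (s + q.1 * v + q.2) (t + q.1)) R := by
      refine hw.comp (f := fun q : ℝ × ℝ => (s + q.1 * v + q.2, t + q.1)) (by fun_prop) ?_
      rintro ⟨σ, r⟩ ⟨h1, h2⟩
      exact ⟨hr σ h1 r h2, htt σ h1⟩
    exact (h1.sub continuousOn_const).sub (by fun_prop)
  obtain ⟨κ, hκ0, hκ⟩ : ∃ κ > 0, ∀ q ∈ R, G q < κ := by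
    obtain ⟨C, hC⟩ := hRc.exists_bound_of_continuousOn hGc
    refine ⟨|C| + 1, by positivity, fun q hq => ?_⟩
    have := hC q hq
    have h2 := le_abs_self (G q)
    rw [Real.norm_eq_abs] at this
    linarith [le_abs_self C]
  have h00 : G (0, 0) = 0 := by simp [hG]
  have hl1 : 0 < G (l, 0) := by simp only [hG, add_zero]; linarith
  -- a time before the final one where `G` is still positive
  obtain ⟨σ₂, hσ₂, γ, hγ, hσ₂G⟩ : ∃ σ₂ ∈ Ioo 0 l, ∃ γ > 0, 2 * γ < G (σ₂, 0) := by
    have hc : ContinuousOn (fun σ => G (σ, 0)) (Icc 0 l) := by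
      refine hGc.comp (by fun_prop) ?_
      intro σ hσ
      exact ⟨hσ, by constructor <;> linarith⟩
    have hev : ∀ᶠ σ in 𝓝[Icc 0 l] l, 0 < G (σ, 0) :=
      (hc l ⟨hl0.le, le_rfl⟩).eventually_const_lt hl1
    have hev2 : ∀ᶠ σ in 𝓝[<] l, 0 < G (σ, 0) ∧ σ ∈ Ioo 0 l := by
      have : ∀ᶠ σ in 𝓝[<] l, σ ∈ Ioo 0 l := Ioo_mem_nhdsLT hl0
      refine Filter.Eventually.and ?_ this
      rw [eventually_nhdsWithin_iff] at hev
      filter_upwards [this, hev.filter_mono nhdsWithin_le_nhds] with σ h1 h2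
      exact h2 ⟨h1.1.le, h1.2.le⟩
    obtain ⟨σ, h1, h2⟩ := hev2.exists
    exact ⟨σ, h2, G (σ, 0) / 4, by positivity, by linarith⟩
  obtain ⟨M, hM0, hM⟩ : ∃ M > 0, κ * Real.exp (M * (σ₂ - l)) < γ := by
    have h1 : Tendsto (fun M : ℝ => κ * Real.exp (M * (σ₂ - l))) atTop (𝓝 (κ * 0)) := by
      refine Tendsto.const_mul _ (Real.tendsto_exp_atBot.comp ?_)
      exact tendsto_id.atTop_mul_const_of_neg (by linarith [hσ₂.2])
    rw [mul_zero] at h1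
    obtain ⟨M, h2, h3⟩ := ((h1.eventually_lt_const hγ).and (eventually_gt_atTop 0)).exists
    exact ⟨M, h3, h2⟩
  obtain ⟨ρ, hρ0, hρr, hρ⟩ : ∃ ρ > 0, ρ ≤ r₀ ∧ ∀ r, |r| < ρ → G (0, r) < γ := by
    have hc : ContinuousOn (fun r => G (0, r)) (Icc (-r₀) r₀) := by
      refine hGc.comp (by fun_prop) ?_
      intro r hr
      exact ⟨⟨le_rfl, hl0.le⟩, hr⟩
    have : ∀ᶠ r in 𝓝 (0 : ℝ), G (0, r) < γ := by
      have h1 := (hc.continuousAt (Icc_mem_nhds (by linarith) hr₀))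
      have h2 : G (0, 0) < γ := by rw [h00]; exact hγ
      exact h1.eventually_lt_const h2
    obtain ⟨ρ, h1, h2⟩ := Metric.eventually_nhds_iff.1 this
    refine ⟨min ρ r₀, lt_min h1 hr₀, min_le_right _ _, fun r hr => h2 ?_⟩
    rw [Real.dist_eq, sub_zero]
    exact hr.trans_le (min_le_left _ _)
  set Nn : ℝ := κ / ρ ^ 2 with hNn
  have hNρ : Nn * ρ ^ 2 = κ := by rw [hNn]; field_simp
  have hNpos : 0 < Nn := by positivity
  set Q : ℝ × ℝ → ℝ := fun q => G q - κ * Real.exp (M * (q.1 - l)) - Nn * q.2 ^ 2 with hQ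
  have hQc : ContinuousOn Q R := (hGc.sub (by fun_prop)).sub (by fun_prop)
  obtain ⟨⟨σ₁, r₁⟩, hzR, hzmax⟩ := hRc.exists_isMaxOn
    ⟨(σ₂, 0), ⟨hσ₂.1.le, hσ₂.2.le⟩, by constructor <;> linarith⟩ hQc
  have hval : γ < Q (σ₁, r₁) := by
    have h1 : Q (σ₂, 0) ≤ Q (σ₁, r₁) :=
      hzmax ⟨⟨hσ₂.1.le, hσ₂.2.le⟩, by constructor <;> linarith⟩
    have h2 : Q (σ₂, 0) = G (σ₂, 0) - κ * Real.exp (M * (σ₂ - l)) := by simp [hQ]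
    linarith
  have hexp : ∀ x : ℝ, 0 < κ * Real.exp x := fun x => by positivity
  have hGz := hκ _ hzR
  obtain ⟨hσ₁, hr₁⟩ := hzR
  simp only at hσ₁ hr₁
  have hr₁ρ : |r₁| < ρ := by
    by_contra! h
    have : ρ ^ 2 ≤ r₁ ^ 2 := by rw [← sq_abs r₁]; gcongr
    have : κ ≤ Nn * r₁ ^ 2 := by rw [← hNρ]; gcongr
    have := hexp (M * (σ₁ - l))
    simp only [hQ] at hval
    linarith
  have hσl : σ₁ < l := by
    refine lt_of_le_of_ne hσ₁.2 ?_
    rintro rfl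
    simp only [hQ, sub_self, mul_zero, Real.exp_zero, mul_one] at hval
    have : 0 ≤ Nn * r₁ ^ 2 := by positivity
    linarith
  have hσ0 : 0 < σ₁ := by
    refine lt_of_le_of_ne hσ₁.1 ?_
    rintro rfl
    have h1 := hρ r₁ hr₁ρ
    have : 0 ≤ Nn * r₁ ^ 2 := by positivity
    have := hexp (M * (0 - l))
    simp only [hQ] at hval
    linarith
  -- the contact point and the test function in the original coordinates
  set s₁ := s + σ₁ * v + r₁ with hs₁
  set t₂ := t + σ₁ with ht₂
  set φ : ℝ × ℝ → ℝ := fun q => w s t + m' * (q.2 - t) + κ * Real.exp (M * (q.2 - t - l)) +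
    Nn * (q.1 - s - (q.2 - t) * v) ^ 2 with hφ
  have hφs : ContDiff ℝ 1 φ := by fun_prop
  have hmax : IsLocalMax (fun q : ℝ × ℝ => w q.1 q.2 - φ q) (s₁, t₂) := by
    have hopen : IsOpen
        {q : ℝ × ℝ | q.2 - t ∈ Ioo 0 l ∧ q.1 - s - (q.2 - t) * v ∈ Ioo (-r₀) r₀} := by
      refine IsOpen.inter (isOpen_Ioo.preimage (by fun_prop)) (isOpen_Ioo.preimage (by fun_prop))
    have hmem : (s₁, t₂) ∈ {q : ℝ × ℝ | q.2 - t ∈ Ioo 0 l ∧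
        q.1 - s - (q.2 - t) * v ∈ Ioo (-r₀) r₀} := by
      obtain ⟨h1, h2⟩ := abs_lt.1 (hr₁ρ.trans_le hρr)
      simp only [mem_ofPred_eq, hs₁, ht₂, mem_Ioo]
      refine ⟨⟨by linarith, by linarith⟩, by linarith, by linarith⟩
    filter_upwards [hopen.mem_nhds hmem] with q hq
    have hk : ∀ q : ℝ × ℝ, w q.1 q.2 - φ q = Q (q.2 - t, q.1 - s - (q.2 - t) * v) := by
      intro q
      have e1 : s + (q.2 - t) * v + (q.1 - s - (q.2 - t) * v) = q.1 := by ring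
      have e2 : t + (q.2 - t) = q.2 := by ring
      simp only [hQ, hG, hφ, e1, e2]; ring
    rw [hk q, show w s₁ t₂ - φ (s₁, t₂) = Q ((s₁, t₂).2 - t,
      (s₁, t₂).1 - s - ((s₁, t₂).2 - t) * v) from hk (s₁, t₂)]
    have e3 : ((s₁, t₂).2 - t, (s₁, t₂).1 - s - ((s₁, t₂).2 - t) * v) = (σ₁, r₁) := by
      simp only [hs₁, ht₂, Prod.mk.injEq]; constructor <;> ring
    rw [e3]
    exact hzmax ⟨Ioo_subset_Icc_self hq.1, Ioo_subset_Icc_self hq.2⟩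
  have hkey := hsup s₁ (hr σ₁ hσ₁ r₁ hr₁) t₂ (htt σ₁ hσ₁) φ hφs hmax
  have d1 : HasDerivAt (fun r => φ (s₁, r))
      (m' + κ * (Real.exp (M * (t₂ - t - l)) * M) +
        Nn * (2 * (s₁ - s - (t₂ - t) * v) * (-v))) t₂ := by
    have e1 : HasDerivAt (fun r : ℝ => w s t + m' * (r - t)) (m' * 1) t₂ :=
      (((hasDerivAt_id t₂).sub_const t).const_mul m').const_add _
    have e2 : HasDerivAt (fun r : ℝ => κ * Real.exp (M * (r - t - l)))
        (κ * (Real.exp (M * (t₂ - t - l)) * (M * 1))) t₂ :=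
      (((((hasDerivAt_id t₂).sub_const t).sub_const l).const_mul M).exp).const_mul κ
    have e3 : HasDerivAt (fun r : ℝ => Nn * (s₁ - s - (r - t) * v) ^ 2)
        (Nn * ((2 : ℕ) * (s₁ - s - (t₂ - t) * v) ^ (2 - 1) * (-(1 * v)))) t₂ :=
      (((((hasDerivAt_id t₂).sub_const t).mul_const v).const_sub (s₁ - s)).pow 2).const_mul Nn
    refine ((e1.add e2).add e3).congr_deriv ?_
    push_cast; ring
  have d2 : HasDerivAt (fun r => φ (r, t₂)) (Nn * (2 * (s₁ - s - (t₂ - t) * v))) s₁ := by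
    have e3 : HasDerivAt (fun r : ℝ => Nn * (r - s - (t₂ - t) * v) ^ 2)
        (Nn * ((2 : ℕ) * (s₁ - s - (t₂ - t) * v) ^ (2 - 1) * 1)) s₁ :=
      (((((hasDerivAt_id s₁).sub_const s).sub_const ((t₂ - t) * v))).pow 2).const_mul Nn
    refine (e3.const_add (w s t + m' * (t₂ - t) + κ * Real.exp (M * (t₂ - t - l)))).congr_deriv ?_
    push_cast; ring
  rw [d1.deriv, d2.deriv] at hkey
  have : 0 < κ * (Real.exp (M * (t₂ - t - l)) * M) := by positivity
  nlinarith

/-! ### Subsolutions on an arc in integrated form -/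

/-- The assumptions on the Hamiltonian of a single arc that matter for the argument. -/
structure IsArcHamiltonian (H : ℝ → ℝ → ℝ) : Prop where
  continuousOn : ContinuousOn (fun q : ℝ × ℝ => H q.1 q.2) (Icc 0 1 ×ˢ univ)
  convex : ∀ s ∈ Icc (0 : ℝ) 1, ConvexOn ℝ univ (H s)
  coercive : ∀ A : ℝ, ∃ R : ℝ, ∀ s ∈ Icc (0 : ℝ) 1, ∀ p : ℝ, R ≤ |p| → A ≤ H s p

namespace IsArcHamiltonian

variable {H : ℝ → ℝ → ℝ} (hH : IsArcHamiltonian H)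
include hH

theorem exists_bound (K : ℝ) :
    ∃ C, 0 ≤ C ∧ ∀ s ∈ Icc (0 : ℝ) 1, ∀ p, |p| ≤ K → |H s p| ≤ C := by
  have hc : IsCompact (Icc (0 : ℝ) 1 ×ˢ Icc (-K) K) := isCompact_Icc.prod isCompact_Icc
  obtain ⟨C, hC⟩ := hc.exists_bound_of_continuousOn
    (hH.continuousOn.mono (prod_mono_right (subset_univ _)))
  exact ⟨|C|, abs_nonneg C, fun s hs p hp => (hC (s, p) ⟨hs, abs_le.1 hp⟩).trans (le_abs_self C)⟩

theorem exists_neg_le : ∃ M, 0 ≤ M ∧ ∀ s ∈ Icc (0 : ℝ) 1, ∀ p, -H s p ≤ M := by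
  obtain ⟨R, hR⟩ := hH.coercive 0
  obtain ⟨C, hC0, hC⟩ := hH.exists_bound R
  refine ⟨C, hC0, fun s hs p => ?_⟩
  rcases le_total R |p| with h | h
  · linarith [hR s hs p h]
  · linarith [neg_abs_le (H s p), hC s hs p h]

/-- Convexity upgrades coercivity to a linear lower bound. -/
theorem exists_linear_le :
    ∃ α > 0, ∃ β, ∀ s ∈ Icc (0 : ℝ) 1, ∀ p, α * |p| - β ≤ H s p := by
  obtain ⟨M, hM0, hM⟩ := hH.exists_neg_le
  obtain ⟨C, hC0, hC⟩ := hH.exists_bound 0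
  obtain ⟨R', hR'⟩ := hH.coercive (C + 1)
  set R := max R' 1 with hR
  have hR0 : 0 < R := lt_of_lt_of_le one_pos (le_max_right _ _)
  refine ⟨1 / R, by positivity, 1 + M, fun s hs p => ?_⟩
  rcases le_total R |p| with h | h
  · have hp : 0 < |p| := hR0.trans_le h
    set θ := R / |p| with hθ
    have hθ0 : 0 < θ := by positivity
    have hθ1 : θ ≤ 1 := (div_le_one hp).2 h
    have hcv := (hH.convex s hs).2 (mem_univ 0) (mem_univ p) (sub_nonneg.2 hθ1) hθ0.le (by ring)
    simp only [smul_eq_mul, mul_zero, zero_add] at hcv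
    have h1 : C + 1 ≤ H s (θ * p) := by
      refine hR' s hs _ ?_
      rw [abs_mul, abs_of_pos hθ0, hθ, div_mul_cancel₀ _ hp.ne']
      exact le_max_left _ _
    have h2 : H s 0 ≤ C := (le_abs_self _).trans (hC s hs 0 (by simp))
    have h3 : (1 - θ) * H s 0 ≤ (1 - θ) * C := by
      apply mul_le_mul_of_nonneg_left h2; linarith
    have h4 : 1 ≤ θ * H s p := by nlinarith
    have h5 : 1 / R * |p| = 1 / θ := by rw [hθ]; field_simp
    have h6 : 1 / θ ≤ H s p := by rw [div_le_iff₀ hθ0]; linarith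
    linarith
  · have h1 : 1 / R * |p| ≤ 1 := by
      rw [one_div, inv_mul_le_iff₀ hR0]; linarith
    linarith [hM s hs p]

theorem uniformContinuousOn (R : ℝ) :
    UniformContinuousOn (fun q : ℝ × ℝ => H q.1 q.2) (Icc 0 1 ×ˢ Icc (-R) R) :=
  (isCompact_Icc.prod isCompact_Icc).uniformContinuousOn_of_continuous
    (hH.continuousOn.mono (prod_mono_right (subset_univ _)))

omit hH in
theorem _root_.ConvexOn.exists_subgradient {f : ℝ → ℝ} (hf : ConvexOn ℝ univ f) (x : ℝ) :
    ∃ v, ∀ y, f x + v * (y - x) ≤ f y := by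
  refine ⟨derivWithin f (Ioi x) x, fun y => ?_⟩
  have hint : ∀ z : ℝ, z ∈ interior (univ : Set ℝ) := by simp
  rcases lt_trichotomy y x with h | rfl | h
  · have h1 := hf.slope_le_leftDeriv_of_mem_interior (mem_univ y) (hint x) h
    have h2 := h1.trans (hf.leftDeriv_le_rightDeriv_of_mem_interior (hint x))
    rw [slope_def_field, div_le_iff₀ (by linarith)] at h2
    linarith
  · simp
  · have h1 := hf.rightDeriv_le_slope_of_mem_interior (hint x) (mem_univ y) h
    rw [slope_def_field, le_div_iff₀ (by linarith)] at h1
    linarith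

/-- Speeds that are almost optimal for `p₀` at `s`, with a bound on `p * v - H σ p` that is
uniform in *all* `p` and in `σ` near `s`. An exactly optimal speed may sit at the boundary of the
effective domain of the Legendre transform, where the bound can blow up under a change of `σ`;
shrinking it slightly towards `0` makes `p ↦ H s p - p * v` coercive. -/
theorem exists_speed (K : ℝ) {η : ℝ} (hη : 0 < η) :
    ∃ h > 0, ∀ s ∈ Icc (0 : ℝ) 1, ∀ p₀, |p₀| ≤ K → ∃ v, ∀ σ ∈ Icc (0 : ℝ) 1, |σ - s| ≤ h →
      ∀ p, p * v - H σ p ≤ p₀ * v - H s p₀ + η := by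
  obtain ⟨M, hM0, hM⟩ := hH.exists_neg_le
  obtain ⟨C, hC0, hC⟩ := hH.exists_bound K
  obtain ⟨R', hR'⟩ := hH.coercive (C + 1)
  set R := max R' (K + 1) with hR
  have hRR : R' ≤ R := le_max_left _ _
  have hRK : K + 1 ≤ R := le_max_right _ _
  set θ := min 1 (η / (2 * (C + M + 1))) with hθ
  have hθ0 : 0 < θ := lt_min one_pos (by positivity)
  have hθ1 : θ ≤ 1 := min_le_left _ _
  have hθη : θ * (C + M) ≤ η / 2 := by
    have : θ ≤ η / (2 * (C + M + 1)) := min_le_right _ _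
    rw [le_div_iff₀ (by positivity)] at this
    nlinarith
  set ω := min (θ / 2) (η / 2) with hω
  have hω0 : 0 < ω := lt_min (by positivity) (by positivity)
  have hωθ : ω ≤ θ / 2 := min_le_left _ _
  have hωη : ω ≤ η / 2 := min_le_right _ _
  obtain ⟨h, hh, huc⟩ := Metric.uniformContinuousOn_iff.1 (hH.uniformContinuousOn R) ω hω0
  refine ⟨h / 2, by positivity, fun s hs p₀ hp₀ => ?_⟩
  obtain ⟨v₀, hv₀⟩ := (hH.convex s hs).exists_subgradient p₀
  refine ⟨(1 - θ) * v₀, fun σ hσ hσs p => ?_⟩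
  set v := (1 - θ) * v₀ with hv
  have hp₀' := abs_le.1 hp₀
  have hclose : ∀ p, |p| ≤ R → |H σ p - H s p| < ω := by
    intro p hp
    have := huc (σ, p) ⟨hσ, abs_le.1 hp⟩ (s, p) ⟨hs, abs_le.1 hp⟩ (by
      rw [Prod.dist_eq, dist_self, Real.dist_eq, max_eq_left (abs_nonneg _)]; linarith)
    rwa [Real.dist_eq] at this
  have hHp₀ := abs_le.1 (hC s hs p₀ hp₀)
  -- the shrunk speed makes `H s p - p * v` grow relative to its value at `p₀`
  have hF : ∀ p, θ * (H s p - H s p₀) ≤ (H s p - p * v) - (H s p₀ - p₀ * v) := by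
    intro p
    have := mul_le_mul_of_nonneg_left (hv₀ p) (sub_nonneg.2 hθ1)
    rw [hv]; linarith
  have hGc : ConvexOn ℝ univ (fun p => H σ p - p * v) := by
    have h1 := (hH.convex σ hσ).add ((LinearMap.mulRight ℝ (-v)).convexOn convex_univ)
    refine h1.congr fun p _ => ?_
    simp [sub_eq_add_neg]
  have hp₀R : |p₀| ≤ R := by linarith
  have hG₀ := abs_lt.1 (hclose p₀ hp₀R)
  -- both ends of `[-R, R]` lie above the value at `p₀`, so that convexity controls the outside
  have hend : ∀ r, |r| = R → H s p₀ - p₀ * v ≤ H σ r - r * v ∧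
      H σ p₀ - p₀ * v ≤ H σ r - r * v := by
    intro r hr
    have h1 := hF r
    have h2 := hR' s hs r (by rw [hr]; exact hRR)
    have h3 := abs_lt.1 (hclose r hr.le)
    have h4 : θ * 1 ≤ θ * (H s r - H s p₀) := mul_le_mul_of_nonneg_left (by linarith) hθ0.le
    constructor <;> linarith
  have hRpos : 0 < R := by linarith [abs_nonneg p₀]
  suffices hs : H s p₀ - p₀ * v - η ≤ H σ p - p * v by linarith
  rcases le_or_gt |p| R with hp | hp
  · have h1 := hF p
    have h2 := abs_lt.1 (hclose p hp)
    have h3 := hM s hs p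
    have h4 : θ * (-(C + M)) ≤ θ * (H s p - H s p₀) :=
      mul_le_mul_of_nonneg_left (by linarith) hθ0.le
    linarith
  · rcases lt_abs.1 hp with hp | hp
    · obtain ⟨e1, e2⟩ := hend R (abs_of_pos hRpos)
      have := hGc.le_right_of_left_le (mem_univ p₀) (mem_univ p) (z := R)
        (by rw [openSegment_eq_Ioo (by linarith)]; constructor <;> linarith) e2
      linarith
    · obtain ⟨e1, e2⟩ := hend (-R) (by rw [abs_neg, abs_of_pos hRpos])
      have := hGc.le_left_of_right_le (mem_univ p) (mem_univ p₀) (z := -R)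
        (by rw [openSegment_eq_Ioo (by linarith)]; constructor <;> linarith) e2
      linarith

end IsArcHamiltonian

theorem deriv_slice_snd {φ : ℝ × ℝ → ℝ} (hφ : ContDiff ℝ 1 φ) (s t : ℝ) :
    HasDerivAt (fun r => φ (s, r)) (fderiv ℝ φ (s, t) (0, 1)) t := by
  have h1 := (hφ.differentiable one_ne_zero (s, t)).hasFDerivAt
  exact h1.comp_hasDerivAt t ((hasDerivAt_const t s).prodMk (hasDerivAt_id t))

theorem deriv_slice_fst {φ : ℝ × ℝ → ℝ} (hφ : ContDiff ℝ 1 φ) (s t : ℝ) :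
    HasDerivAt (fun r => φ (r, t)) (fderiv ℝ φ (s, t) (1, 0)) s := by
  have h1 := (hφ.differentiable one_ne_zero (s, t)).hasFDerivAt
  exact h1.comp_hasDerivAt s ((hasDerivAt_id s).prodMk (hasDerivAt_const s t))

/-- Subsolutions on an arc in integrated form: along a segment of direction `(v, 1)` in
`[a, b] × [T₀, T₁)`, the function grows at most at rate `sup {p v - H(σ, p) : σ ∈ [a, b], p ∈ ℝ}`
(the bound is void where this supremum is infinite). No continuity is required. In this form the
class of subsolutions is stable under suprema, translations in time, averages, and concatenation
in time. -/
def IsArcSub (H : ℝ → ℝ → ℝ) (T₀ : ℝ) (T₁ : EReal) (w : ℝ → ℝ → ℝ) : Prop :=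
  ∀ a b, 0 ≤ a → a < b → b ≤ 1 → ∀ v m, (∀ σ ∈ Icc a b, ∀ p, p * v - H σ p ≤ m) →
    ∀ s ∈ Icc a b, ∀ t, T₀ ≤ t → ∀ l, 0 ≤ l → s + l * v ∈ Icc a b → ((t + l : ℝ) : EReal) < T₁ →
      w (s + l * v) (t + l) ≤ w s t + l * m

theorem EReal.coe_lt_of_le_of_lt {x y : ℝ} {T : EReal} (h : x ≤ y) (hy : (y : EReal) < T) :
    (x : EReal) < T :=
  (EReal.coe_le_coe_iff.2 h).trans_lt hy

theorem EReal.exists_gt_coe_lt {x : ℝ} {T : EReal} (h : (x : EReal) < T) :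
    ∃ y : ℝ, x < y ∧ (y : EReal) < T := by
  obtain ⟨y, h1, h2⟩ := EReal.exists_between_coe_real h
  exact ⟨y, by exact_mod_cast h1, h2⟩

/-- Continuous viscosity subsolutions are subsolutions in integrated form, up to the end points of
the arc and up to the initial time. -/
theorem IsViscositySubsolution.isArcSub {H : ℝ → ℝ → ℝ} (hH : IsArcHamiltonian H) {T₀ : ℝ}
    {T₁ : EReal} {w : ℝ → ℝ → ℝ}
    (hw : ContinuousOn (fun q : ℝ × ℝ => w q.1 q.2) (Icc 0 1 ×ˢ timeIco T₀ T₁))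
    (h : IsViscositySubsolution H T₀ T₁ (fun q => w q.1 q.2)) : IsArcSub H T₀ T₁ w := by
  intro a b ha hab hb v m hm s hs t ht l hl hs' htl
  rcases hl.eq_or_lt with rfl | hl0
  · simp
  obtain ⟨M, hM0, hM⟩ := hH.exists_neg_le
  obtain ⟨T, hT, hTT⟩ := EReal.exists_gt_coe_lt htl
  set c := (a + b) / 2 with hc
  -- segments contracted towards the centre of `[a, b]` and shifted forward in time
  have key : ∀ ε ∈ Ioo (0 : ℝ) 1,
      w ((1 - ε) * s + ε * c + l * ((1 - ε) * v)) (t + ε * ((T - (t + l)) / 2) + l) ≤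
        w ((1 - ε) * s + ε * c) (t + ε * ((T - (t + l)) / 2)) + l * ((1 - ε) * m + ε * M) := by
    intro ε hε
    obtain ⟨hε0, hε1⟩ := hε
    have hmem : ∀ x ∈ Icc a b, (1 - ε) * x + ε * c ∈ Ioo a b := by
      intro x hx
      obtain ⟨h1, h2⟩ := hx
      have := mul_le_mul_of_nonneg_left h1 (by linarith : 0 ≤ 1 - ε)
      have := mul_le_mul_of_nonneg_left h2 (by linarith : 0 ≤ 1 - ε)
      have := mul_pos hε0 (by linarith : 0 < b - a)
      constructor <;> rw [hc] <;> linarith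
    have hd : 0 < ε * ((T - (t + l)) / 2) := mul_pos hε0 (by linarith)
    have hd' : ε * ((T - (t + l)) / 2) < T - (t + l) := by nlinarith
    refine increment_le_of_supertangent (a := a) (b := b) (t₀ := T₀) (t₁ := T) ?_ ?_ hl
      (hmem s hs) ?_ ⟨by linarith, by linarith⟩ ⟨by linarith, by linarith⟩
    · refine hw.mono (prod_mono ?_ ?_)
      · exact fun x hx => ⟨ha.trans hx.1.le, hx.2.le.trans hb⟩
      · exact fun x hx => ⟨hx.1.le, EReal.coe_lt_of_le_of_lt hx.2.le hTT⟩
    · intro s₁ hs₁ t₁ ht₁ φ hφ hmax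
      have h1 := h s₁ ⟨ha.trans_lt hs₁.1, hs₁.2.trans_le hb⟩ t₁
        ⟨ht₁.1, EReal.coe_lt_of_le_of_lt ht₁.2.le hTT⟩ φ hφ hmax
      set p := deriv (fun r => φ (r, t₁)) s₁
      have h2 := mul_le_mul_of_nonneg_left (hm s₁ ⟨hs₁.1.le, hs₁.2.le⟩ p)
        (by linarith : 0 ≤ 1 - ε)
      have h3 := mul_le_mul_of_nonneg_left
        (hM s₁ ⟨ha.trans hs₁.1.le, hs₁.2.le.trans hb⟩ p) hε0.le
      nlinarith
    · have e : (1 - ε) * s + ε * c + l * ((1 - ε) * v) = (1 - ε) * (s + l * v) + ε * c := by ring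
      rw [e]
      exact hmem _ hs'
  have hlim : ∀ x ∈ Icc a b, ∀ t', T₀ ≤ t' → t' ≤ t + l → ∀ f : ℝ → ℝ, Continuous f → f 0 = x →
      (∀ ε ∈ Ioo (0 : ℝ) 1, f ε ∈ Icc a b) →
      Tendsto (fun ε => w (f ε) (t' + ε * ((T - (t + l)) / 2))) (𝓝[>] 0) (𝓝 (w x t')) := by
    intro x hx t' ht' ht'' f hf hf0 hfm
    have h1 := hw (x, t') ⟨⟨ha.trans hx.1, hx.2.trans hb⟩, ht',
      EReal.coe_lt_of_le_of_lt ht'' htl⟩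
    refine Tendsto.comp (g := fun q : ℝ × ℝ => w q.1 q.2)
      (f := fun ε => (f ε, t' + ε * ((T - (t + l)) / 2))) h1 ?_
    refine tendsto_nhdsWithin_iff.2 ⟨?_, ?_⟩
    · have h2 : Continuous (fun ε => (f ε, t' + ε * ((T - (t + l)) / 2))) := by fun_prop
      have h3 := h2.tendsto 0
      simp only [hf0, zero_mul, add_zero] at h3
      exact h3.mono_left nhdsWithin_le_nhds
    · filter_upwards [Ioo_mem_nhdsGT one_pos] with ε hε
      have h4 := hfm ε hε
      have hd : 0 < ε * ((T - (t + l)) / 2) := mul_pos hε.1 (by linarith)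
      have hd' : ε * ((T - (t + l)) / 2) < T - (t + l) := by nlinarith [hε.2]
      exact ⟨⟨ha.trans h4.1, h4.2.trans hb⟩, by linarith,
        EReal.coe_lt_of_le_of_lt (by linarith) hTT⟩
  have hmemc : ∀ x ∈ Icc a b, ∀ ε ∈ Ioo (0 : ℝ) 1, (1 - ε) * x + ε * c ∈ Icc a b := by
    intro x hx ε hε
    have := (convex_Icc a b) hx (⟨by linarith, by linarith⟩ : c ∈ Icc a b)
      (by linarith [hε.2] : 0 ≤ 1 - ε) hε.1.le (by ring)
    simpa using this
  have hL := hlim (s + l * v) hs' (t + l) (by linarith) le_rfl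
    (fun ε => (1 - ε) * s + ε * c + l * ((1 - ε) * v)) (by fun_prop) (by ring) (by
      intro ε hε
      have := hmemc _ hs' ε hε
      convert this using 1; ring)
  have hR := hlim s hs t ht (by linarith)
    (fun ε => (1 - ε) * s + ε * c) (by fun_prop) (by ring) (hmemc s hs)
  have hRm : Tendsto (fun ε : ℝ => l * ((1 - ε) * m + ε * M)) (𝓝[>] 0) (𝓝 (l * m)) := by
    have h2 : Continuous (fun ε : ℝ => l * ((1 - ε) * m + ε * M)) := by fun_prop
    have h3 := h2.tendsto 0
    simp only [sub_zero, one_mul, zero_mul, add_zero] at h3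
    exact h3.mono_left nhdsWithin_le_nhds
  refine le_of_tendsto_of_tendsto hL (hR.add hRm) ?_
  filter_upwards [Ioo_mem_nhdsGT one_pos] with ε hε
  have e : t + l + ε * ((T - (t + l)) / 2) = t + ε * ((T - (t + l)) / 2) + l := by ring
  rw [e]
  exact key ε hε

/-- A `C¹` function that touches a subsolution in integrated form from above satisfies the
differential inequality; only earlier times matter. -/
theorem IsArcSub.isViscositySubsolution {H : ℝ → ℝ → ℝ} (hH : IsArcHamiltonian H) {T₀ : ℝ}
    {T₁ : EReal} {w : ℝ → ℝ → ℝ} (h : IsArcSub H T₀ T₁ w) :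
    IsViscositySubsolution H T₀ T₁ (fun q => w q.1 q.2) := by
  intro s hs t ht φ hφ hmax
  rw [(deriv_slice_snd hφ s t).deriv, (deriv_slice_fst hφ s t).deriv]
  set p₀ := fderiv ℝ φ (s, t) (1, 0) with hp₀
  refine le_of_forall_pos_le_add fun η hη => ?_
  obtain ⟨d, hd, hsp⟩ := hH.exists_speed |p₀| hη
  obtain ⟨v, hv⟩ := hsp s ⟨hs.1.le, hs.2.le⟩ p₀ le_rfl
  set a := max 0 (s - d) with ha
  set b := min 1 (s + d) with hb
  have has : a < s := max_lt hs.1 (by linarith)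
  have hsb : s < b := lt_min hs.2 (by linarith)
  have hm : ∀ σ ∈ Icc a b, ∀ p, p * v - H σ p ≤ p₀ * v - H s p₀ + η := by
    intro σ hσ
    have h1 := (le_max_left _ _).trans hσ.1
    have h2 := (le_max_right _ _).trans hσ.1
    have h3 := hσ.2.trans (min_le_left _ _)
    have h4 := hσ.2.trans (min_le_right _ _)
    exact hv σ ⟨h1, h3⟩ (abs_le.2 ⟨by linarith, by linarith⟩)
  set m := p₀ * v - H s p₀ + η with hmdef
  -- the derivative of `φ` along the direction `(v, 1)`, taken backwards
  have hder : HasDerivAt (fun r => φ (s - r * v, t - r))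
      (-(fderiv ℝ φ (s, t) (0, 1) + v * p₀)) 0 := by
    have h1 := (hφ.differentiable one_ne_zero (s, t)).hasFDerivAt
    have h2 : HasDerivAt (fun r : ℝ => (s - r * v, t - r)) (-v, -1) 0 := by
      have e1 : HasDerivAt (fun r : ℝ => s - r * v) (-(1 * v)) 0 :=
        ((hasDerivAt_id (0 : ℝ)).mul_const v).const_sub s
      have e2 : HasDerivAt (fun r : ℝ => t - r) (-1) 0 := (hasDerivAt_id (0 : ℝ)).const_sub t
      simpa using e1.prodMk e2
    have h3 : HasFDerivAt φ (fderiv ℝ φ (s, t)) (s - 0 * v, t - 0) := by simpa using h1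
    refine (h3.comp_hasDerivAt 0 h2).congr_deriv ?_
    have : ((-v, -1) : ℝ × ℝ) = (-v) • (1, 0) + (-1 : ℝ) • (0, 1) := by simp
    rw [this, map_add, map_smul, map_smul, smul_eq_mul, smul_eq_mul, ← hp₀]
    ring
  have hev : ∀ᶠ r in 𝓝[>] (0 : ℝ), -m ≤ slope (fun r => φ (s - r * v, t - r)) 0 r := by
    have hcont : Continuous (fun r : ℝ => (s - r * v, t - r)) := by fun_prop
    have h1 : ∀ᶠ r in 𝓝 (0 : ℝ), w (s - r * v) (t - r) - φ (s - r * v, t - r) ≤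
        w s t - φ (s, t) := by
      have := hcont.tendsto 0
      simp only [zero_mul, sub_zero] at this
      exact this.eventually hmax
    have h2 : ∀ᶠ r in 𝓝 (0 : ℝ), s - r * v ∈ Ioo a b := by
      have hc : Continuous (fun r : ℝ => s - r * v) := by fun_prop
      have := hc.tendsto 0
      simp only [zero_mul, sub_zero] at this
      exact this.eventually (Ioo_mem_nhds has hsb)
    have h3 : ∀ᶠ r in 𝓝 (0 : ℝ), T₀ < t - r := by
      have hc : Continuous (fun r : ℝ => t - r) := by fun_prop
      have := hc.tendsto 0
      simp only [sub_zero] at this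
      exact this.eventually (lt_mem_nhds ht.1)
    filter_upwards [h1.filter_mono nhdsWithin_le_nhds, h2.filter_mono nhdsWithin_le_nhds,
      h3.filter_mono nhdsWithin_le_nhds, self_mem_nhdsWithin] with r h1 h2 h3 hr
    have hr0 : (0 : ℝ) < r := hr
    have h4 := h a b (le_max_left _ _) (has.trans hsb) (min_le_left _ _) v m hm (s - r * v)
      ⟨h2.1.le, h2.2.le⟩ (t - r) h3.le r hr0.le
      (by rw [sub_add_cancel]; exact ⟨has.le, hsb.le⟩) (by rw [sub_add_cancel]; exact ht.2)
    rw [sub_add_cancel, sub_add_cancel] at h4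
    rw [slope_def_field, le_div_iff₀ (by linarith)]
    simp only [zero_mul, sub_zero]
    linarith
  have hlim : Tendsto (slope (fun r => φ (s - r * v, t - r)) 0) (𝓝[>] 0)
      (𝓝 (-(fderiv ℝ φ (s, t) (0, 1) + v * p₀))) :=
    (hasDerivAt_iff_tendsto_slope.1 hder).mono_left (nhdsWithin_mono _ fun r hr => ne_of_gt hr)
  have := ge_of_tendsto hlim hev
  rw [hmdef] at this
  linarith

/-! ### Local modifications of subsolutions, and subtangents at the end of an arc -/

/-- Raising a subsolution to the maximum with `F` on a box `[a₀, b₀] × [t₁, t₂]` yields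
a subsolution, provided that `F` is a subsolution in the box and does not exceed `w` at the initial
time of the box and on those of its sides that are not end points of the arc. The drop back to `w`
after time `t₂` is harmless. -/
theorem IsArcSub.max_box {H : ℝ → ℝ → ℝ} {T₀ : ℝ} {T₁ : EReal} {w F : ℝ → ℝ → ℝ}
    (hw : IsArcSub H T₀ T₁ w) {a₀ b₀ t₁ t₂ : ℝ}
    (hF : ∀ v m, ∀ s ∈ Icc a₀ b₀, (∀ p, p * v - H s p ≤ m) → ∀ t l, 0 ≤ l →
      s + l * v ∈ Icc a₀ b₀ → t₁ ≤ t → t + l ≤ t₂ → F (s + l * v) (t + l) ≤ F s t + l * m)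
    (hbot : ∀ s ∈ Icc a₀ b₀, F s t₁ ≤ w s t₁)
    (hleft : 0 < a₀ → ∀ t ∈ Icc t₁ t₂, F a₀ t ≤ w a₀ t)
    (hright : b₀ < 1 → ∀ t ∈ Icc t₁ t₂, F b₀ t ≤ w b₀ t) {w' : ℝ → ℝ → ℝ}
    (hin : ∀ s ∈ Icc (0 : ℝ) 1, ∀ t, s ∈ Icc a₀ b₀ → t ∈ Icc t₁ t₂ →
      w' s t = max (w s t) (F s t))
    (hout : ∀ s ∈ Icc (0 : ℝ) 1, ∀ t, ¬ (s ∈ Icc a₀ b₀ ∧ t ∈ Icc t₁ t₂) → w' s t = w s t) :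
    IsArcSub H T₀ T₁ w' := by
  intro a b ha hab hb v m hm s hs t ht l hl hs' htl
  have hunit : ∀ x ∈ Icc a b, x ∈ Icc (0 : ℝ) 1 := fun x hx => ⟨ha.trans hx.1, hx.2.trans hb⟩
  have hle : w s t ≤ w' s t := by
    by_cases h : s ∈ Icc a₀ b₀ ∧ t ∈ Icc t₁ t₂
    · rw [hin s (hunit s hs) t h.1 h.2]; exact le_max_left _ _
    · rw [hout s (hunit s hs) t h]
  have hbase := hw a b ha hab hb v m hm s hs t ht l hl hs' htl
  by_cases hend : s + l * v ∈ Icc a₀ b₀ ∧ t + l ∈ Icc t₁ t₂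
  swap
  · rw [hout _ (hunit _ hs') _ hend]; linarith
  rw [hin _ (hunit _ hs') _ hend.1 hend.2]
  refine max_le (by linarith) ?_
  by_cases hst : s ∈ Icc a₀ b₀ ∧ t ∈ Icc t₁ t₂
  · have h1 := hF v m s hst.1 (hm s hs) t l hl hend.1 hst.2.1 hend.2.2
    have h2 : F s t ≤ w' s t := by
      rw [hin s (hunit s hs) t hst.1 hst.2]; exact le_max_right _ _
    linarith
  -- the segment enters the box at a first time `τ`, where `F ≤ w`
  set A : Set ℝ := {τ | τ ∈ Icc 0 l ∧ s + τ * v ∈ Icc a₀ b₀ ∧ t + τ ∈ Icc t₁ t₂} with hA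
  have hAc : IsCompact A := by
    refine isCompact_Icc.of_isClosed_subset ?_ (fun τ hτ => hτ.1)
    exact isClosed_Icc.inter ((isClosed_Icc.preimage (by fun_prop)).inter
      (isClosed_Icc.preimage (by fun_prop)))
  obtain ⟨τ, hτA, hτ⟩ := hAc.exists_isLeast ⟨l, ⟨hl, le_rfl⟩, hend.1, hend.2⟩
  obtain ⟨⟨hτ0, hτl⟩, hτs, hτt⟩ := hτA
  have hτpos : 0 < τ := by
    refine hτ0.lt_of_ne ?_
    rintro rfl
    simp only [zero_mul, add_zero] at hτs hτt
    exact hst ⟨hτs, hτt⟩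
  have hseg : ∀ τ' ∈ Icc 0 l, s + τ' * v ∈ Icc a b := by
    intro τ' hτ'
    rcases le_total 0 v with hv | hv
    · have e1 : τ' * v ≤ l * v := mul_le_mul_of_nonneg_right hτ'.2 hv
      have e2 : 0 ≤ τ' * v := mul_nonneg hτ'.1 hv
      exact ⟨by linarith [hs.1], by linarith [hs'.2]⟩
    · have e1 : l * v ≤ τ' * v := mul_le_mul_of_nonpos_right hτ'.2 hv
      have e2 : τ' * v ≤ 0 := mul_nonpos_of_nonneg_of_nonpos hτ'.1 hv
      exact ⟨by linarith [hs'.1], by linarith [hs.2]⟩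
  have hsτ := hseg τ ⟨hτ0, hτl⟩
  have hcross : F (s + τ * v) (t + τ) ≤ w (s + τ * v) (t + τ) := by
    by_contra! hcon
    have h1 : t₁ < t + τ := by
      refine hτt.1.lt_of_ne fun h => ?_
      rw [← h] at hcon
      exact absurd (hbot _ hτs) (not_le.2 hcon)
    have h2 : 0 < a₀ → a₀ < s + τ * v := by
      intro h
      refine hτs.1.lt_of_ne fun h' => ?_
      rw [← h'] at hcon
      exact absurd (hleft h _ hτt) (not_le.2 hcon)
    have h3 : b₀ < 1 → s + τ * v < b₀ := by
      intro h
      refine hτs.2.lt_of_ne fun h' => ?_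
      rw [h'] at hcon
      exact absurd (hright h _ hτt) (not_le.2 hcon)
    have hc : Continuous (fun τ' : ℝ => s + τ' * v) := by fun_prop
    have hc' : Continuous (fun τ' : ℝ => t + τ') := by fun_prop
    have e1 : ∀ᶠ τ' in 𝓝[<] τ, t₁ < t + τ' :=
      ((hc'.tendsto τ).eventually (lt_mem_nhds h1)).filter_mono nhdsWithin_le_nhds
    have e2 : ∀ᶠ τ' in 𝓝[<] τ, 0 < a₀ → a₀ < s + τ' * v := by
      by_cases h : 0 < a₀
      · exact (((hc.tendsto τ).eventually (lt_mem_nhds (h2 h))).filter_mono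
          nhdsWithin_le_nhds).mono fun _ h _ => h
      · exact Eventually.of_forall fun _ h' => absurd h' h
    have e3 : ∀ᶠ τ' in 𝓝[<] τ, b₀ < 1 → s + τ' * v < b₀ := by
      by_cases h : b₀ < 1
      · exact (((hc.tendsto τ).eventually (gt_mem_nhds (h3 h))).filter_mono
          nhdsWithin_le_nhds).mono fun _ h _ => h
      · exact Eventually.of_forall fun _ h' => absurd h' h
    obtain ⟨τ', ⟨⟨e1, e2⟩, e3⟩, e4⟩ :=
      (((e1.and e2).and e3).and (Ioo_mem_nhdsLT hτpos)).exists
    have hs'' := hunit _ (hseg τ' ⟨e4.1.le, e4.2.le.trans hτl⟩)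
    refine absurd (hτ ⟨⟨e4.1.le, e4.2.le.trans hτl⟩, ⟨?_, ?_⟩, e1.le, ?_⟩) (not_le.2 e4.2)
    · by_cases h : 0 < a₀
      · exact (e2 h).le
      · linarith [hs''.1]
    · by_cases h : b₀ < 1
      · exact (e3 h).le
      · linarith [hs''.2]
    · linarith [hτt.2, e4.2]
  have e1 : s + l * v = s + τ * v + (l - τ) * v := by ring
  have e2 : t + l = t + τ + (l - τ) := by ring
  have h1 := hF v m (s + τ * v) hτs (hm _ hsτ) (t + τ) (l - τ) (by linarith)
    (by rw [← e1]; exact hend.1) hτt.1 (by rw [← e2]; exact hend.2.2)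
  rw [← e1, ← e2] at h1
  have h2 := hw a b ha hab hb v m hm s hs t ht τ hτ0 hsτ
    (EReal.coe_lt_of_le_of_lt (by linarith) htl)
  linarith

set_option maxHeartbeats 1000000 in
/-- At an end point of an arc, the time slope of a strict subtangent can be lowered to that of any
subtangent `ψ` of the boundary trace, with the same space slope. If this failed, then along the
homotopy `φ + θ (ψ - φ(1, ·))`, whose values at the end point stay below `w` throughout, the test
functions would stop being subtangents; the contact points leave the end point, and contradict the
supersolution property inside the arc. -/
theorem IsViscositySupersolution.tilt {H : ℝ → ℝ → ℝ} (hH : IsArcHamiltonian H) {T₀ : ℝ}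
    {T₁ : EReal} {w : ℝ → ℝ → ℝ}
    (hw : ContinuousOn (fun q : ℝ × ℝ => w q.1 q.2) (Icc 0 1 ×ˢ timeIco T₀ T₁))
    (h : IsViscositySupersolution H T₀ T₁ (fun q => w q.1 q.2)) {t₀ : ℝ}
    (ht₀ : t₀ ∈ timeIoo T₀ T₁) {φ : ℝ × ℝ → ℝ} (hφ : ContDiff ℝ 1 φ)
    (hmin : IsLocalMinOn (fun q : ℝ × ℝ => w q.1 q.2 - φ q) (Icc 0 1 ×ˢ timeIco T₀ T₁) (1, t₀))
    (hneg : deriv (fun t => φ (1, t)) t₀ + H 1 (deriv (fun s => φ (s, t₀)) 1) < 0)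
    {ψ : ℝ → ℝ} (hψ : ContDiff ℝ 1 ψ) (hψmin : IsLocalMin (fun t => w 1 t - ψ t) t₀)
    (hle : deriv ψ t₀ ≤ deriv (fun t => φ (1, t)) t₀) :
    ∀ ε > 0, ∃ r > 0, ∀ s ∈ Icc (1 - r) 1, ∀ t ∈ Icc (t₀ - r) (t₀ + r),
      w 1 t₀ + deriv (fun s => φ (s, t₀)) 1 * (s - 1) + deriv ψ t₀ * (t - t₀)
        - ε * ((1 - s) + |t - t₀|) ≤ w s t := by
  rw [(deriv_slice_snd hφ 1 t₀).deriv, (deriv_slice_fst hφ 1 t₀).deriv] at *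
  have hfd : Continuous (fderiv ℝ φ) := hφ.continuous_fderiv one_ne_zero
  have hdψ : Continuous (deriv ψ) := hψ.continuous_deriv le_rfl
  obtain ⟨T, hT, hTT⟩ := EReal.exists_gt_coe_lt ht₀.2
  -- room in the strict inequality, uniform with respect to small perturbations
  obtain ⟨μ, hμ0, hμ⟩ : ∃ μ > 0, ∀ s ∈ Icc (1 - μ) 1, s ∈ Icc (0 : ℝ) 1 → ∀ t,
      |t - t₀| ≤ μ → ∀ y, |y| ≤ μ →
      fderiv ℝ φ (s, t) (0, 1) + 2 * μ + H s (fderiv ℝ φ (s, t) (1, 0) + y) < 0 := by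
    set D : Set (ℝ × ℝ × ℝ × ℝ) := Icc (0 : ℝ) 1 ×ˢ univ with hD
    have hc : ContinuousOn (fun z : ℝ × ℝ × ℝ × ℝ => fderiv ℝ φ (z.1, z.2.1) (0, 1) + z.2.2.1 +
        H z.1 (fderiv ℝ φ (z.1, z.2.1) (1, 0) + z.2.2.2)) D := by
      have h1 : Continuous (fun z : ℝ × ℝ × ℝ × ℝ => fderiv ℝ φ (z.1, z.2.1)) := by fun_prop
      refine ContinuousOn.add (by fun_prop) ?_
      refine hH.continuousOn.comp (f := fun z : ℝ × ℝ × ℝ × ℝ =>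
        (z.1, fderiv ℝ φ (z.1, z.2.1) (1, 0) + z.2.2.2)) (by fun_prop) ?_
      exact fun z hz => ⟨hz.1, mem_univ _⟩
    have h1 := (hc (1, t₀, 0, 0) ⟨⟨zero_le_one, le_rfl⟩, mem_univ _⟩).eventually_lt_const
      (u := 0) (by simpa using hneg)
    rw [eventually_nhdsWithin_iff] at h1
    obtain ⟨δ, hδ, h2⟩ := Metric.eventually_nhds_iff.1 h1
    refine ⟨δ / 4, by positivity, fun s hs hs1 t ht y hy => ?_⟩
    have := h2 (y := (s, t, 2 * (δ / 4), y)) (by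
      simp only [Prod.dist_eq, Real.dist_eq, sub_zero]
      refine max_lt ?_ (max_lt (by linarith) (max_lt ?_ (by linarith)))
      · rw [abs_lt]; constructor <;> linarith [hs.1, hs.2]
      · rw [abs_lt]; constructor <;> linarith) ⟨hs1, mem_univ _⟩
    simpa using this
  set D : ℝ → ℝ := fun t => ψ t - ψ t₀ - (φ (1, t) - φ (1, t₀)) with hDdef
  have hD : ∀ t, HasDerivAt D (deriv ψ t - fderiv ℝ φ (1, t) (0, 1)) t := fun t =>
    (((hψ.differentiable one_ne_zero t).hasDerivAt.sub_const _).sub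
      ((deriv_slice_snd hφ 1 t).sub_const _))
  obtain ⟨Λ, hΛ0, hΛ⟩ : ∃ Λ, 0 ≤ Λ ∧ ∀ᶠ t in 𝓝 t₀, |D t| ≤ Λ * |t - t₀| := by
    obtain ⟨Λ, hΛ⟩ := (hD t₀).isBigO_sub.bound
    refine ⟨|Λ|, abs_nonneg _, hΛ.mono fun t ht => ?_⟩
    have h0 : D t₀ = 0 := by simp [hDdef]
    rw [h0, sub_zero, Real.norm_eq_abs, Real.norm_eq_abs] at ht
    exact ht.trans (mul_le_mul_of_nonneg_right (le_abs_self Λ) (abs_nonneg _))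
  -- a box in which all the local conditions hold
  obtain ⟨r₀, hr₀, hr₀1, hr₀μ, hr₀T, hr₀T', hb⟩ : ∃ r₀ > 0, r₀ < 1 ∧ r₀ ≤ μ ∧ T₀ < t₀ - r₀ ∧
      t₀ + r₀ < T ∧ ∀ t ∈ Icc (t₀ - r₀) (t₀ + r₀),
      (∀ s ∈ Icc (1 - r₀) 1, w 1 t₀ + (φ (s, t) - φ (1, t₀)) ≤ w s t) ∧
      w 1 t₀ + (ψ t - ψ t₀) ≤ w 1 t ∧ |D t| ≤ Λ * |t - t₀| ∧
      deriv ψ t - fderiv ℝ φ (1, t) (0, 1) ≤ μ := by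
    have e1 : ∀ᶠ t in 𝓝 t₀, w 1 t₀ + (ψ t - ψ t₀) ≤ w 1 t := hψmin.mono fun t ht => by linarith
    have e2 : ∀ᶠ t in 𝓝 t₀, deriv ψ t - fderiv ℝ φ (1, t) (0, 1) ≤ μ := by
      have hc : Continuous (fun t => deriv ψ t - fderiv ℝ φ (1, t) (0, 1)) := by fun_prop
      have : deriv ψ t₀ - fderiv ℝ φ (1, t₀) (0, 1) < μ := by linarith
      exact ((hc.tendsto t₀).eventually (gt_mem_nhds this)).mono fun _ h => h.le
    obtain ⟨δ₁, hδ₁, h1⟩ := Metric.eventually_nhds_iff.1 ((e1.and hΛ).and e2)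
    have e3 := eventually_nhdsWithin_iff.1 hmin
    obtain ⟨δ₂, hδ₂, h2⟩ := Metric.eventually_nhds_iff.1 e3
    set d := min (min (min δ₁ δ₂) (min 1 μ)) (min (t₀ - T₀) (T - t₀)) with hd
    have hd0 : 0 < d := by
      have := ht₀.1
      simp only [hd, lt_min_iff]
      refine ⟨⟨⟨hδ₁, hδ₂⟩, one_pos, hμ0⟩, ?_, ?_⟩ <;> linarith
    have d1 : d ≤ δ₁ := (min_le_left _ _).trans ((min_le_left _ _).trans (min_le_left _ _))
    have d2 : d ≤ δ₂ := (min_le_left _ _).trans ((min_le_left _ _).trans (min_le_right _ _))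
    have d3 : d ≤ 1 := (min_le_left _ _).trans ((min_le_right _ _).trans (min_le_left _ _))
    have d4 : d ≤ μ := (min_le_left _ _).trans ((min_le_right _ _).trans (min_le_right _ _))
    have d5 : d ≤ t₀ - T₀ := (min_le_right _ _).trans (min_le_left _ _)
    have d6 : d ≤ T - t₀ := (min_le_right _ _).trans (min_le_right _ _)
    refine ⟨d / 2, by linarith, by linarith, by linarith, by linarith, by linarith,
      fun t ht => ?_⟩
    have htd : |t - t₀| ≤ d / 2 := abs_le.2 ⟨by linarith [ht.1], by linarith [ht.2]⟩
    obtain ⟨⟨e1, e2⟩, e3⟩ := h1 (y := t) (by rw [Real.dist_eq]; linarith)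
    refine ⟨fun s hs => ?_, e1, e2, e3⟩
    have hsd : |s - 1| ≤ d / 2 := abs_le.2 ⟨by linarith [hs.1], by linarith [hs.2]⟩
    have := h2 (y := (s, t)) (by
      rw [Prod.dist_eq, Real.dist_eq, Real.dist_eq]
      exact max_lt (by linarith) (by linarith))
      ⟨⟨by linarith [hs.1], hs.2⟩, by linarith [ht.1],
        EReal.coe_lt_of_le_of_lt (by linarith [ht.2]) hTT⟩
    simp only at this
    linarith
  set f : ℝ → ℝ → ℝ → ℝ := fun θ s t => w 1 t₀ + (φ (s, t) - φ (1, t₀)) + θ * D t with hf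
  set P : ℝ → Prop := fun θ => ∃ k, 0 ≤ k ∧ ∃ r, 0 < r ∧ r ≤ r₀ ∧ ∀ s ∈ Icc (1 - r) 1,
    ∀ t ∈ Icc (t₀ - r) (t₀ + r), f θ s t - k * ((1 - s) ^ 2 + (t - t₀) ^ 2) ≤ w s t with hP
  have hstep : ∀ θ η, 0 ≤ θ → 0 ≤ η → θ + η ≤ 1 → η * Λ ≤ μ / 4 → P θ → P (θ + η) := by
    rintro θ η hθ hη hθη hηΛ ⟨k, hk, r, hr, hrr, hkr⟩
    set r' := min r (μ / (8 * k + 1)) with hr'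
    have hr'0 : 0 < r' := lt_min hr (by positivity)
    have hr'r : r' ≤ r := min_le_left _ _
    have hr'k : 8 * k * r' ≤ μ := by
      have : r' ≤ μ / (8 * k + 1) := min_le_right _ _
      rw [le_div_iff₀ (by positivity)] at this
      nlinarith
    have hr'0' := hr'r.trans hrr
    set K := μ / (2 * r') with hK
    have hKr : K * (2 * r') = μ := by rw [hK]; field_simp
    have hK0 : 0 < K := by positivity
    refine ⟨K, hK0.le, r', hr'0, hr'0', ?_⟩
    by_contra! hcon
    obtain ⟨s₂, hs₂, t₂, ht₂, hneg₂⟩ := hcon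
    set B : Set (ℝ × ℝ) := Icc (1 - r') 1 ×ˢ Icc (t₀ - r') (t₀ + r') with hB
    have hBc : IsCompact B := isCompact_Icc.prod isCompact_Icc
    have hBsub : B ⊆ Icc 0 1 ×ˢ timeIco T₀ T₁ := by
      rintro ⟨s, t⟩ ⟨hs, ht⟩
      exact ⟨⟨by linarith [hs.1], hs.2⟩, by linarith [ht.1],
        EReal.coe_lt_of_le_of_lt (by linarith [ht.2]) hTT⟩
    set g : ℝ × ℝ → ℝ := fun q => w 1 t₀ + (φ q - φ (1, t₀)) + (θ + η) *
      (ψ q.2 - ψ t₀ - (φ (1, q.2) - φ (1, t₀))) - K * ((1 - q.1) ^ 2 + (q.2 - t₀) ^ 2) with hg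
    have hgs : ContDiff ℝ 1 g := by fun_prop
    have hgf : ∀ s t, g (s, t) = f (θ + η) s t - K * ((1 - s) ^ 2 + (t - t₀) ^ 2) := by
      intro s t; simp only [hg, hf, hDdef]
    obtain ⟨⟨s₁, t₁⟩, hzB, hzmin⟩ := hBc.exists_isMinOn ⟨(s₂, t₂), hs₂, ht₂⟩
      (f := fun q : ℝ × ℝ => w q.1 q.2 - g q)
      ((hw.mono hBsub).sub hgs.continuous.continuousOn)
    have hval : w s₁ t₁ - g (s₁, t₁) < 0 := by
      have : w s₁ t₁ - g (s₁, t₁) ≤ w s₂ t₂ - g (s₂, t₂) :=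
        isMinOn_iff.1 hzmin (s₂, t₂) ⟨hs₂, ht₂⟩
      rw [hgf s₂ t₂] at this
      linarith
    have hzI := hBsub hzB
    obtain ⟨hs₁, ht₁⟩ := hzB
    simp only at hs₁ ht₁
    have htr : |t₁ - t₀| ≤ r' := abs_le.2 ⟨by linarith [ht₁.1], by linarith [ht₁.2]⟩
    obtain ⟨hb1, hb2, hb3, hb4⟩ := hb t₁ ⟨by linarith [ht₁.1], by linarith [ht₁.2]⟩
    -- the minimum is not attained at the end point of the arc
    have hs₁1 : s₁ < 1 := by
      refine hs₁.2.lt_of_ne ?_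
      rintro rfl
      have h1 := hb1 1 ⟨by linarith, le_rfl⟩
      have h2 : f (θ + η) 1 t₁ ≤ w 1 t₁ := by
        have : f (θ + η) 1 t₁ = (1 - (θ + η)) * (w 1 t₀ + (φ (1, t₁) - φ (1, t₀))) +
            (θ + η) * (w 1 t₀ + (ψ t₁ - ψ t₀)) := by simp only [hf, hDdef]; ring
        rw [this]
        have e1 := mul_le_mul_of_nonneg_left h1 (by linarith : 0 ≤ 1 - (θ + η))
        have e2 := mul_le_mul_of_nonneg_left hb2 (by linarith : 0 ≤ θ + η)
        linarith
      rw [hgf] at hval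
      have : 0 ≤ K * ((1 - 1) ^ 2 + (t₁ - t₀) ^ 2) := by positivity
      linarith
    -- nor on the other sides of the box
    have hin : (1 - s₁) ^ 2 + (t₁ - t₀) ^ 2 < r' ^ 2 := by
      by_contra! hcon
      have h1 := hkr s₁ ⟨by linarith [hs₁.1], hs₁.2⟩ t₁
        ⟨by linarith [ht₁.1], by linarith [ht₁.2]⟩
      have h2 : f (θ + η) s₁ t₁ = f θ s₁ t₁ + η * D t₁ := by simp only [hf]; ring
      have h3 : η * D t₁ ≤ μ / 4 * r' := by
        calc η * D t₁ ≤ η * (Λ * r') := by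
              refine mul_le_mul_of_nonneg_left ?_ hη
              exact ((le_abs_self _).trans hb3).trans (mul_le_mul_of_nonneg_left htr hΛ0)
          _ = (η * Λ) * r' := by ring
          _ ≤ _ := mul_le_mul_of_nonneg_right hηΛ hr'0.le
      have h4 : K * r' ^ 2 = μ / 2 * r' := by
        have : K * r' ^ 2 = K * (2 * r') * r' / 2 := by ring
        rw [this, hKr]; ring
      have h5 : K * r' ^ 2 ≤ K * ((1 - s₁) ^ 2 + (t₁ - t₀) ^ 2) :=
        mul_le_mul_of_nonneg_left hcon hK0.le
      have h6 : (1 - s₁) ^ 2 + (t₁ - t₀) ^ 2 ≤ 2 * r' ^ 2 := by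
        have e1 : (t₁ - t₀) ^ 2 ≤ r' ^ 2 := by rw [← sq_abs]; gcongr
        have e2 : (1 - s₁) ^ 2 ≤ r' ^ 2 := by
          apply pow_le_pow_left₀ <;> linarith [hs₁.1]
        linarith
      have h7 : k * ((1 - s₁) ^ 2 + (t₁ - t₀) ^ 2) ≤ k * (2 * r' ^ 2) :=
        mul_le_mul_of_nonneg_left h6 hk
      have h8 : k * (2 * r' ^ 2) ≤ μ / 4 * r' := by
        have := mul_le_mul_of_nonneg_right hr'k hr'0.le
        linarith
      rw [hgf] at hval
      linarith
    have hs₁' : 1 - r' < s₁ := by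
      by_contra! hcon
      have : r' ^ 2 ≤ (1 - s₁) ^ 2 := by gcongr; linarith
      linarith [sq_nonneg (t₁ - t₀)]
    have ht₁' : |t₁ - t₀| < r' := by
      by_contra! hcon
      have : r' ^ 2 ≤ (t₁ - t₀) ^ 2 := by rw [← sq_abs (t₁ - t₀)]; gcongr
      linarith [sq_nonneg (1 - s₁)]
    have ht₁'' := abs_lt.1 ht₁'
    have hloc : IsLocalMin (fun q : ℝ × ℝ => w q.1 q.2 - g q) (s₁, t₁) := by
      filter_upwards [prod_mem_nhds (Ioo_mem_nhds hs₁' hs₁1)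
        (Ioo_mem_nhds (show t₀ - r' < t₁ by linarith) (show t₁ < t₀ + r' by linarith))] with q hq
      exact hzmin ⟨Ioo_subset_Icc_self.trans (Icc_subset_Icc_right le_rfl) hq.1,
        Ioo_subset_Icc_self hq.2⟩
    have hs₁0 : 0 < s₁ := by linarith
    have hkey := h s₁ ⟨hs₁0, hs₁1⟩ t₁ ⟨by linarith,
      EReal.coe_lt_of_le_of_lt (by linarith) hTT⟩ g hgs hloc
    have d1 : HasDerivAt (fun t => g (s₁, t)) (fderiv ℝ φ (s₁, t₁) (0, 1) + (θ + η) *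
        (deriv ψ t₁ - fderiv ℝ φ (1, t₁) (0, 1)) - K * (2 * (t₁ - t₀))) t₁ := by
      have e1 := (((deriv_slice_snd hφ s₁ t₁).sub_const (φ (1, t₀))).const_add (w 1 t₀)).add
        ((hD t₁).const_mul (θ + η))
      have e2 : HasDerivAt (fun t => K * ((1 - s₁) ^ 2 + (t - t₀) ^ 2))
          (K * ((2 : ℕ) * (t₁ - t₀) ^ (2 - 1) * 1)) t₁ :=
        (((((hasDerivAt_id t₁).sub_const t₀).pow 2).const_add _).const_mul K)
      refine (e1.sub e2).congr_deriv ?_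
      push_cast; ring
    have d2 : HasDerivAt (fun s => g (s, t₁)) (fderiv ℝ φ (s₁, t₁) (1, 0) +
        K * (2 * (1 - s₁))) s₁ := by
      have e1 := (((deriv_slice_fst hφ s₁ t₁).sub_const (φ (1, t₀))).const_add (w 1 t₀)).add_const
        ((θ + η) * D t₁)
      have e2 : HasDerivAt (fun s => K * ((1 - s) ^ 2 + (t₁ - t₀) ^ 2))
          (K * ((2 : ℕ) * (1 - s₁) ^ (2 - 1) * (-1))) s₁ :=
        (((((hasDerivAt_id s₁).const_sub 1).pow 2).add_const _).const_mul K)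
      refine (e1.sub e2).congr_deriv ?_
      push_cast; ring
    rw [d1.deriv, d2.deriv] at hkey
    have hy0 : 0 ≤ K * (2 * (1 - s₁)) := by
      have : 0 ≤ 1 - s₁ := by linarith
      positivity
    have hy : K * (2 * (1 - s₁)) ≤ μ := by
      rw [← hKr]; exact mul_le_mul_of_nonneg_left (by linarith) hK0.le
    have hx : -(K * (2 * (t₁ - t₀))) ≤ μ := by
      rw [← hKr, ← mul_neg]; exact mul_le_mul_of_nonneg_left (by linarith) hK0.le
    have hz : (θ + η) * (deriv ψ t₁ - fderiv ℝ φ (1, t₁) (0, 1)) ≤ μ := by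
      calc (θ + η) * (deriv ψ t₁ - fderiv ℝ φ (1, t₁) (0, 1)) ≤ (θ + η) * μ :=
            mul_le_mul_of_nonneg_left hb4 (by linarith)
        _ ≤ 1 * μ := mul_le_mul_of_nonneg_right hθη hμ0.le
        _ = μ := one_mul μ
    have hroom := hμ s₁ ⟨by linarith, hs₁.2⟩ hzI.1 t₁ (by linarith) (K * (2 * (1 - s₁)))
      (by rw [abs_of_nonneg hy0]; exact hy)
    linarith
  have hP0 : P 0 := by
    refine ⟨0, le_rfl, r₀, hr₀, le_rfl, fun s hs t ht => ?_⟩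
    have := (hb t ht).1 s hs
    simp only [hf]; linarith
  have hP1 : P 1 := by
    obtain ⟨n, hn⟩ := exists_nat_gt (4 * Λ / μ)
    have hn0 : (0 : ℝ) < n := lt_of_le_of_lt (by positivity) hn
    have hind : ∀ j : ℕ, j ≤ n → P (j / n) := by
      intro j
      induction j with
      | zero => intro _; simpa using hP0
      | succ j ih =>
        intro hj
        have hjn : ((j : ℝ) + 1) / n ≤ 1 := by
          rw [div_le_one hn0]; exact_mod_cast hj
        have := hstep (j / n) (1 / n) (by positivity) (by positivity)
          (by rw [← add_div]; exact hjn) (by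
            rw [div_lt_iff₀ hμ0] at hn
            rw [one_div, inv_mul_le_iff₀ hn0]; linarith) (ih (by omega))
        rw [← add_div] at this
        exact_mod_cast this
    have := hind n le_rfl
    rwa [div_self hn0.ne'] at this
  obtain ⟨k, hk, r, hr, hrr, hkr⟩ := hP1
  -- linearize at the end point
  intro ε hε
  have hd1 : ∀ᶠ z in 𝓝 ((1 : ℝ), t₀), |φ z - φ (1, t₀) - fderiv ℝ φ (1, t₀) (z - (1, t₀))|
      ≤ ε / 8 * ‖z - (1, t₀)‖ := by
    have := (hφ.differentiable one_ne_zero (1, t₀)).hasFDerivAt.isLittleO.bound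
      (show 0 < ε / 8 by positivity)
    exact this
  have hd2 : ∀ᶠ t in 𝓝 t₀, |D t - (t - t₀) * (deriv ψ t₀ - fderiv ℝ φ (1, t₀) (0, 1))|
      ≤ ε / 8 * |t - t₀| := by
    have := (hasDerivAt_iff_isLittleO.1 (hD t₀)).bound (show 0 < ε / 8 by positivity)
    refine this.mono fun t ht => ?_
    have h0 : D t₀ = 0 := by simp [hDdef]
    rw [h0, sub_zero] at ht
    exact ht
  obtain ⟨δ₁, hδ₁, h1⟩ := Metric.eventually_nhds_iff.1 hd1
  obtain ⟨δ₂, hδ₂, h2⟩ := Metric.eventually_nhds_iff.1 hd2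
  set d := min (min δ₁ δ₂) (min r (ε / (2 * k + 1))) with hd
  have hd0 : 0 < d := by
    simp only [hd, lt_min_iff]; exact ⟨⟨hδ₁, hδ₂⟩, hr, by positivity⟩
  have d1 : d ≤ δ₁ := (min_le_left _ _).trans (min_le_left _ _)
  have d2 : d ≤ δ₂ := (min_le_left _ _).trans (min_le_right _ _)
  have d3 : d ≤ r := (min_le_right _ _).trans (min_le_left _ _)
  have d4 : d ≤ ε / (2 * k + 1) := (min_le_right _ _).trans (min_le_right _ _)
  rw [le_div_iff₀ (by positivity)] at d4
  refine ⟨d / 2, by positivity, fun s hs t ht => ?_⟩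
  have hs1 : |s - 1| ≤ d / 2 := abs_le.2 ⟨by linarith [hs.1], by linarith [hs.2]⟩
  have ht1 : |t - t₀| ≤ d / 2 := abs_le.2 ⟨by linarith [ht.1], by linarith [ht.2]⟩
  have hs0 : |s - 1| = 1 - s := by rw [abs_of_nonpos (by linarith [hs.2])]; ring
  have a1 := h1 (y := (s, t)) (by
    rw [Prod.dist_eq, Real.dist_eq, Real.dist_eq]; exact max_lt (by linarith) (by linarith))
  have a2 := h2 (y := t) (by rw [Real.dist_eq]; linarith)
  have a3 := hkr s ⟨by linarith [hs.1], hs.2⟩ t ⟨by linarith [ht.1], by linarith [ht.2]⟩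
  have a4 : ‖(s, t) - (1, t₀)‖ ≤ (1 - s) + |t - t₀| := by
    rw [Prod.mk_sub_mk, Prod.norm_mk, Real.norm_eq_abs, Real.norm_eq_abs, hs0]
    exact max_le (by linarith [abs_nonneg (t - t₀)]) (by linarith [hs.2])
  have a5 : fderiv ℝ φ (1, t₀) ((s, t) - (1, t₀)) =
      (s - 1) * fderiv ℝ φ (1, t₀) (1, 0) + (t - t₀) * fderiv ℝ φ (1, t₀) (0, 1) := by
    have : ((s, t) - (1, t₀) : ℝ × ℝ) = (s - 1) • (1, 0) + (t - t₀) • (0, 1) := by simp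
    rw [this, map_add, map_smul, map_smul, smul_eq_mul, smul_eq_mul]
  rw [a5] at a1
  have a6 := (abs_le.1 a1).1
  have a7 := (abs_le.1 a2).1
  have a8 : k * ((1 - s) ^ 2 + (t - t₀) ^ 2) ≤ ε / 2 * ((1 - s) + |t - t₀|) := by
    have e1 : (1 - s) ^ 2 ≤ d / 2 * (1 - s) := by
      rw [sq]; exact mul_le_mul_of_nonneg_right (by linarith) (by linarith [hs.2])
    have e2 : (t - t₀) ^ 2 ≤ d / 2 * |t - t₀| := by
      rw [← sq_abs, sq]; exact mul_le_mul_of_nonneg_right ht1 (abs_nonneg _)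
    have e3 : k * ((1 - s) ^ 2 + (t - t₀) ^ 2) ≤ k * (d / 2 * ((1 - s) + |t - t₀|)) :=
      mul_le_mul_of_nonneg_left (by linarith) hk
    have e4 : k * d ≤ ε := by linarith [mul_nonneg hk hd0.le]
    have e5 : 0 ≤ (1 - s) + |t - t₀| := by linarith [hs.2, abs_nonneg (t - t₀)]
    linarith [mul_le_mul_of_nonneg_right e4 e5]
  have a9 : ε / 8 * ‖(s, t) - (1, t₀)‖ ≤ ε / 8 * ((1 - s) + |t - t₀|) :=
    mul_le_mul_of_nonneg_left a4 (by positivity)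
  have a10 : ε / 8 * |t - t₀| ≤ ε / 8 * ((1 - s) + |t - t₀|) :=
    mul_le_mul_of_nonneg_left (by linarith [hs.2]) (by positivity)
  have a11 : 0 ≤ ε * ((1 - s) + |t - t₀|) := by
    have : 0 ≤ 1 - s := by linarith [hs.2]
    positivity
  simp only [hf, one_mul] at a3
  linarith

/-! ### The maximal subsolution on the network -/

theorem IsArcSub.le_add_time {H : ℝ → ℝ → ℝ} {T₀ : ℝ} {T₁ : EReal} {w : ℝ → ℝ → ℝ}
    (hw : IsArcSub H T₀ T₁ w) {M : ℝ} (hM : ∀ s ∈ Icc (0 : ℝ) 1, ∀ p, -H s p ≤ M) {s : ℝ}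
    (hs : s ∈ Icc (0 : ℝ) 1) {t l : ℝ} (ht : T₀ ≤ t) (hl : 0 ≤ l)
    (htl : ((t + l : ℝ) : EReal) < T₁) : w s (t + l) ≤ w s t + l * M := by
  have := hw 0 1 le_rfl one_pos le_rfl 0 M (fun σ hσ p => by simpa using hM σ hσ p) s hs t ht l hl
    (by simpa using hs) htl
  simpa using this

theorem IsArcSub.reverse {H H' : ℝ → ℝ → ℝ} {T₀ : ℝ} {T₁ : EReal} {w w' : ℝ → ℝ → ℝ}
    (hw : IsArcSub H T₀ T₁ w) (hH : ∀ s ∈ Icc (0 : ℝ) 1, ∀ p, H' s p = H (1 - s) (-p))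
    (hw' : ∀ s ∈ Icc (0 : ℝ) 1, ∀ t, w' s t = w (1 - s) t) : IsArcSub H' T₀ T₁ w' := by
  intro a b ha hab hb v m hm s hs t ht l hl hs' htl
  have h := hw (1 - b) (1 - a) (by linarith) (by linarith) (by linarith) (-v) m (by
    intro σ hσ p
    have := hm (1 - σ) ⟨by linarith [hσ.2], by linarith [hσ.1]⟩ (-p)
    rw [hH _ ⟨by linarith [hσ.2], by linarith [hσ.1]⟩] at this
    simpa using this) (1 - s) ⟨by linarith [hs.2], by linarith [hs.1]⟩ t ht l hl
    ⟨by linarith [hs'.2], by linarith [hs'.1]⟩ htl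
  rw [hw' s ⟨by linarith [hs.1], by linarith [hs.2]⟩,
    hw' _ ⟨by linarith [hs'.1], by linarith [hs'.2]⟩]
  have e : 1 - (s + l * v) = 1 - s + l * -v := by ring
  rw [e]; exact h

namespace EmbeddedNetwork

variable {E : Type*} {N : ℕ} {Γ : EmbeddedNetwork E N} {H : E → ℝ → ℝ → ℝ}
  {c : EuclideanSpace ℝ (Fin N) → ℝ} {T₀ : ℝ} {T₁ : EReal}

theorem IsHamiltonian.arc (hH : Γ.IsHamiltonian H) (e : E) : IsArcHamiltonian (H e) :=
  ⟨hH.continuousOn e, hH.convex e, hH.coercive e⟩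

theorem arc_mem_carrier (e : E) {s : ℝ} (hs : s ∈ Icc (0 : ℝ) 1) : Γ.arc e s ∈ Γ.carrier :=
  mem_iUnion.2 ⟨e, mem_image_of_mem _ hs⟩

theorem mem_carrier_iff {x : EuclideanSpace ℝ (Fin N)} :
    x ∈ Γ.carrier ↔ ∃ e, ∃ s ∈ Icc (0 : ℝ) 1, Γ.arc e s = x := by
  simp [carrier]

theorem vertices_subset_carrier : Γ.vertices ⊆ Γ.carrier := by
  rintro _ ⟨e, rfl⟩
  exact arc_mem_carrier e ⟨zero_le_one, le_rfl⟩

theorem arc_inv_one (e : E) : Γ.arc (Γ.inv e) 1 = Γ.arc e 0 := by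
  rw [Γ.arc_inv e 1 ⟨zero_le_one, le_rfl⟩, sub_self]

theorem arc_zero_mem_vertices (e : E) : Γ.arc e 0 ∈ Γ.vertices :=
  ⟨Γ.inv e, Γ.arc_inv_one e⟩

theorem continuousOn_arc (e : E) : ContinuousOn (Γ.arc e) (Icc 0 1) :=
  (Γ.arc_contDiffOn e).continuousOn

theorem isCompact_carrier [Finite E] : IsCompact Γ.carrier :=
  isCompact_iUnion fun e => isCompact_Icc.image_of_continuousOn (Γ.continuousOn_arc e)

theorem timeIco_left_mem (hT₁ : (T₀ : EReal) < T₁) : T₀ ∈ timeIco T₀ T₁ := ⟨le_rfl, hT₁⟩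

/-- Subsolutions in integrated form on the network: integrated subsolutions along every arc that
grow at most at rate `c x` at the vertex `x`. -/
structure IsIntegratedSub (Γ : EmbeddedNetwork E N) (H : E → ℝ → ℝ → ℝ)
    (c : EuclideanSpace ℝ (Fin N) → ℝ) (T₀ : ℝ) (T₁ : EReal)
    (w : EuclideanSpace ℝ (Fin N) → ℝ → ℝ) : Prop where
  arcs : ∀ e, IsArcSub (H e) T₀ T₁ (fun s t => w (Γ.arc e s) t)
  vertices : ∀ x ∈ Γ.vertices, ∀ t, T₀ ≤ t → ∀ l, 0 ≤ l → ((t + l : ℝ) : EReal) < T₁ →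
    w x (t + l) ≤ w x t + l * c x

/-- The integrated subsolutions that lie below `g` at the initial time. -/
def subsBelow (Γ : EmbeddedNetwork E N) (H : E → ℝ → ℝ → ℝ)
    (c : EuclideanSpace ℝ (Fin N) → ℝ) (T₀ : ℝ) (T₁ : EReal)
    (g : EuclideanSpace ℝ (Fin N) → ℝ) : Set (EuclideanSpace ℝ (Fin N) → ℝ → ℝ) :=
  {w | Γ.IsIntegratedSub H c T₀ T₁ w ∧ ∀ x ∈ Γ.carrier, w x T₀ ≤ g x}

/-- The largest integrated subsolution below `g` at the initial time. It is meaningful on the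
network only: elsewhere the supremum may be that of an unbounded set. -/
noncomputable def maximalSub (Γ : EmbeddedNetwork E N) (H : E → ℝ → ℝ → ℝ)
    (c : EuclideanSpace ℝ (Fin N) → ℝ) (T₀ : ℝ) (T₁ : EReal)
    (g : EuclideanSpace ℝ (Fin N) → ℝ) : EuclideanSpace ℝ (Fin N) → ℝ → ℝ :=
  fun x t => ⨆ w : Γ.subsBelow H c T₀ T₁ g, w.1 x t

section Maximal

variable (hH : Γ.IsHamiltonian H) {g : EuclideanSpace ℝ (Fin N) → ℝ}
include hH

theorem bddAbove_subsBelow {x : EuclideanSpace ℝ (Fin N)} (hx : x ∈ Γ.carrier) {t : ℝ}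
    (ht : t ∈ timeIco T₀ T₁) :
    BddAbove (range fun w : Γ.subsBelow H c T₀ T₁ g => w.1 x t) := by
  obtain ⟨e, s, hs, rfl⟩ := mem_carrier_iff.1 hx
  obtain ⟨M, -, hM⟩ := (hH.arc e).exists_neg_le
  refine ⟨g (Γ.arc e s) + (t - T₀) * M, ?_⟩
  rintro _ ⟨⟨w, hw, hw0⟩, rfl⟩
  have h := (hw.arcs e).le_add_time hM hs le_rfl (l := t - T₀) (by linarith [ht.1])
    (by rw [add_sub_cancel]; exact ht.2)
  rw [add_sub_cancel] at h
  exact h.trans (by gcongr; exact hw0 _ hx)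

theorem le_maximalSub {w : EuclideanSpace ℝ (Fin N) → ℝ → ℝ} (hw : w ∈ Γ.subsBelow H c T₀ T₁ g)
    {x : EuclideanSpace ℝ (Fin N)} (hx : x ∈ Γ.carrier) {t : ℝ} (ht : t ∈ timeIco T₀ T₁) :
    w x t ≤ Γ.maximalSub H c T₀ T₁ g x t :=
  le_ciSup (f := fun w : Γ.subsBelow H c T₀ T₁ g => w.1 x t) (bddAbove_subsBelow hH hx ht) ⟨w, hw⟩

theorem maximalSub_isIntegratedSub (hne : (Γ.subsBelow H c T₀ T₁ g).Nonempty) :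
    Γ.IsIntegratedSub H c T₀ T₁ (Γ.maximalSub H c T₀ T₁ g) := by
  have := hne.to_subtype
  constructor
  · intro e a b ha hab hb v m hm s hs t ht l hl hs' htl
    refine ciSup_le fun w => ?_
    have h1 := w.2.1.arcs e a b ha hab hb v m hm s hs t ht l hl hs' htl
    have h2 := le_maximalSub hH w.2 (arc_mem_carrier e ⟨ha.trans hs.1, hs.2.trans hb⟩)
      (t := t) ⟨ht, EReal.coe_lt_of_le_of_lt (by linarith) htl⟩
    simp only at h1
    linarith
  · intro x hx t ht l hl htl
    refine ciSup_le fun w => ?_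
    have h1 := w.2.1.vertices x hx t ht l hl htl
    have h2 := le_maximalSub hH w.2 (vertices_subset_carrier hx)
      (t := t) ⟨ht, EReal.coe_lt_of_le_of_lt (by linarith) htl⟩
    linarith

theorem maximalSub_le_add {g' : EuclideanSpace ℝ (Fin N) → ℝ} {κ : ℝ}
    (hne : (Γ.subsBelow H c T₀ T₁ g).Nonempty) (hgg : ∀ x ∈ Γ.carrier, g x ≤ g' x + κ)
    {x : EuclideanSpace ℝ (Fin N)} (hx : x ∈ Γ.carrier) {t : ℝ} (ht : t ∈ timeIco T₀ T₁) :
    Γ.maximalSub H c T₀ T₁ g x t ≤ Γ.maximalSub H c T₀ T₁ g' x t + κ := by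
  have := hne.to_subtype
  refine ciSup_le fun w => ?_
  have h : (fun x t => w.1 x t - κ) ∈ Γ.subsBelow H c T₀ T₁ g' := by
    refine ⟨⟨?_, ?_⟩, fun x hx => ?_⟩
    · intro e a b ha hab hb v m hm s hs t ht l hl hs' htl
      have h1 := w.2.1.arcs e a b ha hab hb v m hm s hs t ht l hl hs' htl
      linarith
    · intro x hx t ht l hl htl
      have h1 := w.2.1.vertices x hx t ht l hl htl
      linarith
    · have h1 := w.2.2 x hx
      have h2 := hgg x hx
      simp only
      linarith
  have := le_maximalSub hH h hx ht
  linarith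

/-- For Lipschitz data `g` the functions `g - C (t - T₀)` with large `C` are subsolutions. -/
theorem exists_sub_of_lipschitz [Finite E] (hg : Γ.LipschitzSpace g) :
    ∃ C, 0 ≤ C ∧ (fun x t => g x - C * (t - T₀)) ∈ Γ.subsBelow H c T₀ T₁ g := by
  obtain ⟨K, hK⟩ := hg
  choose C hC0 hC using fun e => (hH.arc e).exists_bound K
  obtain ⟨B, hB⟩ := (finite_range C).bddAbove
  obtain ⟨B', hB'⟩ := (finite_range fun e => -c (Γ.arc e 1)).bddAbove
  set A := max 0 (max B B') with hA
  have hA0 : 0 ≤ A := le_max_left _ _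
  have hCA : ∀ e, C e ≤ A := fun e =>
    (hB (mem_range_self e)).trans ((le_max_left _ _).trans (le_max_right _ _))
  have hcA : ∀ e, -c (Γ.arc e 1) ≤ A := fun e =>
    (hB' (mem_range_self e)).trans ((le_max_right _ _).trans (le_max_right _ _))
  refine ⟨A, hA0, ⟨?_, ?_⟩, fun x _ => by simp⟩
  · intro e a b ha hab hb v m hm s hs t ht l hl hs' htl
    have hs1 : s ∈ Icc (0 : ℝ) 1 := ⟨ha.trans hs.1, hs.2.trans hb⟩
    have h1 := (hK e).dist_le_mul (s + l * v) ⟨ha.trans hs'.1, hs'.2.trans hb⟩ s hs1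
    rw [Real.dist_eq, Real.dist_eq, add_sub_cancel_left, abs_mul, abs_of_nonneg hl] at h1
    have h2 : (K : ℝ) * |v| - A ≤ m := by
      rcases le_total 0 v with hv | hv
      · have e1 := hm s hs K
        have e2 := hC e s hs1 K (by simp)
        rw [abs_of_nonneg hv]
        linarith [le_abs_self (H e s K), hCA e]
      · have e1 := hm s hs (-K)
        have e2 := hC e s hs1 (-K) (by simp)
        rw [abs_of_nonpos hv]
        linarith [le_abs_self (H e s (-K)), hCA e]
    have h3 := mul_le_mul_of_nonneg_left h2 hl
    have h4 := (abs_le.1 h1).2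
    simp only
    linarith
  · rintro _ ⟨e, rfl⟩ t ht l hl htl
    have := mul_le_mul_of_nonneg_left (hcA e) hl
    simp only at this ⊢
    linarith

theorem subsBelow_nonempty [Finite E] (hg : ContinuousOn g Γ.carrier) :
    (Γ.subsBelow H c T₀ T₁ g).Nonempty := by
  obtain ⟨B, hB⟩ := Γ.isCompact_carrier.exists_bound_of_continuousOn hg
  obtain ⟨C, -, hC1, hC2⟩ := exists_sub_of_lipschitz (g := fun _ => -B) (T₀ := T₀) (T₁ := T₁)
    (c := c) hH ⟨0, fun e => (LipschitzWith.const _).lipschitzOnWith⟩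
  refine ⟨_, hC1, fun x hx => (hC2 x hx).trans ?_⟩
  have := hB x hx
  rw [Real.norm_eq_abs] at this
  linarith [neg_abs_le (g x)]

omit hH in
theorem maximalSub_init_le (hne : (Γ.subsBelow H c T₀ T₁ g).Nonempty)
    {x : EuclideanSpace ℝ (Fin N)} (hx : x ∈ Γ.carrier) :
    Γ.maximalSub H c T₀ T₁ g x T₀ ≤ g x := by
  have := hne.to_subtype
  exact ciSup_le fun w => w.2.2 x hx

/-- The maximal subsolution with Lipschitz data decreases at most at a fixed rate `C`: starting
along `g - C (t - T₀)` for a time `h` and then following a translate of a given subsolution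
is admissible. -/
theorem maximalSub_sub_le [Finite E] {C : ℝ} (hgne : ContinuousOn g Γ.carrier)
    (hC : (fun x t => g x - C * (t - T₀)) ∈ Γ.subsBelow H c T₀ T₁ g)
    {x : EuclideanSpace ℝ (Fin N)} (hx : x ∈ Γ.carrier) {t h : ℝ} (ht : T₀ ≤ t) (hh : 0 ≤ h)
    (hth : ((t + h : ℝ) : EReal) < T₁) :
    Γ.maximalSub H c T₀ T₁ g x t - C * h ≤ Γ.maximalSub H c T₀ T₁ g x (t + h) := by
  have := (subsBelow_nonempty (c := c) (T₀ := T₀) (T₁ := T₁) hH hgne).to_subtype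
  rw [sub_le_iff_le_add]
  refine ciSup_le fun ⟨w, hw, hw0⟩ => ?_
  rcases hh.eq_or_lt with rfl | hh0
  · simpa using le_maximalSub (c := c) hH ⟨hw, hw0⟩ hx (t := t) ⟨ht, by simpa using hth⟩
  set w' : EuclideanSpace ℝ (Fin N) → ℝ → ℝ := fun x t =>
    if t < T₀ + h then g x - C * (t - T₀) else w x (t - h) - C * h with hw'
  have hw'mem : w' ∈ Γ.subsBelow H c T₀ T₁ g := by
    refine ⟨⟨?_, ?_⟩, fun x hx => ?_⟩
    · intro e a b ha hab hb v m hm s hs t ht l hl hs' htl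
      simp only [hw']
      by_cases h2 : t + l < T₀ + h
      · have h1 : t < T₀ + h := by linarith
        rw [if_pos h1, if_pos h2]
        exact hC.1.arcs e a b ha hab hb v m hm s hs t ht l hl hs' htl
      rw [if_neg h2]
      by_cases h1 : t < T₀ + h
      · rw [if_pos h1]
        -- split the segment at the time of the switch
        set l₁ := T₀ + h - t with hl₁
        have hl₁0 : 0 ≤ l₁ := by linarith
        have hl₂0 : 0 ≤ l - l₁ := by linarith
        have hmid : s + l₁ * v ∈ Icc a b := by
          rcases le_total 0 v with hv | hv
          · have e1 : l₁ * v ≤ l * v := mul_le_mul_of_nonneg_right (by linarith) hv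
            have e2 : 0 ≤ l₁ * v := mul_nonneg hl₁0 hv
            exact ⟨by linarith [hs.1], by linarith [hs'.2]⟩
          · have e1 : l * v ≤ l₁ * v := mul_le_mul_of_nonpos_right (by linarith) hv
            have e2 : l₁ * v ≤ 0 := mul_nonpos_of_nonneg_of_nonpos hl₁0 hv
            exact ⟨by linarith [hs'.1], by linarith [hs.2]⟩
        have a1 := hC.1.arcs e a b ha hab hb v m hm s hs t ht l₁ hl₁0 hmid
          (EReal.coe_lt_of_le_of_lt (by linarith) htl)
        have e1 : s + l₁ * v + (l - l₁) * v = s + l * v := by ring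
        have a2 := hw.arcs e a b ha hab hb v m hm (s + l₁ * v) hmid T₀ le_rfl (l - l₁) hl₂0
          (by rw [e1]; exact hs') (EReal.coe_lt_of_le_of_lt (by linarith) htl)
        have a3 := hw0 _ (Γ.arc_mem_carrier e ⟨ha.trans hmid.1, hmid.2.trans hb⟩)
        have e2 : T₀ + (l - l₁) = t + l - h := by rw [hl₁]; ring
        rw [e1, e2] at a2
        have e3 : t + l₁ - T₀ = h := by rw [hl₁]; ring
        simp only [e3] at a1
        linarith
      · rw [if_neg h1]
        have e1 : t + l - h = t - h + l := by ring
        have := hw.arcs e a b ha hab hb v m hm s hs (t - h) (by linarith) l hl hs'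
          (EReal.coe_lt_of_le_of_lt (by linarith) htl)
        simp only at this
        rw [e1]; linarith
    · intro x hx t ht l hl htl
      simp only [hw']
      by_cases h2 : t + l < T₀ + h
      · have h1 : t < T₀ + h := by linarith
        rw [if_pos h1, if_pos h2]
        exact hC.1.vertices x hx t ht l hl htl
      rw [if_neg h2]
      by_cases h1 : t < T₀ + h
      · rw [if_pos h1]
        set l₁ := T₀ + h - t with hl₁
        have hl₁0 : 0 ≤ l₁ := by linarith
        have hl₂0 : 0 ≤ l - l₁ := by linarith
        have a1 := hC.1.vertices x hx t ht l₁ hl₁0 (EReal.coe_lt_of_le_of_lt (by linarith) htl)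
        have a2 := hw.vertices x hx T₀ le_rfl (l - l₁) hl₂0
          (EReal.coe_lt_of_le_of_lt (by linarith) htl)
        have a3 := hw0 _ (vertices_subset_carrier hx)
        have e2 : T₀ + (l - l₁) = t + l - h := by rw [hl₁]; ring
        rw [e2] at a2
        have e3 : t + l₁ - T₀ = h := by rw [hl₁]; ring
        simp only [e3] at a1
        linarith
      · rw [if_neg h1]
        have e1 : t + l - h = t - h + l := by ring
        have := hw.vertices x hx (t - h) (by linarith) l hl
          (EReal.coe_lt_of_le_of_lt (by linarith) htl)
        rw [e1]; linarith
    · simp only [hw']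
      rw [if_pos (by linarith)]
      simp
  have h1 := le_maximalSub hH hw'mem hx (t := t + h) ⟨by linarith, hth⟩
  simp only [hw'] at h1
  rw [if_neg (by linarith), add_sub_cancel_right] at h1
  simp only
  linarith

theorem maximalSub_init_of_lipschitz [Finite E] (hT₁ : (T₀ : EReal) < T₁)
    (hgc : ContinuousOn g Γ.carrier) (hg : Γ.LipschitzSpace g) {x : EuclideanSpace ℝ (Fin N)}
    (hx : x ∈ Γ.carrier) : Γ.maximalSub H c T₀ T₁ g x T₀ = g x := by
  refine le_antisymm (maximalSub_init_le (subsBelow_nonempty hH hgc) hx) ?_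
  obtain ⟨C, -, hC⟩ := exists_sub_of_lipschitz (c := c) (T₀ := T₀) (T₁ := T₁) hH hg
  simpa using le_maximalSub hH hC hx (timeIco_left_mem hT₁)

/-- Lipschitz regularity. Time: the growth is bounded by `-min H`, the decrease by
`maximalSub_sub_le`. Space: a point `s'` is reached from `s` with a small speed `α`, at a cost
bounded through `H ≥ α |p| - β`. -/
theorem lipschitzSpaceTime_maximalSub [Finite E] (hT₁ : (T₀ : EReal) < T₁)
    (hgc : ContinuousOn g Γ.carrier) (hg : Γ.LipschitzSpace g) :
    Γ.LipschitzSpaceTime T₀ T₁ (fun q => Γ.maximalSub H c T₀ T₁ g q.1 q.2) := by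
  set V := Γ.maximalSub H c T₀ T₁ g with hV
  obtain ⟨C, hC0, hC⟩ := exists_sub_of_lipschitz (c := c) (T₀ := T₀) (T₁ := T₁) hH hg
  have hsub : Γ.IsIntegratedSub H c T₀ T₁ V :=
    maximalSub_isIntegratedSub hH (subsBelow_nonempty hH hgc)
  have hinit : ∀ x ∈ Γ.carrier, V x T₀ = g x := fun x hx =>
    maximalSub_init_of_lipschitz hH hT₁ hgc hg hx
  have hdec : ∀ x ∈ Γ.carrier, ∀ t, T₀ ≤ t → ∀ h, 0 ≤ h → ((t + h : ℝ) : EReal) < T₁ →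
      V x t - C * h ≤ V x (t + h) := fun x hx t ht h hh hth =>
    maximalSub_sub_le hH hgc hC hx ht hh hth
  obtain ⟨K, hK⟩ := hg
  have key : ∀ e, ∃ L : NNReal, LipschitzOnWith L (Γ.pullback (fun q => V q.1 q.2) e)
      (Icc 0 1 ×ˢ timeIco T₀ T₁) := by
    intro e
    obtain ⟨M, hM0, hM⟩ := (hH.arc e).exists_neg_le
    obtain ⟨α, hα, β, hβ⟩ := (hH.arc e).exists_linear_le
    have htime : ∀ s ∈ Icc (0 : ℝ) 1, ∀ t ∈ timeIco T₀ T₁, ∀ t' ∈ timeIco T₀ T₁, t ≤ t' →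
        |V (Γ.arc e s) t - V (Γ.arc e s) t'| ≤ (M + C) * |t - t'| := by
      intro s hs t ht t' ht' htt
      have h1 := (hsub.arcs e).le_add_time hM hs ht.1 (l := t' - t) (by linarith)
        (by rw [add_sub_cancel]; exact ht'.2)
      have h2 := hdec _ (arc_mem_carrier e hs) t ht.1 (t' - t) (by linarith)
        (by rw [add_sub_cancel]; exact ht'.2)
      rw [add_sub_cancel] at h1 h2
      have h3 := mul_nonneg hC0 (sub_nonneg.2 htt)
      have h4 := mul_nonneg hM0 (sub_nonneg.2 htt)
      rw [abs_sub_comm t t', abs_of_nonneg (sub_nonneg.2 htt), abs_le]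
      constructor <;> linarith
    have hspace : ∀ s ∈ Icc (0 : ℝ) 1, ∀ s' ∈ Icc (0 : ℝ) 1, ∀ t ∈ timeIco T₀ T₁,
        V (Γ.arc e s') t ≤ V (Γ.arc e s) t + ((|β| + C + M) / α + K) * |s' - s| := by
      intro s hs s' hs' t ht
      set l := |s' - s| / α with hl
      have hl0 : 0 ≤ l := by positivity
      have hexp : ((|β| + C + M) / α + K) * |s' - s| = |β| * l + C * l + M * l + K * |s' - s| := by
        rw [hl]; ring
      have hKs : 0 ≤ K * |s' - s| := by positivity
      rw [hexp]
      rcases le_or_gt T₀ (t - l) with h | h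
      · obtain ⟨v, hv, hvs⟩ : ∃ v, |v| = α ∧ s + l * v = s' := by
          rcases le_total s s' with h | h
          · refine ⟨α, abs_of_pos hα, ?_⟩
            rw [hl, div_mul_cancel₀ _ hα.ne', abs_of_nonneg (by linarith)]; ring
          · refine ⟨-α, by rw [abs_neg, abs_of_pos hα], ?_⟩
            rw [hl, mul_neg, div_mul_cancel₀ _ hα.ne', abs_of_nonpos (by linarith)]; ring
        have h1 := hsub.arcs e 0 1 le_rfl one_pos le_rfl v |β| (by
          intro σ hσ p
          have e1 := hβ σ hσ p
          have e2 : p * v ≤ α * |p| := by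
            calc p * v ≤ |p * v| := le_abs_self _
              _ = α * |p| := by rw [abs_mul, hv]; ring
          linarith [le_abs_self β]) s hs (t - l) h l hl0 (by rw [hvs]; exact hs')
          (by rw [sub_add_cancel]; exact ht.2)
        have h2 := hdec _ (arc_mem_carrier e hs) (t - l) h l hl0
          (by rw [sub_add_cancel]; exact ht.2)
        rw [sub_add_cancel] at h1 h2
        simp only [hvs] at h1
        have := mul_nonneg hM0 hl0
        linarith
      · have h1 := (hsub.arcs e).le_add_time hM hs' le_rfl (l := t - T₀) (by linarith [ht.1])
          (by rw [add_sub_cancel]; exact ht.2)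
        have h2 := hdec _ (arc_mem_carrier e hs) T₀ le_rfl (t - T₀) (by linarith [ht.1])
          (by rw [add_sub_cancel]; exact ht.2)
        rw [add_sub_cancel] at h1 h2
        rw [hinit _ (arc_mem_carrier e hs')] at h1
        rw [hinit _ (arc_mem_carrier e hs)] at h2
        have h3 := (hK e).dist_le_mul s' hs' s hs
        rw [Real.dist_eq, Real.dist_eq] at h3
        have h4 := (abs_le.1 h3).2
        have h5 : (t - T₀) * M ≤ M * l := by
          rw [mul_comm]; exact mul_le_mul_of_nonneg_left (by linarith) hM0
        have h6 : C * (t - T₀) ≤ C * l := mul_le_mul_of_nonneg_left (by linarith) hC0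
        have := mul_nonneg (abs_nonneg β) hl0
        linarith
    refine ⟨Real.toNNReal (((|β| + C + M) / α + K) + (M + C)), LipschitzOnWith.of_dist_le_mul ?_⟩
    rintro ⟨s, t⟩ ⟨hs, ht⟩ ⟨s', t'⟩ ⟨hs', ht'⟩
    have hL0 : 0 ≤ (|β| + C + M) / α + K := by positivity
    rw [Real.coe_toNNReal _ (by positivity), Real.dist_eq, Prod.dist_eq, Real.dist_eq,
      Real.dist_eq]
    simp only [pullback]
    have h1 : |V (Γ.arc e s) t - V (Γ.arc e s') t| ≤ ((|β| + C + M) / α + K) * |s - s'| := by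
      have a1 := hspace s hs s' hs' t ht
      have a2 := hspace s' hs' s hs t ht
      rw [abs_sub_comm s' s] at a1
      rw [abs_le]; constructor <;> linarith
    have h2 : |V (Γ.arc e s') t - V (Γ.arc e s') t'| ≤ (M + C) * |t - t'| := by
      rcases le_total t t' with h | h
      · exact htime s' hs' t ht t' ht' h
      · rw [abs_sub_comm, abs_sub_comm t t']; exact htime s' hs' t' ht' t ht h
    calc |V (Γ.arc e s) t - V (Γ.arc e s') t'|
        ≤ |V (Γ.arc e s) t - V (Γ.arc e s') t| + |V (Γ.arc e s') t - V (Γ.arc e s') t'| :=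
          abs_sub_le _ _ _
      _ ≤ ((|β| + C + M) / α + K) * |s - s'| + (M + C) * |t - t'| := add_le_add h1 h2
      _ ≤ ((|β| + C + M) / α + K) * max |s - s'| |t - t'| + (M + C) * max |s - s'| |t - t'| := by
          gcongr
          · exact le_max_left _ _
          · exact le_max_right _ _
      _ = _ := by ring
  choose L hL using key
  obtain ⟨B, hB⟩ := (finite_range L).bddAbove
  exact ⟨B, fun e => (hL e).weaken (hB (mem_range_self e))⟩

end Maximal

end EmbeddedNetwork

/-! ### Uniform continuity and approximation of the initial datum -/

theorem Finite.exists_pos_le {ι : Type*} [Finite ι] {f : ι → ℝ} (hf : ∀ i, 0 < f i) :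
    ∃ d > 0, ∀ i, d ≤ f i := by
  rcases isEmpty_or_nonempty ι with h | h
  · exact ⟨1, one_pos, fun i => (h.false i).elim⟩
  · obtain ⟨i, hi⟩ := Finite.exists_min f
    exact ⟨f i, hf i, hi⟩

namespace EmbeddedNetwork

variable {E : Type*} {N : ℕ} {Γ : EmbeddedNetwork E N} {H : E → ℝ → ℝ → ℝ}
  {c : EuclideanSpace ℝ (Fin N) → ℝ} {T₀ : ℝ} {T₁ : EReal}

/-- Two points of the network that are close in `ℝ^N` give close values, uniformly in time: this
compares the distance of `ℝ^N` with the one along the arcs, by compactness. -/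
theorem exists_dist_arc_lt {u : EuclideanSpace ℝ (Fin N) × ℝ → ℝ} {K : NNReal}
    (hK : ∀ e, LipschitzOnWith K (Γ.pullback u e) (Icc 0 1 ×ˢ timeIco T₀ T₁)) (e e' : E)
    {ε : ℝ} (hε : 0 < ε) :
    ∃ δ > 0, ∀ s ∈ Icc (0 : ℝ) 1, ∀ s' ∈ Icc (0 : ℝ) 1, dist (Γ.arc e s) (Γ.arc e' s') < δ →
      ∀ t ∈ timeIco T₀ T₁, |u (Γ.arc e s, t) - u (Γ.arc e' s', t)| < ε := by
  have hspace : ∀ e, ∀ s ∈ Icc (0 : ℝ) 1, ∀ s' ∈ Icc (0 : ℝ) 1, ∀ t ∈ timeIco T₀ T₁,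
      |u (Γ.arc e s, t) - u (Γ.arc e s', t)| ≤ K * |s - s'| := by
    intro e s hs s' hs' t ht
    have := (hK e).dist_le_mul (s, t) ⟨hs, ht⟩ (s', t) ⟨hs', ht⟩
    rwa [Prod.dist_eq, dist_self, max_eq_left dist_nonneg, Real.dist_eq, Real.dist_eq] at this
  suffices h : ∃ δ > 0, ∀ z ∈ Icc (0 : ℝ) 1 ×ˢ Icc (0 : ℝ) 1,
      dist (Γ.arc e z.1) (Γ.arc e' z.2) < δ →
      ∀ t ∈ timeIco T₀ T₁, |u (Γ.arc e z.1, t) - u (Γ.arc e' z.2, t)| < ε by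
    obtain ⟨δ, hδ, h⟩ := h
    exact ⟨δ, hδ, fun s hs s' hs' => h (s, s') ⟨hs, hs'⟩⟩
  refine (isCompact_Icc.prod isCompact_Icc).induction_on
    (p := fun S => ∃ δ > 0, ∀ z ∈ S, dist (Γ.arc e z.1) (Γ.arc e' z.2) < δ →
      ∀ t ∈ timeIco T₀ T₁, |u (Γ.arc e z.1, t) - u (Γ.arc e' z.2, t)| < ε) ?_ ?_ ?_ ?_
  · exact ⟨1, one_pos, fun z hz => absurd hz (notMem_empty z)⟩
  · rintro S S' hSS ⟨δ, hδ, h⟩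
    exact ⟨δ, hδ, fun z hz => h z (hSS hz)⟩
  · rintro S S' ⟨δ, hδ, h⟩ ⟨δ', hδ', h'⟩
    refine ⟨min δ δ', lt_min hδ hδ', fun z hz hd => ?_⟩
    rcases hz with hz | hz
    · exact h z hz (hd.trans_le (min_le_left _ _))
    · exact h' z hz (hd.trans_le (min_le_right _ _))
  · rintro ⟨a, b⟩ ⟨ha, hb⟩
    by_cases hab : Γ.arc e a = Γ.arc e' b
    · set ρ := ε / (2 * K + 1) with hρ
      have hρ0 : 0 < ρ := by positivity
      have hKρ : 2 * (K * ρ) < ε := by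
        have : ρ * (2 * K + 1) = ε := div_mul_cancel₀ _ (by positivity)
        linarith
      refine ⟨Metric.ball (a, b) ρ ∩ (Icc 0 1 ×ˢ Icc 0 1), ?_, 1, one_pos, ?_⟩
      · rw [inter_comm]; exact inter_mem_nhdsWithin _ (Metric.ball_mem_nhds _ hρ0)
      · rintro ⟨s, s'⟩ ⟨hz, hs, hs'⟩ - t ht
        rw [Metric.mem_ball, Prod.dist_eq, max_lt_iff, Real.dist_eq, Real.dist_eq] at hz
        have h1 := hspace e s hs a ha t ht
        have h2 := hspace e' b hb s' hs' t ht
        rw [abs_sub_comm b s'] at h2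
        have h3 : K * |s - a| ≤ K * ρ := mul_le_mul_of_nonneg_left hz.1.le K.coe_nonneg
        have h4 : K * |s' - b| ≤ K * ρ := mul_le_mul_of_nonneg_left hz.2.le K.coe_nonneg
        have h5 := abs_sub_le (u (Γ.arc e s, t)) (u (Γ.arc e a, t)) (u (Γ.arc e' s', t))
        rw [hab] at h5 h1
        simp only
        linarith
    · have hd : 0 < dist (Γ.arc e a) (Γ.arc e' b) := dist_pos.2 hab
      have hc : ContinuousOn (fun z : ℝ × ℝ => dist (Γ.arc e z.1) (Γ.arc e' z.2))
          (Icc 0 1 ×ˢ Icc 0 1) :=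
        continuous_dist.comp_continuousOn
          (((Γ.continuousOn_arc e).comp continuousOn_fst fun z hz => hz.1).prodMk
            ((Γ.continuousOn_arc e').comp continuousOn_snd fun z hz => hz.2))
      have hev := (hc (a, b) ⟨ha, hb⟩).eventually_const_lt
        (u := dist (Γ.arc e a) (Γ.arc e' b) / 2) (by simp only; linarith)
      exact ⟨_, hev, dist (Γ.arc e a) (Γ.arc e' b) / 2, by linarith,
        fun z hz hlt => absurd hlt (not_lt.2 (le_of_lt hz))⟩

theorem LipschitzSpaceTime.uniformContinuousOn [Finite E]
    {u : EuclideanSpace ℝ (Fin N) × ℝ → ℝ} (hu : Γ.LipschitzSpaceTime T₀ T₁ u) :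
    UniformContinuousOn u (Γ.carrier ×ˢ timeIco T₀ T₁) := by
  obtain ⟨K, hK⟩ := hu
  rw [Metric.uniformContinuousOn_iff]
  intro ε hε
  choose δ hδ h using fun z : E × E => exists_dist_arc_lt hK z.1 z.2 (half_pos hε)
  obtain ⟨d, hd0, hd⟩ := Finite.exists_pos_le hδ
  refine ⟨min d (ε / (2 * K + 1)), lt_min hd0 (by positivity), ?_⟩
  rintro ⟨x, t⟩ ⟨hx, ht⟩ ⟨y, t'⟩ ⟨hy, ht'⟩ hdist
  obtain ⟨e, s, hs, rfl⟩ := mem_carrier_iff.1 hx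
  obtain ⟨e', s', hs', rfl⟩ := mem_carrier_iff.1 hy
  rw [Prod.dist_eq, max_lt_iff, lt_min_iff, lt_min_iff] at hdist
  have h1 := h (e, e') s hs s' hs' (hdist.1.1.trans_le (hd _)) t ht
  have h2 := (hK e').dist_le_mul (s', t) ⟨hs', ht⟩ (s', t') ⟨hs', ht'⟩
  rw [Prod.dist_eq, dist_self, max_eq_right dist_nonneg] at h2
  have h3 : K * dist t t' ≤ K * (ε / (2 * K + 1)) :=
    mul_le_mul_of_nonneg_left hdist.2.2.le K.coe_nonneg
  have h4 : K * (ε / (2 * K + 1)) < ε / 2 := by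
    rw [mul_div_assoc', div_lt_iff₀ (by positivity)]
    linarith
  calc dist (u (Γ.arc e s, t)) (u (Γ.arc e' s', t'))
      ≤ dist (u (Γ.arc e s, t)) (u (Γ.arc e' s', t)) +
        dist (u (Γ.arc e' s', t)) (u (Γ.arc e' s', t')) := dist_triangle _ _ _
    _ < ε / 2 + ε / 2 := by
        refine add_lt_add ?_ (lt_of_le_of_lt h2 (by linarith))
        rw [Real.dist_eq]; exact h1
    _ = ε := add_halves ε

theorem lipschitzSpace_of_lipschitzWith {g : EuclideanSpace ℝ (Fin N) → ℝ} [Finite E] {K : NNReal}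
    (hg : LipschitzWith K g) : Γ.LipschitzSpace g := by
  choose L hL using fun e => (Γ.arc_contDiffOn e).exists_lipschitzOnWith one_ne_zero
    (convex_Icc 0 1) isCompact_Icc
  obtain ⟨B, hB⟩ := (finite_range L).bddAbove
  exact ⟨K * B, fun e => (hg.comp_lipschitzOnWith ((hL e).weaken (hB (mem_range_self e))))⟩

/-- Continuous functions on a compact set are uniform limits of Lipschitz functions, here through
the inf-convolutions `x ↦ inf_y (g y + n |x - y|)`. -/
theorem _root_.IsCompact.exists_lipschitzWith_approx {X : Type*} [MetricSpace X] {S : Set X}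
    (hS : IsCompact S) {g : X → ℝ} (hg : ContinuousOn g S) {κ : ℝ} (hκ : 0 < κ) :
    ∃ (K : NNReal) (g' : X → ℝ), LipschitzWith K g' ∧ ∀ x ∈ S, g' x ≤ g x ∧ g x ≤ g' x + κ := by
  rcases S.eq_empty_or_nonempty with rfl | hne
  · exact ⟨0, fun _ => 0, LipschitzWith.const _, fun x hx => absurd hx (notMem_empty x)⟩
  have := hne.to_subtype
  obtain ⟨B, hB⟩ := hS.exists_bound_of_continuousOn hg
  obtain ⟨δ, hδ, huc⟩ := Metric.uniformContinuousOn_iff.1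
    (hS.uniformContinuousOn_of_continuous hg) κ hκ
  set n : NNReal := Real.toNNReal (2 * |B| / δ) with hn
  have hnδ : (n : ℝ) * δ = 2 * |B| := by
    rw [hn, Real.coe_toNNReal _ (by positivity), div_mul_cancel₀ _ hδ.ne']
  have hbdd : ∀ x : X, BddBelow (range fun y : S => g y + n * dist x (y : X)) := by
    intro x
    refine ⟨-B, ?_⟩
    rintro _ ⟨y, rfl⟩
    have := hB y y.2
    rw [Real.norm_eq_abs] at this
    have h2 : 0 ≤ (n : ℝ) * dist x (y : X) := by positivity
    simp only
    linarith [neg_abs_le (g y)]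
  refine ⟨n, fun x => ⨅ y : S, (g y + n * dist x (y : X)), ?_, fun x hx => ⟨?_, ?_⟩⟩
  · refine LipschitzWith.of_le_add_mul n fun x x' => ?_
    rw [← sub_le_iff_le_add]
    refine le_ciInf fun y => ?_
    rw [sub_le_iff_le_add]
    refine (ciInf_le (hbdd x) y).trans ?_
    have := mul_le_mul_of_nonneg_left (dist_triangle x x' (y : X)) n.coe_nonneg
    linarith
  · refine (ciInf_le (hbdd x) ⟨x, hx⟩).trans ?_
    simp
  · rw [← sub_le_iff_le_add]
    refine le_ciInf fun y => ?_
    rcases lt_or_ge (dist x (y : X)) δ with h | h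
    · have h1 := huc x hx y y.2 h
      rw [Real.dist_eq] at h1
      have h2 : 0 ≤ (n : ℝ) * dist x (y : X) := by positivity
      linarith [(abs_lt.1 h1).2]
    · have h1 := mul_le_mul_of_nonneg_left h n.coe_nonneg
      rw [hnδ] at h1
      have h2 := hB y y.2
      have h3 := hB x hx
      rw [Real.norm_eq_abs] at h2 h3
      linarith [neg_abs_le (g y), le_abs_self (g x), le_abs_self B]

section

variable [Finite E] (hH : Γ.IsHamiltonian H) {g : EuclideanSpace ℝ (Fin N) → ℝ}
  (hg : ContinuousOn g Γ.carrier)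
include hH hg

/-- The maximal subsolutions with approximate Lipschitz data. -/
theorem exists_lipschitz_approx {κ : ℝ} (hκ : 0 < κ) :
    ∃ g', Γ.LipschitzSpace g' ∧ ContinuousOn g' Γ.carrier ∧
      (∀ x ∈ Γ.carrier, g' x ≤ g x) ∧
      ∀ x ∈ Γ.carrier, ∀ t ∈ timeIco T₀ T₁,
        Γ.maximalSub H c T₀ T₁ g' x t ≤ Γ.maximalSub H c T₀ T₁ g x t ∧
        Γ.maximalSub H c T₀ T₁ g x t ≤ Γ.maximalSub H c T₀ T₁ g' x t + κ := by
  obtain ⟨K, g', hK, hg'⟩ := Γ.isCompact_carrier.exists_lipschitzWith_approx hg hκ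
  refine ⟨g', lipschitzSpace_of_lipschitzWith hK, hK.continuous.continuousOn,
    fun x hx => (hg' x hx).1, fun x hx t ht => ⟨?_, ?_⟩⟩
  · have := maximalSub_le_add (c := c) (κ := 0) hH
      (subsBelow_nonempty (T₀ := T₀) (T₁ := T₁) hH hK.continuous.continuousOn)
      (fun x hx => by simpa using (hg' x hx).1) hx ht
    simpa using this
  · exact maximalSub_le_add hH (subsBelow_nonempty hH hg) (fun x hx => (hg' x hx).2) hx ht

theorem maximalSub_init (hT₁ : (T₀ : EReal) < T₁) {x : EuclideanSpace ℝ (Fin N)}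
    (hx : x ∈ Γ.carrier) : Γ.maximalSub H c T₀ T₁ g x T₀ = g x := by
  refine le_antisymm (maximalSub_init_le (subsBelow_nonempty hH hg) hx) ?_
  refine le_of_forall_pos_le_add fun κ hκ => ?_
  obtain ⟨K, g', hK, hg'⟩ := Γ.isCompact_carrier.exists_lipschitzWith_approx hg hκ
  have h1 := maximalSub_init_of_lipschitz (c := c) hH hT₁ hK.continuous.continuousOn
    (lipschitzSpace_of_lipschitzWith hK) hx
  have h2 := maximalSub_le_add (c := c) (κ := 0) (g := g') (g' := g) hH
    (subsBelow_nonempty hH hK.continuous.continuousOn)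
    (fun x hx => by simpa using (hg' x hx).1) hx (timeIco_left_mem hT₁)
  linarith [(hg' x hx).2]

theorem uniformContinuousOn_maximalSub (hT₁ : (T₀ : EReal) < T₁) :
    UniformContinuousOn (fun q : EuclideanSpace ℝ (Fin N) × ℝ => Γ.maximalSub H c T₀ T₁ g q.1 q.2)
      (Γ.carrier ×ˢ timeIco T₀ T₁) := by
  rw [Metric.uniformContinuousOn_iff]
  intro ε hε
  obtain ⟨g', hg'L, hg'c, -, hg'⟩ := exists_lipschitz_approx (c := c) (T₀ := T₀) (T₁ := T₁) hH hg
    (show 0 < ε / 3 by positivity)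
  obtain ⟨δ, hδ, h⟩ := Metric.uniformContinuousOn_iff.1
    (lipschitzSpaceTime_maximalSub (c := c) hH hT₁ hg'c hg'L).uniformContinuousOn
    (ε / 3) (by positivity)
  refine ⟨δ, hδ, fun q hq q' hq' hd => ?_⟩
  have h1 := h q hq q' hq' hd
  have h2 := hg' q.1 hq.1 q.2 hq.2
  have h3 := hg' q'.1 hq'.1 q'.2 hq'.2
  rw [Real.dist_eq, abs_lt] at h1 ⊢
  constructor <;> linarith [h1.1, h1.2]

end

end EmbeddedNetwork

/-! ### The maximal subsolution is a supersolution -/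

/-- A strict inequality at `(s₀, q)` leaves room for a perturbation of all the quantities
involved. -/
theorem IsArcHamiltonian.exists_room {H : ℝ → ℝ → ℝ} (hH : IsArcHamiltonian H) {s₀ q b : ℝ}
    (hs₀ : s₀ ∈ Icc (0 : ℝ) 1) (hneg : b + H s₀ q < 0) :
    ∃ ε > 0, ∀ s ∈ Icc (0 : ℝ) 1, |s - s₀| ≤ ε → ∀ y, |y| ≤ ε → b + ε + H s (q + y) ≤ 0 := by
  have h1 := (hH.continuousOn (s₀, q) ⟨hs₀, mem_univ _⟩).eventually_lt_const
    (u := (H s₀ q - b) / 2) (by simp only; linarith)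
  rw [eventually_nhdsWithin_iff] at h1
  obtain ⟨δ, hδ, h2⟩ := Metric.eventually_nhds_iff.1 h1
  refine ⟨min (δ / 2) (-(b + H s₀ q) / 2), lt_min (by positivity) (by linarith),
    fun s hs hss y hy => ?_⟩
  have d1 := min_le_left (δ / 2) (-(b + H s₀ q) / 2)
  have d2 := min_le_right (δ / 2) (-(b + H s₀ q) / 2)
  have := h2 (y := (s, q + y)) (by
    rw [Prod.dist_eq, Real.dist_eq, Real.dist_eq, add_sub_cancel_left]
    exact max_lt (by linarith) (by linarith)) ⟨hs, mem_univ _⟩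
  simp only at this
  linarith

namespace EmbeddedNetwork

variable {E : Type*} {N : ℕ} {Γ : EmbeddedNetwork E N} {H : E → ℝ → ℝ → ℝ}
  {c : EuclideanSpace ℝ (Fin N) → ℝ} {T₀ : ℝ} {T₁ : EReal}

theorem eq_or_eq_inv_of_arc_eq {e e' : E} {s s' : ℝ} (hs : s ∈ Ioo (0 : ℝ) 1)
    (hs' : s' ∈ Icc (0 : ℝ) 1) (h : Γ.arc e s = Γ.arc e' s') :
    e' = e ∧ s' = s ∨ e' = Γ.inv e ∧ s' = 1 - s := by
  by_cases h1 : e = e'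
  · subst h1
    exact Or.inl ⟨rfl, (Γ.arc_injOn e (Ioo_subset_Icc_self hs) hs' h).symm⟩
  by_cases h2 : e = Γ.inv e'
  · subst h2
    rw [Γ.arc_inv e' s (Ioo_subset_Icc_self hs)] at h
    have := Γ.arc_injOn e' ⟨by linarith [hs.2], by linarith [hs.1]⟩ hs' h
    exact Or.inr ⟨(Γ.inv_inv e').symm, this.symm⟩
  · exact absurd h fun h => (Set.disjoint_left.1 (Γ.arc_disjoint e e' h1 h2)
      (mem_image_of_mem _ hs)) ⟨s', hs', h.symm⟩

theorem arc_zero_ne_arc_one (e : E) : Γ.arc e 0 ≠ Γ.arc e 1 := fun h =>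
  zero_ne_one (Γ.arc_injOn e ⟨le_rfl, zero_le_one⟩ ⟨zero_le_one, le_rfl⟩ h)

theorem arc_notMem_vertices {e : E} {s : ℝ} (hs : s ∈ Ioo (0 : ℝ) 1) :
    Γ.arc e s ∉ Γ.vertices := by
  rintro ⟨e', h⟩
  rcases eq_or_eq_inv_of_arc_eq hs ⟨zero_le_one, le_rfl⟩ h.symm with ⟨-, h⟩ | ⟨-, h⟩
  · linarith [hs.2]
  · linarith [hs.1]

/-- Near a vertex, the coordinates along the arcs that end there are unambiguous. -/
theorem eq_of_arc_eq_of_arc_one_eq {e e' : E} (hee : Γ.arc e 1 = Γ.arc e' 1) {s s' : ℝ}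
    (hs : s ∈ Ioc (0 : ℝ) 1) (hs' : s' ∈ Ioc (0 : ℝ) 1) (h : Γ.arc e s = Γ.arc e' s') :
    s' = s ∧ (s = 1 ∨ e' = e) := by
  rcases hs.2.eq_or_lt with rfl | hs1
  · rw [hee] at h
    exact ⟨(Γ.arc_injOn e' ⟨zero_le_one, le_rfl⟩ (Ioc_subset_Icc_self hs') h).symm, Or.inl rfl⟩
  · rcases eq_or_eq_inv_of_arc_eq ⟨hs.1, hs1⟩ (Ioc_subset_Icc_self hs') h with ⟨h1, h2⟩ | ⟨h1, h2⟩
    · exact ⟨h2, Or.inr h1⟩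
    · subst h1
      rw [arc_inv_one] at hee
      exact absurd hee.symm (Γ.arc_zero_ne_arc_one e)

/-- `S` meets the arc `e` in the coordinates `[a₀, b₀]`, and along `e` the function
`Q + β (t - t₂)` is a subsolution over `S` that does not exceed `V` at time `t₁` and on the sides of
`S` inside the arc. -/
structure IsPatchAlong (Γ : EmbeddedNetwork E N) (H : E → ℝ → ℝ → ℝ)
    (V : EuclideanSpace ℝ (Fin N) → ℝ → ℝ) (S : Set (EuclideanSpace ℝ (Fin N)))
    (Q : EuclideanSpace ℝ (Fin N) → ℝ) (β t₁ t₂ : ℝ) (e : E) (a₀ b₀ : ℝ) : Prop where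
  mem_iff : ∀ s ∈ Icc (0 : ℝ) 1, Γ.arc e s ∈ S ↔ s ∈ Icc a₀ b₀
  sub : ∀ v m, ∀ s ∈ Icc a₀ b₀, (∀ p, p * v - H e s p ≤ m) → ∀ l, 0 ≤ l → s + l * v ∈ Icc a₀ b₀ →
    Q (Γ.arc e (s + l * v)) + l * β ≤ Q (Γ.arc e s) + l * m
  bot : ∀ s ∈ Icc a₀ b₀, Q (Γ.arc e s) + β * (t₁ - t₂) ≤ V (Γ.arc e s) t₁
  left : 0 < a₀ → ∀ t ∈ Icc t₁ t₂, Q (Γ.arc e a₀) + β * (t - t₂) ≤ V (Γ.arc e a₀) t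
  right : b₀ < 1 → ∀ t ∈ Icc t₁ t₂, Q (Γ.arc e b₀) + β * (t - t₂) ≤ V (Γ.arc e b₀) t

open Classical in
/-- The function `V`, raised to its maximum with `Q + β (t - t₂)` over `S × [t₁, t₂]`. -/
noncomputable def patch (V : EuclideanSpace ℝ (Fin N) → ℝ → ℝ) (S : Set (EuclideanSpace ℝ (Fin N)))
    (Q : EuclideanSpace ℝ (Fin N) → ℝ) (β t₁ t₂ : ℝ) : EuclideanSpace ℝ (Fin N) → ℝ → ℝ :=
  fun x t => if x ∈ S ∧ t ∈ Icc t₁ t₂ then max (V x t) (Q x + β * (t - t₂)) else V x t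

theorem IsIntegratedSub.patch (hH : Γ.IsHamiltonian H)
    {V : EuclideanSpace ℝ (Fin N) → ℝ → ℝ} (hV : Γ.IsIntegratedSub H c T₀ T₁ V)
    {S : Set (EuclideanSpace ℝ (Fin N))} {Q : EuclideanSpace ℝ (Fin N) → ℝ} {β t₁ t₂ : ℝ}
    (harcs : ∀ e, (∀ s ∈ Icc (0 : ℝ) 1, Γ.arc e s ∉ S) ∨
      (∃ a₀ b₀, Γ.IsPatchAlong H V S Q β t₁ t₂ e a₀ b₀) ∨
      ∃ a₀ b₀, Γ.IsPatchAlong H V S Q β t₁ t₂ (Γ.inv e) a₀ b₀)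
    (hvert : ∀ x ∈ Γ.vertices, x ∈ S → β ≤ c x ∧ Q x + β * (t₁ - t₂) ≤ V x t₁) :
    Γ.IsIntegratedSub H c T₀ T₁ (patch V S Q β t₁ t₂) := by
  have hpatch : ∀ e a₀ b₀, Γ.IsPatchAlong H V S Q β t₁ t₂ e a₀ b₀ →
      IsArcSub (H e) T₀ T₁ (fun s t => EmbeddedNetwork.patch V S Q β t₁ t₂ (Γ.arc e s) t) := by
    intro e a₀ b₀ h
    refine (hV.arcs e).max_box (F := fun s t => Q (Γ.arc e s) + β * (t - t₂)) (a₀ := a₀) (b₀ := b₀)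
      (t₁ := t₁) (t₂ := t₂) ?_ h.bot h.left h.right ?_ ?_
    · intro v m s hs hm t l hl hs' _ _
      have := h.sub v m s hs hm l hl hs'
      linarith
    · intro s hs t hs' ht
      simp only [EmbeddedNetwork.patch]
      rw [if_pos ⟨(h.mem_iff s hs).2 hs', ht⟩]
    · intro s hs t hn
      simp only [EmbeddedNetwork.patch]
      rw [if_neg fun h' => hn ⟨(h.mem_iff s hs).1 h'.1, h'.2⟩]
  constructor
  · intro e
    rcases harcs e with h | ⟨a₀, b₀, h⟩ | ⟨a₀, b₀, h⟩
    · intro a b ha hab hb v m hm s hs t ht l hl hs' htl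
      simp only [EmbeddedNetwork.patch]
      rw [if_neg fun h' => h _ ⟨ha.trans hs'.1, hs'.2.trans hb⟩ h'.1,
        if_neg fun h' => h _ ⟨ha.trans hs.1, hs.2.trans hb⟩ h'.1]
      exact hV.arcs e a b ha hab hb v m hm s hs t ht l hl hs' htl
    · exact hpatch e a₀ b₀ h
    · refine (hpatch _ a₀ b₀ h).reverse (fun s hs p => ?_) fun s hs t => ?_
      · rw [hH.inv e (1 - s) ⟨by linarith [hs.2], by linarith [hs.1]⟩, sub_sub_cancel, neg_neg]
      · rw [Γ.arc_inv e (1 - s) ⟨by linarith [hs.2], by linarith [hs.1]⟩, sub_sub_cancel]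
  · intro x hx t ht l hl htl
    have hbase := hV.vertices x hx t ht l hl htl
    have hle : V x t ≤ EmbeddedNetwork.patch V S Q β t₁ t₂ x t := by
      simp only [EmbeddedNetwork.patch]; split_ifs
      · exact le_max_left _ _
      · exact le_rfl
    by_cases hend : x ∈ S ∧ t + l ∈ Icc t₁ t₂
    swap
    · have : EmbeddedNetwork.patch V S Q β t₁ t₂ x (t + l) = V x (t + l) := by
        simp only [EmbeddedNetwork.patch]; rw [if_neg hend]
      rw [this]; linarith
    obtain ⟨hβ, hbot⟩ := hvert x hx hend.1
    have : EmbeddedNetwork.patch V S Q β t₁ t₂ x (t + l) =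
        max (V x (t + l)) (Q x + β * (t + l - t₂)) := by
      simp only [EmbeddedNetwork.patch]; rw [if_pos hend]
    rw [this]
    refine max_le (by linarith) ?_
    have hβl := mul_le_mul_of_nonneg_left hβ hl
    rcases le_or_gt t₁ t with h1 | h1
    · have : Q x + β * (t - t₂) ≤ EmbeddedNetwork.patch V S Q β t₁ t₂ x t := by
        simp only [EmbeddedNetwork.patch]
        rw [if_pos ⟨hend.1, h1, by linarith [hend.2.2]⟩]
        exact le_max_right _ _
      linarith
    · have h2 := hV.vertices x hx t ht (t₁ - t) (by linarith)
        (EReal.coe_lt_of_le_of_lt (by linarith [hend.2.1]) htl)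
      rw [add_sub_cancel] at h2
      have h3 := mul_le_mul_of_nonneg_left hβ (by linarith [hend.2.1] : 0 ≤ t + l - t₁)
      linarith

section Super

variable [Finite E] (hH : Γ.IsHamiltonian H) {g : EuclideanSpace ℝ (Fin N) → ℝ}
  (hg : ContinuousOn g Γ.carrier)
include hH hg

/-- No patch lifts the maximal subsolution. -/
theorem patch_le_maximalSub {S : Set (EuclideanSpace ℝ (Fin N))}
    {Q : EuclideanSpace ℝ (Fin N) → ℝ} {β t₁ t₂ : ℝ} (ht₁ : T₀ < t₁) (ht₁₂ : t₁ ≤ t₂)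
    (ht₂ : (t₂ : EReal) < T₁)
    (harcs : ∀ e, (∀ s ∈ Icc (0 : ℝ) 1, Γ.arc e s ∉ S) ∨
      (∃ a₀ b₀, Γ.IsPatchAlong H (Γ.maximalSub H c T₀ T₁ g) S Q β t₁ t₂ e a₀ b₀) ∨
      ∃ a₀ b₀, Γ.IsPatchAlong H (Γ.maximalSub H c T₀ T₁ g) S Q β t₁ t₂ (Γ.inv e) a₀ b₀)
    (hvert : ∀ x ∈ Γ.vertices, x ∈ S →
      β ≤ c x ∧ Q x + β * (t₁ - t₂) ≤ Γ.maximalSub H c T₀ T₁ g x t₁)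
    {x : EuclideanSpace ℝ (Fin N)} (hx : x ∈ Γ.carrier) (hxS : x ∈ S) :
    Q x ≤ Γ.maximalSub H c T₀ T₁ g x t₂ := by
  have hne := subsBelow_nonempty (c := c) (T₀ := T₀) (T₁ := T₁) hH hg
  have h1 := (maximalSub_isIntegratedSub hH hne).patch hH harcs hvert
  have h2 := le_maximalSub (g := g) hH (w := EmbeddedNetwork.patch _ S Q β t₁ t₂)
    ⟨h1, fun y hy => ?_⟩
    hx (t := t₂) ⟨by linarith, ht₂⟩
  · refine le_trans ?_ h2
    simp only [EmbeddedNetwork.patch]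
    rw [if_pos ⟨hxS, ht₁₂, le_rfl⟩]
    refine le_trans ?_ (le_max_right _ _)
    simp
  · simp only [EmbeddedNetwork.patch]
    rw [if_neg fun h => absurd h.2.1 (not_le.2 ht₁)]
    exact maximalSub_init_le hne hy

theorem continuousOn_arc_maximalSub (hT₁ : (T₀ : EReal) < T₁) (e : E) :
    ContinuousOn (fun q : ℝ × ℝ => Γ.maximalSub H c T₀ T₁ g (Γ.arc e q.1) q.2)
      (Icc 0 1 ×ˢ timeIco T₀ T₁) :=
  (uniformContinuousOn_maximalSub (c := c) hH hg hT₁).continuousOn.comp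
    (f := fun q : ℝ × ℝ => (Γ.arc e q.1, q.2))
    (((Γ.continuousOn_arc e).comp continuousOn_fst fun _ hq => hq.1).prodMk continuousOn_snd)
    fun _ hq => ⟨arc_mem_carrier e hq.1, hq.2⟩

/-- Inside the arcs the maximal subsolution is a supersolution: otherwise it could be lifted by
a concave wedge around the contact point. -/
theorem maximalSub_isViscositySupersolution (e : E) :
    IsViscositySupersolution (H e) T₀ T₁
      (fun q => Γ.maximalSub H c T₀ T₁ g (Γ.arc e q.1) q.2) := by
  intro s₀ hs₀ t₀ ht₀ φ hφ hmin
  rw [(deriv_slice_snd hφ s₀ t₀).deriv, (deriv_slice_fst hφ s₀ t₀).deriv]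
  set V := Γ.maximalSub H c T₀ T₁ g with hV
  set q := fderiv ℝ φ (s₀, t₀) (1, 0) with hq
  set b := fderiv ℝ φ (s₀, t₀) (0, 1) with hb
  by_contra! hneg
  obtain ⟨ε, hε, hroom⟩ := (hH.arc e).exists_room (Ioo_subset_Icc_self hs₀) hneg
  have hlin : ∀ᶠ z in 𝓝 (s₀, t₀), V (Γ.arc e s₀) t₀ + q * (z.1 - s₀) + b * (z.2 - t₀)
      - ε / 2 * (|z.1 - s₀| + |z.2 - t₀|) ≤ V (Γ.arc e z.1) z.2 := by
    have h1 := (hφ.differentiable one_ne_zero (s₀, t₀)).hasFDerivAt.isLittleO.bound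
      (show 0 < ε / 2 by positivity)
    filter_upwards [h1, hmin] with z h1 h2
    have h3 : fderiv ℝ φ (s₀, t₀) (z - (s₀, t₀)) = (z.1 - s₀) * q + (z.2 - t₀) * b := by
      have : (z - (s₀, t₀) : ℝ × ℝ) = (z.1 - s₀) • (1, 0) + (z.2 - t₀) • (0, 1) := by
        ext <;> simp
      rw [this, map_add, map_smul, map_smul, smul_eq_mul, smul_eq_mul]
    have h4 : ‖z - (s₀, t₀)‖ ≤ |z.1 - s₀| + |z.2 - t₀| := by
      rw [Prod.norm_def]
      simp only [Prod.fst_sub, Prod.snd_sub, Real.norm_eq_abs]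
      exact max_le (by linarith [abs_nonneg (z.2 - t₀)]) (by linarith [abs_nonneg (z.1 - s₀)])
    rw [h3, Real.norm_eq_abs] at h1
    have h5 := (abs_le.1 h1).1
    have h6 := mul_le_mul_of_nonneg_left h4 (show 0 ≤ ε / 2 by positivity)
    linarith
  obtain ⟨δ, hδ, hlin⟩ := Metric.eventually_nhds_iff.1 hlin
  obtain ⟨r, hr, hr'⟩ : ∃ r > 0, r < δ ∧ r ≤ ε ∧ r < s₀ ∧ r < 1 - s₀ ∧ r < t₀ - T₀ := by
    have h1 := hs₀.1
    have h2 := hs₀.2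
    have h3 := ht₀.1
    refine ⟨min (min δ ε) (min (min s₀ (1 - s₀)) (t₀ - T₀)) / 2, ?_, ?_⟩
    · apply half_pos; simp only [lt_min_iff]
      refine ⟨⟨hδ, hε⟩, ⟨?_, ?_⟩, ?_⟩ <;> linarith
    · set d := min (min δ ε) (min (min s₀ (1 - s₀)) (t₀ - T₀)) with hd
      have hd0 : 0 < d := by
        simp only [hd, lt_min_iff]; refine ⟨⟨hδ, hε⟩, ⟨?_, ?_⟩, ?_⟩ <;> linarith
      have e1 : d ≤ δ := (min_le_left _ _).trans (min_le_left _ _)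
      have e2 : d ≤ ε := (min_le_left _ _).trans (min_le_right _ _)
      have e3 : d ≤ s₀ := (min_le_right _ _).trans ((min_le_left _ _).trans (min_le_left _ _))
      have e4 : d ≤ 1 - s₀ := (min_le_right _ _).trans ((min_le_left _ _).trans (min_le_right _ _))
      have e5 : d ≤ t₀ - T₀ := (min_le_right _ _).trans (min_le_right _ _)
      refine ⟨?_, ?_, ?_, ?_, ?_⟩ <;> linarith
  obtain ⟨hr1, hr2, hr3, hr4, hr5⟩ := hr'
  set a₀ := s₀ - r with ha₀
  set b₀ := s₀ + r with hb₀
  have hsub : ∀ s ∈ Icc a₀ b₀, s ∈ Icc (0 : ℝ) 1 := fun s hs =>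
    ⟨by linarith [hs.1], by linarith [hs.2]⟩
  set ρ : ℝ → ℝ := fun s => V (Γ.arc e s₀) t₀ + ε / 2 * r + q * (s - s₀) - ε * |s - s₀| with hρ
  obtain ⟨Q, hQ⟩ : ∃ Q : EuclideanSpace ℝ (Fin N) → ℝ, ∀ s ∈ Icc a₀ b₀, Q (Γ.arc e s) = ρ s := by
    have hfac : Function.FactorsThrough (fun s : Icc a₀ b₀ => ρ s)
        (fun s : Icc a₀ b₀ => Γ.arc e s) := fun s s' h =>
      congrArg ρ (Γ.arc_injOn e (hsub s s.2) (hsub s' s'.2) h)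
    exact ⟨_, fun s hs => hfac.extend_apply (fun _ => 0) ⟨s, hs⟩⟩
  have hgap : ∀ s ∈ Icc a₀ b₀, ∀ t ∈ Icc (t₀ - r) t₀, r ≤ |s - s₀| + (t₀ - t) →
      Q (Γ.arc e s) + (b + ε) * (t - t₀) ≤ V (Γ.arc e s) t := by
    intro s hs t ht hge
    have hss : |s - s₀| ≤ r := abs_le.2 ⟨by linarith [hs.1], by linarith [hs.2]⟩
    have htt : |t - t₀| = t₀ - t := by rw [abs_of_nonpos (by linarith [ht.2])]; ring
    have h1 := hlin (y := (s, t)) (by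
      rw [Prod.dist_eq, Real.dist_eq, Real.dist_eq, htt]
      exact max_lt (by linarith) (by linarith [ht.1]))
    simp only [htt] at h1
    rw [hQ s hs, hρ]
    simp only
    nlinarith
  have hpatch : Γ.IsPatchAlong H V (Γ.arc e '' Icc a₀ b₀) Q (b + ε) (t₀ - r) t₀ e a₀ b₀ := by
    refine ⟨?_, ?_, ?_, ?_, ?_⟩
    · intro s hs
      refine ⟨?_, fun h => mem_image_of_mem _ h⟩
      rintro ⟨s', hs', h⟩
      rwa [← Γ.arc_injOn e (hsub s' hs') hs h]
    · intro v m s hs hm l hl hs'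
      rw [hQ s hs, hQ _ hs']
      have hss : |s - s₀| ≤ ε := (abs_le.2 ⟨by linarith [hs.1], by linarith [hs.2]⟩ :
        |s - s₀| ≤ r).trans hr2
      have h1 : q * v + ε * |v| + (b + ε) ≤ m := by
        rcases le_total 0 v with hv | hv
        · have e1 := hm (q + ε)
          have e2 := hroom s (hsub s hs) hss ε (abs_of_pos hε).le
          rw [abs_of_nonneg hv]
          linarith
        · have e1 := hm (q + -ε)
          have e2 := hroom s (hsub s hs) hss (-ε) (by rw [abs_neg, abs_of_pos hε])
          rw [abs_of_nonpos hv]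
          linarith
      have h2 : |s - s₀| ≤ |s + l * v - s₀| + l * |v| := by
        have e1 : s - s₀ = (s + l * v - s₀) - l * v := by ring
        have e2 : l * |v| = |l * v| := by rw [abs_mul, abs_of_nonneg hl]
        rw [e2]
        nth_rewrite 1 [e1]
        exact abs_sub _ _
      have h3 := mul_le_mul_of_nonneg_left h1 hl
      have h4 := mul_le_mul_of_nonneg_left h2 hε.le
      simp only [hρ]
      linarith
    · intro s hs
      have := hgap s hs (t₀ - r) ⟨le_rfl, by linarith⟩ (by linarith [abs_nonneg (s - s₀)])
      exact this
    · intro _ t ht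
      refine hgap a₀ ⟨le_rfl, by linarith⟩ t ht ?_
      have : |a₀ - s₀| = r := by rw [ha₀, sub_sub_cancel_left, abs_neg, abs_of_pos hr]
      linarith [ht.2]
    · intro _ t ht
      refine hgap b₀ ⟨by linarith, le_rfl⟩ t ht ?_
      have : |b₀ - s₀| = r := by rw [hb₀, add_sub_cancel_left, abs_of_pos hr]
      linarith [ht.2]
  have hfin := patch_le_maximalSub (c := c) (T₀ := T₀) (T₁ := T₁) (g := g)
    (S := Γ.arc e '' Icc a₀ b₀) (Q := Q) (β := b + ε) (t₁ := t₀ - r) (t₂ := t₀) hH hg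
    (by linarith) (by linarith) ht₀.2 (by
      intro e'
      by_cases h1 : e' = e
      · subst h1; exact Or.inr (Or.inl ⟨a₀, b₀, hpatch⟩)
      by_cases h2 : e' = Γ.inv e
      · subst h2
        refine Or.inr (Or.inr ⟨a₀, b₀, ?_⟩)
        rw [Γ.inv_inv]; exact hpatch
      · refine Or.inl ?_
        rintro s hs ⟨s', hs', h⟩
        rcases eq_or_eq_inv_of_arc_eq (e := e) (e' := e') (s := s')
          ⟨by linarith [hs'.1], by linarith [hs'.2]⟩ hs h with ⟨h, -⟩ | ⟨h, -⟩
        · exact h1 h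
        · exact h2 h) (by
      rintro x hx ⟨s, hs, rfl⟩
      exact absurd hx (arc_notMem_vertices ⟨by linarith [hs.1], by linarith [hs.2]⟩))
    (arc_mem_carrier e (Ioo_subset_Icc_self hs₀))
    (mem_image_of_mem _ ⟨by linarith, by linarith⟩)
  rw [hQ s₀ ⟨by linarith, by linarith⟩, hρ] at hfin
  simp only [sub_self, mul_zero, abs_zero, add_zero, sub_zero] at hfin
  have : 0 < ε / 2 * r := by positivity
  linarith

/-- At the vertices the maximal subsolution is a supersolution. If all arcs that end at `x` failed,
`IsViscositySupersolution.tilt` would bring their subtangents to a common time slope `b < c x`,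
and the resulting affine functions would lift the maximal subsolution near `x`. -/
theorem maximalSub_vertex (hT₁ : (T₀ : EReal) < T₁) {x : EuclideanSpace ℝ (Fin N)}
    (hx : x ∈ Γ.vertices) {t₀ : ℝ} (ht₀ : t₀ ∈ timeIoo T₀ T₁) {ψ : ℝ → ℝ} (hψ : ContDiff ℝ 1 ψ)
    (hψmin : IsLocalMin (fun t => Γ.maximalSub H c T₀ T₁ g x t - ψ t) t₀)
    (hψc : deriv ψ t₀ < c x) :
    ∃ e, Γ.arc e 1 = x ∧ ∀ φ : ℝ × ℝ → ℝ, ContDiff ℝ 1 φ →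
      IsLocalMinOn (fun q : ℝ × ℝ => Γ.maximalSub H c T₀ T₁ g (Γ.arc e q.1) q.2 - φ q)
        (Icc 0 1 ×ˢ timeIco T₀ T₁) (1, t₀) →
      0 ≤ deriv (fun t => φ (1, t)) t₀ + H e 1 (deriv (fun s => φ (s, t₀)) 1) := by
  by_contra! hcon
  set V := Γ.maximalSub H c T₀ T₁ g with hV
  choose! φ hφ hφmin hφneg using hcon
  set A : Set E := {e | Γ.arc e 1 = x} with hA
  have hAne : Nonempty A := by
    obtain ⟨e, he⟩ := hx
    exact ⟨⟨e, he⟩⟩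
  -- a subtangent of the trace at `x` whose slope is the least one
  obtain ⟨ψ, hψ, hψmin, hψc, hψle⟩ : ∃ ψ : ℝ → ℝ, ContDiff ℝ 1 ψ ∧
      IsLocalMin (fun t => V x t - ψ t) t₀ ∧ deriv ψ t₀ < c x ∧
      ∀ e, Γ.arc e 1 = x → deriv ψ t₀ ≤ deriv (fun t => φ e (1, t)) t₀ := by
    obtain ⟨⟨e₁, he₁⟩, hmin⟩ := Finite.exists_min fun e : A => deriv (fun t => φ e (1, t)) t₀
    rcases le_total (deriv ψ t₀) (deriv (fun t => φ e₁ (1, t)) t₀) with h | h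
    · exact ⟨ψ, hψ, hψmin, hψc, fun e he => h.trans (hmin ⟨e, he⟩)⟩
    · refine ⟨fun t => φ e₁ (1, t), (hφ e₁ he₁).comp (by fun_prop), ?_, h.trans_lt hψc,
        fun e he => hmin ⟨e, he⟩⟩
      have h1 := eventually_nhdsWithin_iff.1 (hφmin e₁ he₁)
      have h2 : Tendsto (fun t : ℝ => ((1 : ℝ), t)) (𝓝 t₀) (𝓝 (1, t₀)) :=
        (by fun_prop : Continuous (fun t : ℝ => ((1 : ℝ), t))).tendsto t₀
      obtain ⟨T, hT, hTT⟩ := EReal.exists_gt_coe_lt ht₀.2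
      have he₁' : Γ.arc e₁ 1 = x := he₁
      filter_upwards [h2.eventually h1, Ioo_mem_nhds ht₀.1 hT] with t h3 h4
      have := h3 ⟨⟨zero_le_one, le_rfl⟩, h4.1.le, EReal.coe_lt_of_le_of_lt h4.2.le hTT⟩
      simpa only [he₁'] using this
  set b := deriv ψ t₀ with hb
  set q : E → ℝ := fun e => deriv (fun s => φ e (s, t₀)) 1 with hq
  have hroom : ∀ e : A, ∃ ε > 0, ∀ s ∈ Icc (0 : ℝ) 1, |s - 1| ≤ ε → ∀ y, |y| ≤ ε →
      b + ε + H e s (q e + y) ≤ 0 := fun e =>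
    (hH.arc e).exists_room ⟨zero_le_one, le_rfl⟩ (by linarith [hφneg e e.2, hψle e e.2])
  choose ε' hε' hroom using hroom
  obtain ⟨ε'', hε'', hεle⟩ := Finite.exists_pos_le hε'
  set ε := min ε'' (c x - b) with hε
  have hε0 : 0 < ε := lt_min hε'' (by linarith)
  have hεA : ∀ e : A, ε ≤ ε' e := fun e => (min_le_left _ _).trans (hεle e)
  have hεc : b + ε ≤ c x := by linarith [min_le_right ε'' (c x - b)]
  have htilt : ∀ e : A, ∃ r > 0, ∀ s ∈ Icc (1 - r) 1, ∀ t ∈ Icc (t₀ - r) (t₀ + r),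
      V x t₀ + q e * (s - 1) + b * (t - t₀) - ε / 2 * ((1 - s) + |t - t₀|) ≤
        V (Γ.arc e s) t := by
    intro ⟨e, he⟩
    have he' : Γ.arc e 1 = x := he
    have := IsViscositySupersolution.tilt (hH.arc e)
      (w := fun s t => V (Γ.arc e s) t) (continuousOn_arc_maximalSub hH hg hT₁ e)
      (maximalSub_isViscositySupersolution hH hg e) ht₀ (hφ e he) (hφmin e he) (hφneg e he)
      hψ (by simpa only [he'] using hψmin) (hψle e he) (ε / 2) (by positivity)
    simpa only [he'] using this
  choose r' hr' htilt using htilt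
  obtain ⟨r'', hr'', hrle⟩ := Finite.exists_pos_le hr'
  obtain ⟨r, hr, hr1, hr2, hr3, hr4⟩ : ∃ r > 0, r ≤ r'' ∧ r ≤ ε ∧ r < 1 ∧ r < t₀ - T₀ := by
    have h3 := ht₀.1
    set d := min (min r'' ε) (min 1 (t₀ - T₀)) with hd
    have hd0 : 0 < d := by
      simp only [hd, lt_min_iff]; refine ⟨⟨hr'', hε0⟩, one_pos, by linarith⟩
    have e1 : d ≤ r'' := (min_le_left _ _).trans (min_le_left _ _)
    have e2 : d ≤ ε := (min_le_left _ _).trans (min_le_right _ _)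
    have e3 : d ≤ 1 := (min_le_right _ _).trans (min_le_left _ _)
    have e4 : d ≤ t₀ - T₀ := (min_le_right _ _).trans (min_le_right _ _)
    refine ⟨d / 2, by linarith, ?_, ?_, ?_, ?_⟩ <;> linarith
  set ρ : E → ℝ → ℝ := fun e s => V x t₀ + ε / 2 * r + (q e + ε) * (s - 1) with hρ
  set S : Set (EuclideanSpace ℝ (Fin N)) := {y | ∃ e ∈ A, ∃ s ∈ Icc (1 - r) 1, Γ.arc e s = y}
    with hS
  have hIoc : ∀ s ∈ Icc (1 - r) 1, s ∈ Ioc (0 : ℝ) 1 := fun s hs => ⟨by linarith [hs.1], hs.2⟩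
  obtain ⟨Q, hQ⟩ : ∃ Q : EuclideanSpace ℝ (Fin N) → ℝ, ∀ e ∈ A, ∀ s ∈ Icc (1 - r) 1,
      Q (Γ.arc e s) = ρ e s := by
    have hfac : Function.FactorsThrough (fun z : A × Icc (1 - r) 1 => ρ z.1 z.2)
        (fun z : A × Icc (1 - r) 1 => Γ.arc z.1 z.2) := by
      rintro ⟨⟨e, he⟩, ⟨s, hs⟩⟩ ⟨⟨e', he'⟩, ⟨s', hs'⟩⟩ h
      have he1 : Γ.arc e 1 = x := he
      have he1' : Γ.arc e' 1 = x := he'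
      obtain ⟨rfl, h2 | rfl⟩ := eq_of_arc_eq_of_arc_one_eq (he1.trans he1'.symm) (hIoc s hs)
        (hIoc s' hs') h
      · simp only [hρ, h2, sub_self, mul_zero]
      · rfl
    exact ⟨_, fun e he s hs => hfac.extend_apply (fun _ => 0) (⟨e, he⟩, ⟨s, hs⟩)⟩
  have hgap : ∀ e ∈ A, ∀ s ∈ Icc (1 - r) 1, ∀ t ∈ Icc (t₀ - r) t₀, r ≤ (1 - s) + (t₀ - t) →
      Q (Γ.arc e s) + (b + ε) * (t - t₀) ≤ V (Γ.arc e s) t := by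
    intro e he s hs t ht hge
    have hrr := hr1.trans (hrle ⟨e, he⟩)
    have htt : |t - t₀| = t₀ - t := by rw [abs_of_nonpos (by linarith [ht.2])]; ring
    have h1 := htilt ⟨e, he⟩ s ⟨by linarith [hs.1], hs.2⟩ t ⟨by linarith [ht.1], by linarith [ht.2]⟩
    rw [htt] at h1
    rw [hQ e he s hs]
    have h2 := mul_le_mul_of_nonneg_left hge (show 0 ≤ ε / 2 by positivity)
    simp only [hρ]
    simp only at h1
    linarith
  have hpatch : ∀ e ∈ A, Γ.IsPatchAlong H V S Q (b + ε) (t₀ - r) t₀ e (1 - r) 1 := by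
    intro e he
    have he1 : Γ.arc e 1 = x := he
    refine ⟨?_, ?_, ?_, ?_, ?_⟩
    · intro s hs
      refine ⟨?_, fun h => ⟨e, he, s, h, rfl⟩⟩
      rintro ⟨e', he', s', hs', h⟩
      have he1' : Γ.arc e' 1 = x := he'
      rcases hs.1.eq_or_lt with rfl | hs0
      · -- the other end point of `e` is not in the star of `x`
        rcases (hIoc s' hs').2.eq_or_lt with rfl | h1
        · rw [he1', ← he1] at h
          exact absurd h.symm (Γ.arc_zero_ne_arc_one e)
        · exact absurd (h ▸ Γ.arc_zero_mem_vertices e)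
            (arc_notMem_vertices (e := e') ⟨(hIoc s' hs').1, h1⟩)
      · have := (eq_of_arc_eq_of_arc_one_eq (he1.trans he1'.symm) ⟨hs0, hs.2⟩ (hIoc s' hs')
          h.symm).1
        rwa [← this]
    · intro v m s hs hm l hl hs'
      rw [hQ e he s hs, hQ e he _ hs']
      have hss : |s - 1| ≤ ε' ⟨e, he⟩ := by
        rw [abs_le]
        have := hεA ⟨e, he⟩
        constructor <;> linarith [hs.1, hs.2]
      have h1 := hroom ⟨e, he⟩ s (Ioc_subset_Icc_self (hIoc s hs)) hss ε
        (by rw [abs_of_pos hε0]; exact hεA ⟨e, he⟩)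
      have h2 := hm (q e + ε)
      have h3 := hεA ⟨e, he⟩
      simp only at h1
      have h4 : (q e + ε) * v + (b + ε) ≤ m := by linarith
      have h5 := mul_le_mul_of_nonneg_left h4 hl
      simp only [hρ]
      linarith
    · intro s hs
      exact hgap e he s hs (t₀ - r) ⟨le_rfl, by linarith⟩ (by linarith [hs.2])
    · intro _ t ht
      exact hgap e he (1 - r) ⟨le_rfl, by linarith⟩ t ht (by linarith [ht.2])
    · intro h
      exact absurd h (lt_irrefl 1)
  obtain ⟨e₀, he₀⟩ := id hx
  simp only at he₀
  have h1mem : (1 : ℝ) ∈ Icc (1 - r) 1 := ⟨by linarith, le_rfl⟩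
  have hQx : Q x = V x t₀ + ε / 2 * r := by
    have := hQ e₀ he₀ 1 h1mem
    rw [he₀] at this
    simpa [hρ] using this
  have hxS : x ∈ S := ⟨e₀, he₀, 1, h1mem, he₀⟩
  have hfin := patch_le_maximalSub (c := c) (T₀ := T₀) (T₁ := T₁) (g := g) (S := S) (Q := Q)
    (β := b + ε) (t₁ := t₀ - r) (t₂ := t₀) hH hg (by linarith) (by linarith) ht₀.2 (by
      intro e
      by_cases h1 : e ∈ A
      · exact Or.inr (Or.inl ⟨_, _, hpatch e h1⟩)
      by_cases h2 : Γ.inv e ∈ A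
      · exact Or.inr (Or.inr ⟨_, _, hpatch _ h2⟩)
      · refine Or.inl ?_
        rintro s hs ⟨e', he', s', hs', h⟩
        have he1' : Γ.arc e' 1 = x := he'
        rcases (hIoc s' hs').2.eq_or_lt with rfl | h3
        · -- `x` itself is not on the arc `e`
          rcases hs.1.eq_or_lt with rfl | hs0
          · exact h2 (by rw [hA, mem_ofPred_eq, arc_inv_one, ← h, he1'])
          rcases hs.2.eq_or_lt with rfl | hs1
          · exact h1 (by rw [hA, mem_ofPred_eq, ← h, he1'])
          · exact arc_notMem_vertices (e := e) ⟨hs0, hs1⟩ ⟨e', h⟩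
        · rcases eq_or_eq_inv_of_arc_eq ⟨(hIoc s' hs').1, h3⟩ hs h with ⟨h, -⟩ | ⟨h, -⟩
          · exact h1 (h ▸ he')
          · refine h2 ?_
            rw [h, Γ.inv_inv]; exact he') (by
      rintro y hy ⟨e, he, s, hs, rfl⟩
      have he1 : Γ.arc e 1 = x := he
      rcases (hIoc s hs).2.eq_or_lt with rfl | h3
      · rw [he1]
        refine ⟨hεc, ?_⟩
        have := hgap e he 1 h1mem (t₀ - r) ⟨le_rfl, by linarith⟩ (by linarith)
        rwa [he1] at this
      · exact absurd hy (arc_notMem_vertices ⟨(hIoc s hs).1, h3⟩))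
    (vertices_subset_carrier hx) hxS
  rw [hQx] at hfin
  have : 0 < ε / 2 * r := by positivity
  linarith

end Super

end EmbeddedNetwork

/-! ### Smoothing of subsolutions in space -/

theorem contDiff_one_of_partials {f f₁ f₂ : ℝ × ℝ → ℝ}
    (h₁ : ∀ s t, HasDerivAt (fun r => f (r, t)) (f₁ (s, t)) s)
    (h₂ : ∀ s t, HasDerivAt (fun r => f (s, r)) (f₂ (s, t)) t) (c₁ : Continuous f₁)
    (c₂ : Continuous f₂) : ContDiff ℝ 1 f := by
  set L : ℝ →L[ℝ] (ℝ →L[ℝ] ℝ) := ContinuousLinearMap.toSpanSingletonCLE.toContinuousLinearMap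
  have key : ∀ u : ℝ × ℝ, HasFDerivAt f ((ContinuousLinearMap.toSpanSingleton ℝ (f₁ u)).coprod
      (ContinuousLinearMap.toSpanSingleton ℝ (f₂ u))) u := by
    intro u
    have := hasStrictFDerivAt_uncurry_coprod (𝕜 := ℝ) (u := u) (f := fun s t => f (s, t))
      (f₁ := fun s t => ContinuousLinearMap.toSpanSingleton ℝ (f₁ (s, t)))
      (f₂ := fun s t => ContinuousLinearMap.toSpanSingleton ℝ (f₂ (s, t)))
      (Eventually.of_forall fun v => (h₁ v.1 v.2).hasFDerivAt)
      (Eventually.of_forall fun v => (h₂ v.1 v.2).hasFDerivAt)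
      (Continuous.continuousAt (L.continuous.comp c₁))
      (Continuous.continuousAt (L.continuous.comp c₂))
    exact this.hasFDerivAt
  rw [contDiff_one_iff_hasFDerivAt]
  refine ⟨_, ?_, key⟩
  have h1 := (L.continuous.comp c₁)
  have h2 := (L.continuous.comp c₂)
  have : Continuous (fun u : ℝ × ℝ => (L (f₁ u)).comp (ContinuousLinearMap.fst ℝ ℝ ℝ) +
      (L (f₂ u)).comp (ContinuousLinearMap.snd ℝ ℝ ℝ)) :=
    (h1.clm_comp continuous_const).add (h2.clm_comp continuous_const)
  refine this.congr fun u => ?_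
  ext <;> simp [L]

theorem hasDerivAt_average {f : ℝ → ℝ} (hf : Continuous f) {τ : ℝ} (hτ : τ ≠ 0) (t : ℝ) :
    HasDerivAt (fun t => ∫ y in (0 : ℝ)..1, f (t + τ * y)) ((f (t + τ) - f t) / τ) t := by
  set Φ : ℝ → ℝ := fun x => ∫ σ in (0 : ℝ)..x, f σ with hΦ
  have hΦd : ∀ x, HasDerivAt Φ (f x) x := fun x =>
    (hf.integral_hasStrictDerivAt 0 x).hasDerivAt
  have e4 : (fun t => ∫ y in (0 : ℝ)..1, f (t + τ * y)) = fun t => τ⁻¹ * (Φ (t + τ) - Φ t) := by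
    funext r
    simp only [hΦ]
    rw [intervalIntegral.integral_comp_add_mul f hτ, smul_eq_mul, mul_zero,
      add_zero, mul_one, intervalIntegral.integral_interval_sub_left
        (hf.intervalIntegrable _ _) (hf.intervalIntegrable _ _)]
  rw [e4]
  have e1 : HasDerivAt (fun t => Φ (t + τ)) (f (t + τ)) t := (hΦd (t + τ)).comp_add_const t τ
  refine ((e1.sub (hΦd t)).const_mul τ⁻¹).congr_deriv ?_
  field_simp

/-- Smoothing in space of a subsolution `A` that is already smooth in time. The average of `A` over
`[(1 - ε) s, (1 - ε) s + ε]` is `C¹` and almost a subsolution; adding the affine interpolation of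
its errors at the two end points restores the boundary values without spoiling this, since
these errors are small together with their time derivatives. -/
theorem IsArcSub.exists_contDiff_approx {H : ℝ → ℝ → ℝ} (hH : IsArcHamiltonian H) {T₀ T : ℝ}
    {A A' : ℝ → ℝ → ℝ} (hA : IsArcSub H T₀ T A) (hAc : Continuous fun q : ℝ × ℝ => A q.1 q.2)
    (hA'c : Continuous fun q : ℝ × ℝ => A' q.1 q.2)
    (hder : ∀ s t, HasDerivAt (A s) (A' s t) t) {K : ℝ} (hK : 0 < K)
    (hAK : ∀ s s' t, |A s t - A s' t| ≤ K * |s - s'|)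
    (hA'K : ∀ s s' t, |A' s t - A' s' t| ≤ K * |s - s'|) (hA'b : ∀ s t, |A' s t| ≤ K) {η : ℝ}
    (hη : 0 < η) :
    ∃ U : ℝ × ℝ → ℝ, ContDiff ℝ 1 U ∧ (∀ t, U (1, t) = A 1 t) ∧ (∀ t, U (0, t) = A 0 t) ∧
      (∀ s ∈ Icc (0 : ℝ) 1, ∀ t, |U (s, t) - A s t| ≤ η) ∧
      ∀ s ∈ Icc (0 : ℝ) 1, ∀ t ∈ Ioo T₀ T,
        deriv (fun r => U (s, r)) t + H s (deriv (fun r => U (r, t)) s) ≤ η := by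
  obtain ⟨h, hh, hspeed⟩ := hH.exists_speed K (show 0 < η / 4 by positivity)
  obtain ⟨ω, hω, huc⟩ := Metric.uniformContinuousOn_iff.1 (hH.uniformContinuousOn (K + 1))
    (η / 4) (by positivity)
  obtain ⟨ε, hε, hε1, hεh, hεη, hε3, hεω⟩ : ∃ ε > 0, ε < 1 ∧ ε < h ∧ 4 * (K * ε) ≤ η ∧
      3 * (K * ε) ≤ 1 ∧ 3 * (K * ε) < ω := by
    set d := min (min 1 h) (min (min (η / K) (1 / K)) (ω / K)) with hd
    have hd0 : 0 < d := by
      simp only [hd, lt_min_iff]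
      refine ⟨⟨one_pos, hh⟩, ⟨?_, ?_⟩, ?_⟩ <;> positivity
    have e1 : d ≤ 1 := (min_le_left _ _).trans (min_le_left _ _)
    have e2 : d ≤ h := (min_le_left _ _).trans (min_le_right _ _)
    have e3 : d ≤ η / K := (min_le_right _ _).trans ((min_le_left _ _).trans (min_le_left _ _))
    have e4 : d ≤ 1 / K := (min_le_right _ _).trans ((min_le_left _ _).trans (min_le_right _ _))
    have e5 : d ≤ ω / K := (min_le_right _ _).trans (min_le_right _ _)
    rw [le_div_iff₀ hK] at e3 e4 e5
    refine ⟨d / 4, by positivity, by linarith, by linarith, by linarith, by linarith, by linarith⟩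
  have hε0 : ε ≠ 0 := hε.ne'
  have hKε : 0 < K * ε := by positivity
  -- the average in space, with its partial derivatives
  set B : ℝ × ℝ → ℝ := fun q => ∫ y in (0 : ℝ)..1, A ((1 - ε) * q.1 + ε * y) q.2 with hB
  set B₁ : ℝ × ℝ → ℝ := fun q =>
    (1 - ε) * ((A ((1 - ε) * q.1 + ε) q.2 - A ((1 - ε) * q.1) q.2) / ε) with hB₁
  set B₂ : ℝ × ℝ → ℝ := fun q => ∫ y in (0 : ℝ)..1, A' ((1 - ε) * q.1 + ε * y) q.2 with hB₂
  have hAs : ∀ (α β : ℝ) (t : ℝ), Continuous fun y => A (α + β * y) t := fun α β t =>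
    hAc.comp (f := fun y : ℝ => (α + β * y, t)) (by fun_prop)
  have hA's : ∀ (α β : ℝ) (t : ℝ), Continuous fun y => A' (α + β * y) t := fun α β t =>
    hA'c.comp (f := fun y : ℝ => (α + β * y, t)) (by fun_prop)
  have hB₁der : ∀ s t, HasDerivAt (fun r => B (r, t)) (B₁ (s, t)) s := by
    intro s t
    have hAt : Continuous fun y => A y t := hAc.comp (f := fun y : ℝ => (y, t)) (by fun_prop)
    refine ((hasDerivAt_average hAt hε0 _).comp s
      ((hasDerivAt_id s).const_mul (1 - ε))).congr_deriv ?_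
    simp only [hB₁, id_eq]
    ring
  have hB₂der : ∀ s t, HasDerivAt (fun r => B (s, r)) (B₂ (s, t)) t := by
    intro s t
    refine (intervalIntegral.hasDerivAt_integral_of_dominated_loc_of_deriv_le
      (F := fun r y => A ((1 - ε) * s + ε * y) r) (F' := fun r y => A' ((1 - ε) * s + ε * y) r)
      (s := univ) (bound := fun _ => K) univ_mem ?_ ?_ ?_ ?_ ?_ ?_).2
    · exact Eventually.of_forall fun r => (hAs _ _ r).aestronglyMeasurable
    · exact (hAs _ _ t).intervalIntegrable _ _
    · exact (hA's _ _ t).aestronglyMeasurable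
    · exact Eventually.of_forall fun y _ r _ => by rw [Real.norm_eq_abs]; exact hA'b _ _
    · exact intervalIntegrable_const
    · exact Eventually.of_forall fun y _ r _ => hder _ _
  have hB₁c : Continuous B₁ := by
    have e1 : Continuous fun q : ℝ × ℝ => A ((1 - ε) * q.1 + ε) q.2 :=
      hAc.comp (f := fun q : ℝ × ℝ => ((1 - ε) * q.1 + ε, q.2)) (by fun_prop)
    have e2 : Continuous fun q : ℝ × ℝ => A ((1 - ε) * q.1) q.2 :=
      hAc.comp (f := fun q : ℝ × ℝ => ((1 - ε) * q.1, q.2)) (by fun_prop)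
    exact continuous_const.mul ((e1.sub e2).div_const _)
  have hB₂c : Continuous B₂ := by
    refine intervalIntegral.continuous_parametric_intervalIntegral_of_continuous' ?_ 0 1
    exact hA'c.comp (f := fun z : (ℝ × ℝ) × ℝ => ((1 - ε) * z.1.1 + ε * z.2, z.1.2)) (by fun_prop)
  have hBC : ContDiff ℝ 1 B := contDiff_one_of_partials hB₁der hB₂der hB₁c hB₂c
  -- closeness of the averages
  have hdist : ∀ s ∈ Icc (0 : ℝ) 1, ∀ y ∈ Icc (0 : ℝ) 1, |(1 - ε) * s + ε * y - s| ≤ ε := by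
    intro s hs y hy
    have : (1 - ε) * s + ε * y - s = ε * (y - s) := by ring
    rw [this, abs_mul, abs_of_pos hε]
    have h1 : |y - s| ≤ 1 := abs_le.2 ⟨by linarith [hs.2, hy.1], by linarith [hs.1, hy.2]⟩
    exact mul_le_of_le_one_right hε.le h1
  have havg : ∀ F : ℝ → ℝ → ℝ, (∀ (α β : ℝ) (t : ℝ), Continuous fun y => F (α + β * y) t) →
      (∀ s s' t, |F s t - F s' t| ≤ K * |s - s'|) → ∀ s ∈ Icc (0 : ℝ) 1, ∀ t,
      |(∫ y in (0 : ℝ)..1, F ((1 - ε) * s + ε * y) t) - F s t| ≤ K * ε := by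
    intro F hFc hFK s hs t
    have e1 : (∫ y in (0 : ℝ)..1, F ((1 - ε) * s + ε * y) t) - F s t =
        ∫ y in (0 : ℝ)..1, (F ((1 - ε) * s + ε * y) t - F s t) := by
      rw [intervalIntegral.integral_sub ((hFc _ _ t).intervalIntegrable _ _)
        intervalIntegrable_const]
      simp
    rw [e1, ← Real.norm_eq_abs]
    have := intervalIntegral.norm_integral_le_of_norm_le_const (a := (0 : ℝ)) (b := 1)
      (f := fun y => F ((1 - ε) * s + ε * y) t - F s t) (C := K * ε) (fun y hy => by
        rw [uIoc_of_le zero_le_one] at hy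
        rw [Real.norm_eq_abs]
        exact (hFK _ _ t).trans (mul_le_mul_of_nonneg_left (hdist s hs y ⟨hy.1.le, hy.2⟩) hK.le))
    simpa using this
  have hBA : ∀ s ∈ Icc (0 : ℝ) 1, ∀ t, |B (s, t) - A s t| ≤ K * ε := havg A hAs hAK
  have hB₂A : ∀ s ∈ Icc (0 : ℝ) 1, ∀ t, |B₂ (s, t) - A' s t| ≤ K * ε := havg A' hA's hA'K
  -- the average is almost a subsolution
  set P : ℝ → ℝ → ℝ := fun s t => (A ((1 - ε) * s + ε) t - A ((1 - ε) * s) t) / ε with hP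
  have hPK : ∀ s t, |P s t| ≤ K := by
    intro s t
    rw [hP, abs_div, abs_of_pos hε, div_le_iff₀ hε]
    have := hAK ((1 - ε) * s + ε) ((1 - ε) * s) t
    rwa [add_sub_cancel_left, abs_of_pos hε] at this
  have hBsub : ∀ s ∈ Ioo (0 : ℝ) 1, ∀ t ∈ Ioo T₀ T, B₂ (s, t) + H s (P s t) ≤ η / 4 := by
    intro s hs t ht
    obtain ⟨v, hv⟩ := hspeed s (Ioo_subset_Icc_self hs) (P s t) (hPK s t)
    set a := max 0 (s - h) with ha
    set b := min 1 (s + h) with hb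
    set m := P s t * v - H s (P s t) + η / 4 with hm
    have hmab : ∀ σ ∈ Icc a b, ∀ p, p * v - H σ p ≤ m := by
      intro σ hσ
      have h1 := (le_max_left _ _).trans hσ.1
      have h2 := (le_max_right _ _).trans hσ.1
      have h3 := hσ.2.trans (min_le_left _ _)
      have h4 := hσ.2.trans (min_le_right _ _)
      exact hv σ ⟨h1, h3⟩ (abs_le.2 ⟨by linarith, by linarith⟩)
    have hε1' : 0 < 1 - ε := by linarith
    have hs1 := mul_pos hε1' hs.1
    have hs2 := mul_pos hε1' (sub_pos.2 hs.2)
    have hs3 := mul_pos hε hs.1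
    have hs4 := mul_pos hε (sub_pos.2 hs.2)
    have hlo : a < (1 - ε) * s := max_lt hs1 (by linarith)
    have hhi : (1 - ε) * s + ε < b := lt_min (by linarith) (by linarith)
    have hder0 : HasDerivAt (fun r : ℝ => B (s + r * (v / (1 - ε)), t + r))
        (B₂ (s, t) + v * P s t) 0 := by
      have e1 : HasDerivAt (fun r : ℝ => (s + r * (v / (1 - ε)), t + r)) (v / (1 - ε), 1) 0 := by
        have e2 : HasDerivAt (fun r : ℝ => s + r * (v / (1 - ε))) (1 * (v / (1 - ε))) 0 :=
          ((hasDerivAt_id (0 : ℝ)).mul_const _).const_add s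
        have e3 : HasDerivAt (fun r : ℝ => t + r) 1 0 := (hasDerivAt_id (0 : ℝ)).const_add t
        simpa using e2.prodMk e3
      have e4 : HasFDerivAt B (fderiv ℝ B (s, t)) (s + 0 * (v / (1 - ε)), t + 0) := by
        simpa using (hBC.differentiable one_ne_zero (s, t)).hasFDerivAt
      refine (e4.comp_hasDerivAt 0 e1).congr_deriv ?_
      have e5 : ((v / (1 - ε), 1) : ℝ × ℝ) = (v / (1 - ε)) • (1, 0) + (1 : ℝ) • (0, 1) := by simp
      rw [e5, map_add, map_smul, map_smul, smul_eq_mul, smul_eq_mul,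
        (deriv_slice_fst hBC s t).unique (hB₁der s t),
        (deriv_slice_snd hBC s t).unique (hB₂der s t)]
      simp only [hB₁, hP]
      field_simp
      ring
    have hev : ∀ᶠ r in 𝓝[>] (0 : ℝ), slope (fun r : ℝ => B (s + r * (v / (1 - ε)), t + r)) 0 r
        ≤ m := by
      have c1 : ∀ᶠ r in 𝓝 (0 : ℝ), a < (1 - ε) * s + r * v := by
        have hc : Continuous fun r : ℝ => (1 - ε) * s + r * v := by fun_prop
        have := hc.tendsto 0
        rw [zero_mul, add_zero] at this
        exact this.eventually (lt_mem_nhds hlo)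
      have c2 : ∀ᶠ r in 𝓝 (0 : ℝ), (1 - ε) * s + ε + r * v < b := by
        have hc : Continuous fun r : ℝ => (1 - ε) * s + ε + r * v := by fun_prop
        have := hc.tendsto 0
        rw [zero_mul, add_zero] at this
        exact this.eventually (gt_mem_nhds hhi)
      have c3 : ∀ᶠ r in 𝓝 (0 : ℝ), t + r < T := by
        have hc : Continuous fun r : ℝ => t + r := by fun_prop
        have := hc.tendsto 0
        rw [add_zero] at this
        exact this.eventually (gt_mem_nhds ht.2)
      filter_upwards [c1.filter_mono nhdsWithin_le_nhds, c2.filter_mono nhdsWithin_le_nhds,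
        c3.filter_mono nhdsWithin_le_nhds, self_mem_nhdsWithin] with r c1 c2 c3 hr
      have hr0 : (0 : ℝ) < r := hr
      rw [slope_def_field, div_le_iff₀ (by linarith)]
      simp only [zero_mul, add_zero, sub_zero, hB]
      have e1 : ∀ y, (1 - ε) * (s + r * (v / (1 - ε))) + ε * y =
          ((1 - ε) * s + r * v) + ε * y := by
        intro y; field_simp
      simp only [e1]
      rw [sub_le_iff_le_add]
      have e2 : m * r + ∫ y in (0 : ℝ)..1, A ((1 - ε) * s + ε * y) t =
          ∫ y in (0 : ℝ)..1, (A ((1 - ε) * s + ε * y) t + r * m) := by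
        rw [intervalIntegral.integral_add ((hAs _ _ t).intervalIntegrable _ _)
          intervalIntegrable_const]
        simp; ring
      rw [e2]
      refine intervalIntegral.integral_mono_on zero_le_one ((hAs _ _ _).intervalIntegrable _ _)
        (((hAs _ _ _).add continuous_const).intervalIntegrable _ _) fun y hy => ?_
      have e3 : (1 - ε) * s + r * v + ε * y = (1 - ε) * s + ε * y + r * v := by ring
      have hεy0 : 0 ≤ ε * y := mul_nonneg hε.le hy.1
      have hεy1 : ε * y ≤ ε := mul_le_of_le_one_right hε.le hy.2
      rw [e3]
      refine hA a b (le_max_left _ _) (by linarith) (min_le_left _ _) v m hmab _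
        ⟨by linarith, by linarith⟩ t ht.1.le r hr0.le ⟨by linarith, by linarith⟩ ?_
      exact_mod_cast c3
    have hlim : Tendsto (slope (fun r : ℝ => B (s + r * (v / (1 - ε)), t + r)) 0) (𝓝[>] 0)
        (𝓝 (B₂ (s, t) + v * P s t)) :=
      (hasDerivAt_iff_tendsto_slope.1 hder0).mono_left (nhdsWithin_mono _ fun r hr => ne_of_gt hr)
    have := le_of_tendsto hlim hev
    rw [hm] at this
    linarith
  -- correction of the boundary values
  set U : ℝ × ℝ → ℝ := fun q => B q + q.1 * (A 1 q.2 - B (1, q.2)) +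
    (1 - q.1) * (A 0 q.2 - B (0, q.2)) with hU
  set U₁ : ℝ × ℝ → ℝ := fun q => B₁ q + (A 1 q.2 - B (1, q.2)) - (A 0 q.2 - B (0, q.2)) with hU₁
  set U₂ : ℝ × ℝ → ℝ := fun q => B₂ q + q.1 * (A' 1 q.2 - B₂ (1, q.2)) +
    (1 - q.1) * (A' 0 q.2 - B₂ (0, q.2)) with hU₂
  have hU₁der : ∀ s t, HasDerivAt (fun r => U (r, t)) (U₁ (s, t)) s := by
    intro s t
    have := ((hB₁der s t).add ((hasDerivAt_id s).mul_const (A 1 t - B (1, t)))).add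
      (((hasDerivAt_id s).const_sub 1).mul_const (A 0 t - B (0, t)))
    refine this.congr_deriv ?_
    simp only [hU₁]; ring
  have hU₂der : ∀ s t, HasDerivAt (fun r => U (s, r)) (U₂ (s, t)) t := by
    intro s t
    exact ((hB₂der s t).add (((hder 1 t).sub (hB₂der 1 t)).const_mul s)).add
      (((hder 0 t).sub (hB₂der 0 t)).const_mul (1 - s))
  have hslice : ∀ (F : ℝ × ℝ → ℝ), Continuous F → ∀ x : ℝ, Continuous fun q : ℝ × ℝ => F (x, q.2) :=
    fun F hF x => hF.comp (by fun_prop)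
  have hBc := hBC.continuous
  have hU₁c : Continuous U₁ :=
    (hB₁c.add ((hslice _ hAc 1).sub (hslice _ hBc 1))).sub ((hslice _ hAc 0).sub (hslice _ hBc 0))
  have hU₂c : Continuous U₂ :=
    (hB₂c.add (continuous_fst.mul ((hslice _ hA'c 1).sub (hslice _ hB₂c 1)))).add
      ((continuous_const.sub continuous_fst).mul ((hslice _ hA'c 0).sub (hslice _ hB₂c 0)))
  have hconv : ∀ s ∈ Icc (0 : ℝ) 1, ∀ x y, |x| ≤ K * ε → |y| ≤ K * ε →
      |s * x + (1 - s) * y| ≤ K * ε := by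
    intro s hs x y hx hy
    have h1 := abs_le.1 hx
    have h2 := abs_le.1 hy
    have h3 : 0 ≤ 1 - s := by linarith [hs.2]
    rw [abs_le]
    constructor
    · linarith [mul_le_mul_of_nonneg_left h1.1 hs.1, mul_le_mul_of_nonneg_left h2.1 h3]
    · linarith [mul_le_mul_of_nonneg_left h1.2 hs.1, mul_le_mul_of_nonneg_left h2.2 h3]
  have h0mem : (0 : ℝ) ∈ Icc (0 : ℝ) 1 := ⟨le_rfl, zero_le_one⟩
  have h1mem : (1 : ℝ) ∈ Icc (0 : ℝ) 1 := ⟨zero_le_one, le_rfl⟩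
  refine ⟨U, contDiff_one_of_partials hU₁der hU₂der hU₁c hU₂c, ?_, ?_, ?_, ?_⟩
  · intro t; simp only [hU]; ring
  · intro t; simp only [hU]; ring
  · intro s hs t
    have e1 : U (s, t) - A s t = (B (s, t) - A s t) +
        (s * (A 1 t - B (1, t)) + (1 - s) * (A 0 t - B (0, t))) := by simp only [hU]; ring
    rw [e1]
    have e2 := hconv s hs _ _ ((abs_sub_comm _ _).trans_le (hBA 1 h1mem t))
      ((abs_sub_comm _ _).trans_le (hBA 0 h0mem t))
    have e3 := hBA s hs t
    have := abs_add_le (B (s, t) - A s t)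
      (s * (A 1 t - B (1, t)) + (1 - s) * (A 0 t - B (0, t)))
    linarith
  · intro s hs t ht
    have hin : ∀ s ∈ Ioo (0 : ℝ) 1, U₂ (s, t) + H s (U₁ (s, t)) ≤ η := by
      intro s hs
      have hsI := Ioo_subset_Icc_self hs
      have a1 := hBsub s hs t ht
      have a2 := (abs_le.1 (hconv s hsI _ _ ((abs_sub_comm _ _).trans_le (hB₂A 1 h1mem t))
        ((abs_sub_comm _ _).trans_le (hB₂A 0 h0mem t)))).2
      have a3 : U₂ (s, t) ≤ B₂ (s, t) + K * ε := by simp only [hU₂]; linarith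
      have a4 : |U₁ (s, t) - P s t| ≤ 3 * (K * ε) := by
        have b1 : U₁ (s, t) - P s t = -(ε * P s t) + (A 1 t - B (1, t)) - (A 0 t - B (0, t)) := by
          simp only [hU₁, hB₁, hP]; ring
        have b2 := abs_le.1 (hBA 1 h1mem t)
        have b3 := abs_le.1 (hBA 0 h0mem t)
        have b4 := abs_le.1 (hPK s t)
        have b5 := mul_le_mul_of_nonneg_left b4.1 hε.le
        have b6 := mul_le_mul_of_nonneg_left b4.2 hε.le
        rw [b1, abs_le]
        constructor <;> linarith [b2.1, b2.2, b3.1, b3.2]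
      have a5 := abs_le.1 (hPK s t)
      have a6 := abs_le.1 a4
      have a7 := huc (s, U₁ (s, t)) ⟨hsI, by linarith [a5.1, a6.1], by linarith [a5.2, a6.2]⟩
        (s, P s t) ⟨hsI, by linarith [a5.1], by linarith [a5.2]⟩ (by
          rw [Prod.dist_eq, dist_self, max_eq_right dist_nonneg, Real.dist_eq]
          linarith)
      rw [Real.dist_eq] at a7
      have a8 := (abs_lt.1 a7).2
      simp only at a8
      linarith
    rw [(hU₂der s t).deriv, (hU₁der s t).deriv]
    have hc : ContinuousOn (fun s => U₂ (s, t) + H s (U₁ (s, t))) (closure (Ioo (0 : ℝ) 1)) := by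
      rw [closure_Ioo zero_ne_one]
      have e1 : Continuous fun s => U₂ (s, t) := hU₂c.comp (by fun_prop)
      have e2 : Continuous fun s => U₁ (s, t) := hU₁c.comp (by fun_prop)
      exact e1.continuousOn.add (hH.continuousOn.comp (f := fun s => (s, U₁ (s, t)))
        (continuous_id.prodMk e2).continuousOn fun s hs => ⟨hs, mem_univ _⟩)
    exact le_on_closure hin hc continuousOn_const (by rw [closure_Ioo zero_ne_one]; exact hs)

/-! ### The comparison principle -/

/-- Smoothing of a Lipschitz continuous subsolution in integrated form, by averages first in time
and then in space. At the end points of the arc the result depends only on the values there, so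
that it is compatible with the junctions of the network. -/
theorem IsArcSub.exists_contDiff_approx_of_lipschitz {H : ℝ → ℝ → ℝ} (hH : IsArcHamiltonian H)
    {T₀ T T₂ : ℝ} {w : ℝ → ℝ → ℝ} (hw : IsArcSub H T₀ T₂ w) {K : NNReal}
    (hK : LipschitzWith K fun q : ℝ × ℝ => w q.1 q.2) {τ : ℝ} (hτ : 0 < τ) (hT : T + τ ≤ T₂)
    {η : ℝ} (hη : 0 < η) :
    ∃ U : ℝ × ℝ → ℝ, ContDiff ℝ 1 U ∧ (∀ t, U (1, t) = ∫ y in (0 : ℝ)..1, w 1 (t + τ * y)) ∧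
      (∀ t, U (0, t) = ∫ y in (0 : ℝ)..1, w 0 (t + τ * y)) ∧
      (∀ s ∈ Icc (0 : ℝ) 1, ∀ t, |U (s, t) - w s t| ≤ η + K * τ) ∧
      ∀ s ∈ Icc (0 : ℝ) 1, ∀ t ∈ Ioo T₀ T,
        deriv (fun r => U (s, r)) t + H s (deriv (fun r => U (r, t)) s) ≤ η := by
  have hwc : Continuous fun q : ℝ × ℝ => w q.1 q.2 := hK.continuous
  have hwt : ∀ s, Continuous (w s) := fun s => hwc.comp (f := fun t => (s, t)) (by fun_prop)
  have hKs : ∀ s s' t, |w s t - w s' t| ≤ K * |s - s'| := by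
    intro s s' t
    have := hK.dist_le_mul (s, t) (s', t)
    rwa [Prod.dist_eq, dist_self, max_eq_left dist_nonneg, Real.dist_eq, Real.dist_eq] at this
  have hKt : ∀ s t t', |w s t - w s t'| ≤ K * |t - t'| := by
    intro s t t'
    have := hK.dist_le_mul (s, t) (s, t')
    rwa [Prod.dist_eq, dist_self, max_eq_right dist_nonneg, Real.dist_eq, Real.dist_eq] at this
  have hint : ∀ s t, IntervalIntegrable (fun y => w s (t + τ * y)) MeasureTheory.volume 0 1 :=
    fun s t => ((hwt s).comp (by fun_prop : Continuous fun y => t + τ * y)).intervalIntegrable _ _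
  have hK0 : (0 : ℝ) ≤ K := K.2
  set A : ℝ → ℝ → ℝ := fun s t => ∫ y in (0 : ℝ)..1, w s (t + τ * y) with hA
  set A' : ℝ → ℝ → ℝ := fun s t => (w s (t + τ) - w s t) / τ with hA'
  set L : ℝ := K + 1 + 2 * K / τ with hL
  have hL0 : 0 < L := by positivity
  have hKτ : 0 ≤ 2 * (K : ℝ) / τ := by positivity
  have hAsub : IsArcSub H T₀ T A := by
    intro a b ha hab hb v m hm s hs t ht l hl hs' htl
    have htl' : t + l < T := by exact_mod_cast htl
    have e2 : A s t + l * m = ∫ y in (0 : ℝ)..1, (w s (t + τ * y) + l * m) := by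
      rw [intervalIntegral.integral_add (hint s t) intervalIntegrable_const]
      simp [hA]
    rw [e2]
    refine intervalIntegral.integral_mono_on zero_le_one (hint _ _)
      ((hint s t).add intervalIntegrable_const) fun y hy => ?_
    have h1 : 0 ≤ τ * y := mul_nonneg hτ.le hy.1
    have h2 : τ * y ≤ τ := mul_le_of_le_one_right hτ.le hy.2
    have e3 : t + l + τ * y = t + τ * y + l := by ring
    rw [e3]
    refine hw a b ha hab hb v m hm s hs (t + τ * y) (by linarith) l hl hs' ?_
    have : t + τ * y + l < T₂ := by linarith
    exact_mod_cast this
  have hAc : Continuous fun q : ℝ × ℝ => A q.1 q.2 := by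
    refine intervalIntegral.continuous_parametric_intervalIntegral_of_continuous' ?_ 0 1
    exact hwc.comp (f := fun z : (ℝ × ℝ) × ℝ => (z.1.1, z.1.2 + τ * z.2)) (by fun_prop)
  have hA'c : Continuous fun q : ℝ × ℝ => A' q.1 q.2 := by
    have e1 : Continuous fun q : ℝ × ℝ => w q.1 (q.2 + τ) :=
      hwc.comp (f := fun q : ℝ × ℝ => (q.1, q.2 + τ)) (by fun_prop)
    exact (e1.sub hwc).div_const _
  have hint_le : ∀ {f : ℝ → ℝ} {C : ℝ}, (∀ y ∈ Icc (0 : ℝ) 1, |f y| ≤ C) →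
      |∫ y in (0 : ℝ)..1, f y| ≤ C := by
    intro f C hf
    have := intervalIntegral.norm_integral_le_of_norm_le_const (a := (0 : ℝ)) (b := 1)
      (f := f) (C := C) (fun y hy => by
        rw [uIoc_of_le zero_le_one] at hy
        exact hf y ⟨hy.1.le, hy.2⟩)
    simpa using this
  have hAK : ∀ s s' t, |A s t - A s' t| ≤ L * |s - s'| := by
    intro s s' t
    simp only [hA]
    rw [← intervalIntegral.integral_sub (hint s t) (hint s' t)]
    refine hint_le fun y _ => (hKs s s' _).trans ?_
    exact mul_le_mul_of_nonneg_right (by linarith) (abs_nonneg _)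
  have hA'K : ∀ s s' t, |A' s t - A' s' t| ≤ L * |s - s'| := by
    intro s s' t
    have e1 : A' s t - A' s' t = ((w s (t + τ) - w s' (t + τ)) - (w s t - w s' t)) / τ := by
      simp only [hA']; ring
    rw [e1, abs_div, abs_of_pos hτ]
    have e2 := abs_sub (w s (t + τ) - w s' (t + τ)) (w s t - w s' t)
    have e3 := hKs s s' (t + τ)
    have e4 := hKs s s' t
    calc _ ≤ (2 * K * |s - s'|) / τ := by gcongr; linarith
      _ = 2 * K / τ * |s - s'| := by ring
      _ ≤ L * |s - s'| := mul_le_mul_of_nonneg_right (by linarith) (abs_nonneg _)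
  have hA'b : ∀ s t, |A' s t| ≤ L := by
    intro s t
    simp only [hA']
    rw [abs_div, abs_of_pos hτ, div_le_iff₀ hτ]
    have e1 := hKt s (t + τ) t
    rw [add_sub_cancel_left, abs_of_pos hτ] at e1
    exact e1.trans (mul_le_mul_of_nonneg_right (by linarith) hτ.le)
  obtain ⟨U, hU, hU1, hU0, hUA, hUH⟩ := hAsub.exists_contDiff_approx hH hAc hA'c
    (fun s t => hasDerivAt_average (hwt s) hτ.ne' t) hL0 hAK hA'K hA'b hη
  refine ⟨U, hU, hU1, hU0, fun s hs t => ?_, hUH⟩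
  have e1 : |A s t - w s t| ≤ K * τ := by
    have e2 : A s t - w s t = ∫ y in (0 : ℝ)..1, (w s (t + τ * y) - w s t) := by
      rw [intervalIntegral.integral_sub (hint s t) intervalIntegrable_const]
      simp [hA]
    rw [e2]
    refine hint_le fun y hy => (hKt s _ _).trans ?_
    rw [add_sub_cancel_left, abs_of_nonneg (mul_nonneg hτ.le hy.1)]
    exact mul_le_mul_of_nonneg_left (mul_le_of_le_one_right hτ.le hy.2) hK0
  exact (abs_sub_le _ (A s t) _).trans (add_le_add (hUA s hs t) e1)

/-- An increasing barrier that is small at `t₁` and large at the later time `T`. -/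
theorem exists_contDiff_barrier {T₀ t₁ T δ κ : ℝ} (P : ℝ) (ht₁ : T₀ ≤ t₁) (hT : t₁ < T)
    (hδ : 0 < δ) (hκ : 0 < κ) (hδκ : δ * (T - T₀) ≤ κ) :
    ∃ f : ℝ → ℝ, ContDiff ℝ 1 f ∧ (∀ t, δ ≤ deriv f t) ∧ 0 ≤ f T₀ ∧ f t₁ ≤ 2 * κ ∧ P ≤ f T := by
  set Q := max P κ with hQ
  have hQ0 : 0 < Q := hκ.trans_le (le_max_right _ _)
  set M := Real.log (Q / κ) / (T - t₁) with hM
  have hM0 : 0 ≤ M := by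
    refine div_nonneg (Real.log_nonneg ?_) (by linarith)
    rw [le_div_iff₀ hκ, one_mul]
    exact le_max_right _ _
  have hder : ∀ t, HasDerivAt (fun t => δ * (t - T₀) + Q * Real.exp (M * (t - T)))
      (δ * 1 + Q * (Real.exp (M * (t - T)) * (M * 1))) t := fun t =>
    (((hasDerivAt_id t).sub_const T₀).const_mul δ).add
      ((((hasDerivAt_id t).sub_const T).const_mul M).exp.const_mul Q)
  refine ⟨fun t => δ * (t - T₀) + Q * Real.exp (M * (t - T)), ?_, fun t => ?_, ?_, ?_, ?_⟩
  · fun_prop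
  · rw [(hder t).deriv]
    have : 0 ≤ Q * (Real.exp (M * (t - T)) * (M * 1)) := by positivity
    linarith
  · simp only [sub_self, mul_zero, zero_add]
    positivity
  · have e1 : M * (t₁ - T) = -Real.log (Q / κ) := by
      have : T - t₁ ≠ 0 := by linarith
      rw [hM]; field_simp; ring
    have e2 : Q * Real.exp (M * (t₁ - T)) = κ := by
      rw [e1, Real.exp_neg, Real.exp_log (by positivity)]
      field_simp
    have e3 : δ * (t₁ - T₀) ≤ δ * (T - T₀) := by gcongr
    simp only
    linarith
  · simp only [sub_self, mul_zero, Real.exp_zero, mul_one]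
    have e1 : 0 ≤ δ * (T - T₀) := mul_nonneg hδ.le (by linarith)
    linarith [le_max_left P κ]

namespace EmbeddedNetwork

variable {E : Type*} {N : ℕ} {Γ : EmbeddedNetwork E N} {H : E → ℝ → ℝ → ℝ}
  {c : EuclideanSpace ℝ (Fin N) → ℝ} {T₀ : ℝ} {T₁ : EReal}

theorem continuousOn_pullback {v : EuclideanSpace ℝ (Fin N) × ℝ → ℝ}
    (hv : ContinuousOn v (Γ.carrier ×ˢ timeIco T₀ T₁)) (e : E) :
    ContinuousOn (Γ.pullback v e) (Icc 0 1 ×ˢ timeIco T₀ T₁) := by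
  refine hv.comp (f := fun q : ℝ × ℝ => (Γ.arc e q.1, q.2)) ?_ fun q hq =>
    ⟨arc_mem_carrier e hq.1, hq.2⟩
  exact ((continuousOn_arc e).comp continuousOn_fst fun q hq => hq.1).prodMk continuousOn_snd

/-- A supersolution is compared with a family of `C¹` functions on the arcs that is continuous at
the vertices, and a strict subsolution along the arcs and at the vertices: the family itself
provides the test functions at a maximum point of the difference. -/
theorem IsSupersolution.le_of_strict [Finite E] {v : EuclideanSpace ℝ (Fin N) × ℝ → ℝ}
    (hv : Γ.IsSupersolution H c T₀ T₁ v) {T : ℝ} (hT : (T : EReal) < T₁) {U : E → ℝ × ℝ → ℝ}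
    (hU : ∀ e, ContDiff ℝ 1 (U e)) {a : EuclideanSpace ℝ (Fin N) → ℝ → ℝ}
    (hU1 : ∀ e t, U e (1, t) = a (Γ.arc e 1) t) (hU0 : ∀ e t, U e (0, t) = a (Γ.arc e 0) t)
    (ha : ∀ x ∈ Γ.vertices, ∀ t ∈ Ioo T₀ T, deriv (a x) t < c x)
    (hUH : ∀ e, ∀ s ∈ Icc (0 : ℝ) 1, ∀ t ∈ Ioo T₀ T,
      deriv (fun r => U e (s, r)) t + H e s (deriv (fun r => U e (r, t)) s) < 0) {m : ℝ}
    (hm0 : ∀ e, ∀ s ∈ Icc (0 : ℝ) 1, U e (s, T₀) ≤ v (Γ.arc e s, T₀) + m)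
    (hmT : ∀ e, ∀ s ∈ Icc (0 : ℝ) 1, U e (s, T) ≤ v (Γ.arc e s, T) + m) (e : E) {s : ℝ}
    (hs : s ∈ Icc (0 : ℝ) 1) {t : ℝ} (ht : t ∈ Icc T₀ T) :
    U e (s, t) ≤ v (Γ.arc e s, t) + m := by
  by_contra! hcon
  have hsub : Icc T₀ T ⊆ timeIco T₀ T₁ := fun r hr => ⟨hr.1, EReal.coe_lt_of_le_of_lt hr.2 hT⟩
  have hmax : ∀ e, ∃ q ∈ Icc (0 : ℝ) 1 ×ˢ Icc T₀ T, ∀ q' ∈ Icc (0 : ℝ) 1 ×ˢ Icc T₀ T,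
      U e q' - Γ.pullback v e q' ≤ U e q - Γ.pullback v e q := by
    intro e
    obtain ⟨q, hq, hq'⟩ := (isCompact_Icc.prod isCompact_Icc).exists_isMaxOn ⟨(s, t), hs, ht⟩
      ((hU e).continuous.continuousOn.sub
        ((continuousOn_pullback hv.continuousOn e).mono (prod_mono_right hsub)))
    exact ⟨q, hq, isMaxOn_iff.1 hq'⟩
  choose q hq hqmax using hmax
  have : Nonempty E := ⟨e⟩
  obtain ⟨e₀, he₀⟩ := Finite.exists_max fun e => U e (q e) - Γ.pullback v e (q e)
  obtain ⟨⟨s₀, t₀⟩, hq₀⟩ : ∃ p, p = q e₀ := ⟨_, rfl⟩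
  obtain ⟨hs₀, ht₀⟩ : s₀ ∈ Icc (0 : ℝ) 1 ∧ t₀ ∈ Icc T₀ T := by
    have := hq e₀
    rwa [← hq₀] at this
  have hall : ∀ e, ∀ s ∈ Icc (0 : ℝ) 1, ∀ t ∈ Icc T₀ T,
      U e (s, t) - v (Γ.arc e s, t) ≤ U e₀ (s₀, t₀) - v (Γ.arc e₀ s₀, t₀) := by
    intro e s hs t ht
    have h1 := hqmax e (s, t) ⟨hs, ht⟩
    have h2 := h1.trans (he₀ e)
    rw [← hq₀] at h2
    exact h2
  have hbig : m < U e₀ (s₀, t₀) - v (Γ.arc e₀ s₀, t₀) := by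
    have := hall e s hs t ht
    linarith
  have ht₀' : t₀ ∈ Ioo T₀ T := by
    refine ⟨lt_of_le_of_ne ht₀.1 ?_, lt_of_le_of_ne ht₀.2 ?_⟩
    · rintro rfl
      linarith [hm0 e₀ s₀ hs₀]
    · rintro rfl
      linarith [hmT e₀ s₀ hs₀]
  have htI : t₀ ∈ timeIoo T₀ T₁ := ⟨ht₀'.1, EReal.coe_lt_of_le_of_lt ht₀'.2.le hT⟩
  have hvertex : ∀ e₁, (∀ e, ∀ s ∈ Icc (0 : ℝ) 1, ∀ t ∈ Icc T₀ T,
      U e (s, t) - v (Γ.arc e s, t) ≤ U e₁ (1, t₀) - v (Γ.arc e₁ 1, t₀)) → False := by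
    intro e₁ h1
    have h1I : (1 : ℝ) ∈ Icc (0 : ℝ) 1 := ⟨zero_le_one, le_rfl⟩
    have hx : Γ.arc e₁ 1 ∈ Γ.vertices := ⟨e₁, rfl⟩
    obtain ⟨e₂, he₂, htest⟩ := hv.vertices _ hx t₀ htI ⟨a (Γ.arc e₁ 1), by
        have : a (Γ.arc e₁ 1) = fun t => U e₁ (1, t) := by funext t; rw [hU1]
        rw [this]
        exact (hU e₁).comp (contDiff_const.prodMk contDiff_id), by
        filter_upwards [Ioo_mem_nhds ht₀'.1 ht₀'.2] with r hr
        have := h1 e₁ 1 h1I r ⟨hr.1.le, hr.2.le⟩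
        rw [hU1, hU1] at this
        linarith, ha _ hx t₀ ht₀'⟩
    have h2 := htest (U e₂) (hU e₂) (by
      have h3 : ∀ᶠ q : ℝ × ℝ in 𝓝 (1, t₀), q.2 ∈ Ioo T₀ T :=
        continuous_snd.continuousAt.eventually (Ioo_mem_nhds ht₀'.1 ht₀'.2)
      filter_upwards [self_mem_nhdsWithin, h3.filter_mono nhdsWithin_le_nhds] with q hq1 hq2
      have h4 := h1 e₂ q.1 hq1.1 q.2 ⟨hq2.1.le, hq2.2.le⟩
      simp only [pullback]
      rw [hU1 e₂, he₂, ← hU1 e₁]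
      linarith)
    exact absurd (hUH e₂ 1 h1I t₀ ht₀') (not_lt.2 h2)
  rcases eq_or_lt_of_le hs₀.1 with h0 | h0
  · refine hvertex (Γ.inv e₀) fun e s hs t ht => ?_
    rw [hU1, arc_inv_one, ← hU0]
    have := hall e s hs t ht
    rwa [← h0] at this
  rcases eq_or_lt_of_le hs₀.2 with h1 | h1
  · refine hvertex e₀ fun e s hs t ht => ?_
    have := hall e s hs t ht
    rwa [h1] at this
  refine absurd (hUH e₀ s₀ hs₀ t₀ ht₀') (not_lt.2 (hv.arcs e₀ s₀ ⟨h0, h1⟩ t₀ htI (U e₀) (hU e₀) ?_))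
  filter_upwards [prod_mem_nhds (Ioo_mem_nhds h0 h1) (Ioo_mem_nhds ht₀'.1 ht₀'.2)] with q hq
  have := hall e₀ q.1 ⟨hq.1.1.le, hq.1.2.le⟩ q.2 ⟨hq.2.1.le, hq.2.2.le⟩
  simp only [pullback]
  linarith

/-- The comparison principle, for Lipschitz continuous subsolutions. -/
theorem IsIntegratedSub.le_of_isSupersolution [Finite E] (hH : Γ.IsHamiltonian H)
    {u : EuclideanSpace ℝ (Fin N) → ℝ → ℝ} (hu : Γ.IsIntegratedSub H c T₀ T₁ u)
    (huL : Γ.LipschitzSpaceTime T₀ T₁ fun q => u q.1 q.2)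
    {v : EuclideanSpace ℝ (Fin N) × ℝ → ℝ} (hv : Γ.IsSupersolution H c T₀ T₁ v)
    (h0 : ∀ x ∈ Γ.carrier, u x T₀ ≤ v (x, T₀)) {x : EuclideanSpace ℝ (Fin N)}
    (hx : x ∈ Γ.carrier) {t : ℝ} (ht : t ∈ timeIco T₀ T₁) : u x t ≤ v (x, t) := by
  obtain ⟨K, hK⟩ := huL
  obtain ⟨T, htT, hTT₁⟩ := EReal.exists_gt_coe_lt ht.2
  obtain ⟨T₂, hT₂, hT₂T₁⟩ := EReal.exists_gt_coe_lt hTT₁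
  have hT₀T : T₀ ≤ T := ht.1.trans htT.le
  have hT₀T₂ : T₀ ≤ T₂ := hT₀T.trans hT₂.le
  refine le_of_forall_pos_le_add fun κ' hκ' => ?_
  obtain ⟨κ, hκ, hκκ⟩ : ∃ κ : ℝ, 0 < κ ∧ 4 * κ = κ' := ⟨κ' / 4, by positivity, by ring⟩
  obtain ⟨τ, hτ, hτT, hKτ⟩ : ∃ τ > 0, T + τ ≤ T₂ ∧ K * τ ≤ κ / 2 := by
    refine ⟨min (T₂ - T) (κ / 2 / (K + 1)), lt_min (by linarith) (by positivity), ?_, ?_⟩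
    · linarith [min_le_left (T₂ - T) (κ / 2 / (K + 1))]
    · have h1 : min (T₂ - T) (κ / 2 / (K + 1)) ≤ κ / 2 / (K + 1) := min_le_right _ _
      have h2 : (0 : ℝ) < K + 1 := by positivity
      have h3 : 0 < min (T₂ - T) (κ / 2 / (K + 1)) := lt_min (by linarith) (by positivity)
      rw [le_div_iff₀ h2] at h1
      linarith
  obtain ⟨δ, hδ, hδκ⟩ : ∃ δ : ℝ, 0 < δ ∧ δ * (T - T₀) ≤ κ := by
    have h1 : 0 < T - T₀ := by linarith [ht.1]
    exact ⟨κ / (T - T₀), by positivity, by rw [div_mul_cancel₀ _ h1.ne']⟩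
  set η := min (δ / 2) (κ / 2) with hη
  have hη0 : 0 < η := lt_min (by positivity) (by positivity)
  have hηδ : η ≤ δ / 2 := min_le_left _ _
  have hηκ : η ≤ κ / 2 := min_le_right _ _
  -- extension to all real parameters and times
  set w : E → ℝ → ℝ → ℝ := fun e s t =>
    u (Γ.arc e (projIcc 0 1 zero_le_one s)) (projIcc T₀ T₂ hT₀T₂ t) with hw
  have htime : ∀ r ∈ Icc T₀ T₂, r ∈ timeIco T₀ T₁ := fun r hr =>
    ⟨hr.1, EReal.coe_lt_of_le_of_lt hr.2 hT₂T₁⟩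
  have hwu : ∀ e, ∀ s ∈ Icc (0 : ℝ) 1, ∀ t ∈ Icc T₀ T₂, w e s t = u (Γ.arc e s) t := by
    intro e s hs t ht
    simp only [hw]
    rw [projIcc_of_mem _ hs, projIcc_of_mem _ ht]
  have hwL : ∀ e, LipschitzWith K fun q : ℝ × ℝ => w e q.1 q.2 := by
    intro e
    refine LipschitzWith.of_dist_le_mul fun q q' => ?_
    have h1 := (hK e).dist_le_mul
      ((projIcc 0 1 zero_le_one q.1 : ℝ), (projIcc T₀ T₂ hT₀T₂ q.2 : ℝ))
      ⟨(projIcc 0 1 zero_le_one q.1).2, htime _ (projIcc T₀ T₂ hT₀T₂ q.2).2⟩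
      ((projIcc 0 1 zero_le_one q'.1 : ℝ), (projIcc T₀ T₂ hT₀T₂ q'.2 : ℝ))
      ⟨(projIcc 0 1 zero_le_one q'.1).2, htime _ (projIcc T₀ T₂ hT₀T₂ q'.2).2⟩
    refine h1.trans (mul_le_mul_of_nonneg_left ?_ K.2)
    rw [Prod.dist_eq, Prod.dist_eq]
    have h2 := (LipschitzWith.projIcc (zero_le_one (α := ℝ))).dist_le_mul q.1 q'.1
    have h3 := (LipschitzWith.projIcc hT₀T₂).dist_le_mul q.2 q'.2
    rw [NNReal.coe_one, one_mul, Subtype.dist_eq] at h2 h3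
    exact max_le_max h2 h3
  have hwsub : ∀ e, IsArcSub (H e) T₀ T₂ (w e) := by
    intro e a b ha hab hb v m hm s hs t ht l hl hs' htl
    have htl' : t + l < T₂ := by exact_mod_cast htl
    have h1 := hu.arcs e a b ha hab hb v m hm s hs t ht l hl hs'
      (EReal.coe_lt_of_le_of_lt htl'.le hT₂T₁)
    rw [hwu e _ ⟨ha.trans hs'.1, hs'.2.trans hb⟩ _ ⟨by linarith, htl'.le⟩,
      hwu e _ ⟨ha.trans hs.1, hs.2.trans hb⟩ _ ⟨ht, by linarith⟩]
    exact h1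
  choose U hU hU1 hU0 hUw hUH using fun e =>
    (hwsub e).exists_contDiff_approx_of_lipschitz (hH.arc e) (hwL e) hτ hτT hη0
  have hUu : ∀ e, ∀ s ∈ Icc (0 : ℝ) 1, ∀ t ∈ Icc T₀ T, |U e (s, t) - u (Γ.arc e s) t| ≤ κ := by
    intro e s hs t ht
    have := hUw e s hs t
    rw [hwu e s hs t ⟨ht.1, ht.2.trans hT₂.le⟩] at this
    linarith
  obtain ⟨P, hP⟩ : ∃ P, ∀ e, ∀ s ∈ Icc (0 : ℝ) 1, U e (s, T) - v (Γ.arc e s, T) ≤ P := by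
    have h1 : ∀ e, ∃ P, ∀ s ∈ Icc (0 : ℝ) 1, U e (s, T) - v (Γ.arc e s, T) ≤ P := by
      intro e
      have hc : ContinuousOn (fun s => U e (s, T) - Γ.pullback v e (s, T)) (Icc 0 1) := by
        refine ContinuousOn.sub ?_ ?_
        · exact ((hU e).continuous.comp (by fun_prop : Continuous fun s : ℝ => (s, T))).continuousOn
        · exact (continuousOn_pullback hv.continuousOn e).comp (f := fun s : ℝ => (s, T))
            (by fun_prop) fun s hs => ⟨hs, hT₀T, hTT₁⟩
      obtain ⟨P, hP⟩ := isCompact_Icc.exists_bound_of_continuousOn hc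
      exact ⟨P, fun s hs => (le_abs_self _).trans (hP s hs)⟩
    choose P hP using h1
    obtain ⟨B, hB⟩ := (finite_range P).bddAbove
    exact ⟨B, fun e s hs => (hP e s hs).trans (hB (mem_range_self e))⟩
  obtain ⟨f, hf, hfδ, hf0, hft, hfT⟩ := exists_contDiff_barrier P ht.1 htT hδ hκ hδκ
  have hfd : ∀ t, HasDerivAt f (deriv f t) t := fun t =>
    (hf.differentiable one_ne_zero t).hasDerivAt
  set b : EuclideanSpace ℝ (Fin N) → ℝ → ℝ := fun x t =>
    ∫ y in (0 : ℝ)..1, u x (projIcc T₀ T₂ hT₀T₂ (t + τ * y)) with hb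
  have hb1 : ∀ e t, U e (1, t) = b (Γ.arc e 1) t := by
    intro e t
    rw [hU1]
    simp [hw, hb]
  have hb0 : ∀ e t, U e (0, t) = b (Γ.arc e 0) t := by
    intro e t
    rw [hU0]
    simp [hw, hb]
  obtain ⟨e, s, hs, rfl⟩ := mem_carrier_iff.1 hx
  have key := hv.le_of_strict hTT₁ (U := fun e q => U e q - f q.2) (a := fun x t => b x t - f t)
    (m := κ) (fun e => (hU e).sub (hf.comp contDiff_snd)) (fun e t => by rw [hb1])
    (fun e t => by rw [hb0]) ?_ ?_ ?_ ?_ e hs ⟨ht.1, htT.le⟩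
  · have h1 := (abs_le.1 (hUu e s hs t ⟨ht.1, htT.le⟩)).1
    simp only at key
    linarith
  · rintro _ ⟨e, rfl⟩ t ht
    have hfc : Continuous (w e 1) :=
      (hwL e).continuous.comp (f := fun t : ℝ => ((1 : ℝ), t)) (by fun_prop)
    have h1 := (hasDerivAt_average hfc hτ.ne' t).sub (hfd t)
    have h2 : (fun r => b (Γ.arc e 1) r - f r) =
        (fun t => ∫ y in (0 : ℝ)..1, w e 1 (t + τ * y)) - f := by
      funext r
      rw [← hb1, hU1]; rfl
    simp only
    rw [h2, h1.deriv]
    have h1I : (1 : ℝ) ∈ Icc (0 : ℝ) 1 := ⟨zero_le_one, le_rfl⟩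
    have h3 := hu.vertices (Γ.arc e 1) ⟨e, rfl⟩ t ht.1.le τ hτ.le
      (EReal.coe_lt_of_le_of_lt (by linarith [ht.2]) hT₂T₁)
    rw [hwu e 1 h1I _ ⟨by linarith [ht.1], by linarith [ht.2]⟩,
      hwu e 1 h1I _ ⟨ht.1.le, by linarith [ht.2]⟩]
    have h4 : (u (Γ.arc e 1) (t + τ) - u (Γ.arc e 1) t) / τ ≤ c (Γ.arc e 1) := by
      rw [div_le_iff₀ hτ]; linarith
    linarith [hfδ t]
  · intro e s hs t ht
    have h1 : HasDerivAt (fun r => U e (s, r) - f r)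
        (deriv (fun r => U e (s, r)) t - deriv f t) t := by
      have := (deriv_slice_snd (hU e) s t)
      exact this.differentiableAt.hasDerivAt.sub (hfd t)
    have h2 : deriv (fun r => U e (r, t) - f t) s = deriv (fun r => U e (r, t)) s :=
      deriv_sub_const _
    simp only
    rw [h1.deriv, h2]
    linarith [hUH e s hs t ht, hfδ t]
  · intro e s hs
    have h1 := (abs_le.1 (hUu e s hs T₀ ⟨le_rfl, hT₀T⟩)).2
    have h2 := h0 _ (arc_mem_carrier e hs)
    simp only
    linarith
  · intro e s hs
    have := hP e s hs
    simp only
    linarith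

end EmbeddedNetwork

/-! ### Existence and uniqueness -/

namespace EmbeddedNetwork

variable {E : Type*} {N : ℕ} {Γ : EmbeddedNetwork E N} {H : E → ℝ → ℝ → ℝ}
  {c : EuclideanSpace ℝ (Fin N) → ℝ} {T₀ : ℝ} {T₁ : EReal}

/-- Continuous subsolutions in the sense of viscosity are integrated subsolutions. At a vertex,
`increment_le_of_supertangent` is used for a function that is constant in space. -/
theorem IsSubsolution.isIntegratedSub (hH : Γ.IsHamiltonian H)
    {v : EuclideanSpace ℝ (Fin N) × ℝ → ℝ} (hv : Γ.IsSubsolution H c T₀ T₁ v) :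
    Γ.IsIntegratedSub H c T₀ T₁ fun x t => v (x, t) := by
  refine ⟨fun e => (hv.arcs e).isArcSub (w := fun s t => v (Γ.arc e s, t)) (hH.arc e)
    (continuousOn_pullback hv.continuousOn e), fun x hx t ht l hl htl => ?_⟩
  obtain ⟨T, hT, hTT⟩ := EReal.exists_gt_coe_lt htl
  have hc : ContinuousOn (fun r => v (x, r)) (timeIco T₀ T₁) :=
    hv.continuousOn.comp (f := fun r => (x, r)) (by fun_prop)
      fun r hr => ⟨vertices_subset_carrier hx, hr⟩
  have key : ∀ r, T₀ < r → r + l < T → v (x, r + l) ≤ v (x, r) + l * c x := by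
    intro r hr hrT
    have h1 := increment_le_of_supertangent (w := fun _ t => v (x, t)) (a := 0) (b := 1)
      (t₀ := T₀) (t₁ := T) (v := 0) (m := c x) (l := l) (s := 1 / 2) (t := r) ?_ ?_ hl
      (by norm_num) (by norm_num) ⟨hr, by linarith⟩ ⟨by linarith, hrT⟩
    · exact h1
    · refine hc.comp continuousOn_snd fun q hq => ⟨hq.2.1.le, ?_⟩
      exact EReal.coe_lt_of_le_of_lt hq.2.2.le hTT
    · intro s _ t ht φ hφ hmax
      rw [zero_mul, add_zero]
      refine hv.vertices x hx t ⟨ht.1, EReal.coe_lt_of_le_of_lt ht.2.le hTT⟩ (fun r => φ (s, r))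
        (hφ.comp (contDiff_const.prodMk contDiff_id)) ?_
      have h2 : Tendsto (fun r : ℝ => (s, r)) (𝓝 t) (𝓝 (s, t)) :=
        Continuous.tendsto (by fun_prop) t
      exact h2.eventually hmax
  have hlim : ∀ t', T₀ ≤ t' → t' ≤ t + l →
      Tendsto (fun r => v (x, r)) (𝓝[>] t') (𝓝 (v (x, t'))) := by
    intro t' h1 h2
    have h3 := hc t' ⟨h1, EReal.coe_lt_of_le_of_lt h2 htl⟩
    refine h3.mono_left (nhdsWithin_le_iff.2 ?_)
    filter_upwards [Ioo_mem_nhdsGT (show t' < T by linarith)] with r hr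
    exact ⟨h1.trans hr.1.le, EReal.coe_lt_of_le_of_lt hr.2.le hTT⟩
  have hshift : Tendsto (fun r : ℝ => r + l) (𝓝[>] t) (𝓝[>] (t + l)) := by
    refine tendsto_nhdsWithin_iff.2 ⟨?_, ?_⟩
    · exact (Continuous.tendsto (by fun_prop : Continuous fun r : ℝ => r + l) t).mono_left
        nhdsWithin_le_nhds
    · filter_upwards [self_mem_nhdsWithin] with r hr
      exact add_lt_add_left (show t < r from hr) l
  refine le_of_tendsto_of_tendsto ((hlim (t + l) (by linarith) le_rfl).comp hshift)
    ((hlim t ht (by linarith)).add_const (l * c x)) ?_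
  filter_upwards [Ioo_mem_nhdsGT (show t < T - l by linarith)] with r hr
  exact key r (ht.trans_lt hr.1) (by linarith [hr.2])

theorem maximalSub_isSolution [Finite E] (hH : Γ.IsHamiltonian H) (hT₁ : (T₀ : EReal) < T₁)
    {g : EuclideanSpace ℝ (Fin N) → ℝ} (hg : ContinuousOn g Γ.carrier) :
    Γ.IsSolution H c T₀ T₁ g fun q => Γ.maximalSub H c T₀ T₁ g q.1 q.2 := by
  have hsub := maximalSub_isIntegratedSub (T₀ := T₀) (T₁ := T₁) (c := c) hH
    (subsBelow_nonempty hH hg)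
  have hcont := (uniformContinuousOn_maximalSub (c := c) hH hg hT₁).continuousOn
  refine ⟨⟨hcont, fun e => (hsub.arcs e).isViscositySubsolution (hH.arc e), ?_⟩,
    ⟨hcont, fun e => maximalSub_isViscositySupersolution hH hg e, ?_⟩,
    fun x hx => maximalSub_init hH hg hT₁ hx⟩
  · intro x hx t₀ ht₀ ψ hψ hmax
    have hder := (hψ.differentiable one_ne_zero t₀).hasDerivAt
    have hlim : Tendsto (slope ψ t₀) (𝓝[<] t₀) (𝓝 (deriv ψ t₀)) :=
      (hasDerivAt_iff_tendsto_slope.1 hder).mono_left (nhdsWithin_mono _ fun r hr => ne_of_lt hr)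
    refine le_of_tendsto hlim ?_
    filter_upwards [hmax.filter_mono nhdsWithin_le_nhds, Ioo_mem_nhdsLT ht₀.1] with r h1 h2
    have h3 := hsub.vertices x hx r h2.1.le (t₀ - r) (by linarith [h2.2])
      (by rw [add_sub_cancel]; exact ht₀.2)
    rw [add_sub_cancel] at h3
    rw [slope_comm, slope_def_field, div_le_iff₀ (by linarith [h2.2])]
    linarith
  · rintro x hx t₀ ht₀ ⟨ψ, hψ, hψmin, hψc⟩
    exact maximalSub_vertex hH hg hT₁ hx ht₀ hψ hψmin hψc

/-- Uniqueness: a solution lies below the maximal subsolution because it is a subsolution, and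
above it by comparison with the maximal subsolutions for Lipschitz data below `g`. -/
theorem IsSolution.eqOn_maximalSub [Finite E] (hH : Γ.IsHamiltonian H)
    (hT₁ : (T₀ : EReal) < T₁) {g : EuclideanSpace ℝ (Fin N) → ℝ} (hg : ContinuousOn g Γ.carrier)
    {v : EuclideanSpace ℝ (Fin N) × ℝ → ℝ} (hv : Γ.IsSolution H c T₀ T₁ g v) :
    EqOn v (fun q => Γ.maximalSub H c T₀ T₁ g q.1 q.2) (Γ.carrier ×ˢ timeIco T₀ T₁) := by
  rintro ⟨x, t⟩ ⟨hx, ht⟩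
  simp only at hx ht ⊢
  refine le_antisymm ?_ (le_of_forall_pos_le_add fun κ hκ => ?_)
  · exact le_maximalSub hH (w := fun x t => v (x, t))
      ⟨hv.sub.isIntegratedSub hH, fun x hx => (hv.initial x hx).le⟩ hx ht
  · obtain ⟨g', hg'L, hg'c, hg'g, hg'V⟩ := exists_lipschitz_approx (c := c) (T₀ := T₀) (T₁ := T₁)
      hH hg hκ
    have h1 := (maximalSub_isIntegratedSub (T₀ := T₀) (T₁ := T₁) (c := c) hH
      (subsBelow_nonempty hH hg'c)).le_of_isSupersolution hH
      (lipschitzSpaceTime_maximalSub hH hT₁ hg'c hg'L) hv.super (fun y hy => by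
        rw [maximalSub_init hH hg'c hT₁ hy, hv.initial y hy]
        exact hg'g y hy) hx ht
    linarith [(hg'V x hx t ht).2]

end EmbeddedNetwork

end NetworkHJ

theorem proposition6p8 {E : Type*} [Finite E] {N : ℕ} (Γ : EmbeddedNetwork E N)
    (H : E → ℝ → ℝ → ℝ) (hH : Γ.IsHamiltonian H)
    (c : EuclideanSpace ℝ (Fin N) → ℝ) (hc : Γ.IsFluxLimiter H c)
    (T₀ : ℝ) (T₁ : EReal) (hT₀ : 0 ≤ T₀) (hT₁ : (T₀ : EReal) < T₁)
    (g : EuclideanSpace ℝ (Fin N) → ℝ) (hg : ContinuousOn g Γ.carrier) :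
    ∃ u : EuclideanSpace ℝ (Fin N) × ℝ → ℝ,
      Γ.IsSolution H c T₀ T₁ g u ∧
      (∀ v : EuclideanSpace ℝ (Fin N) × ℝ → ℝ, Γ.IsSolution H c T₀ T₁ g v →
        Set.EqOn v u (Γ.carrier ×ˢ timeIco T₀ T₁)) ∧
      UniformContinuousOn u (Γ.carrier ×ˢ timeIco T₀ T₁) ∧
      (Γ.LipschitzSpace g → Γ.LipschitzSpaceTime T₀ T₁ u) := by
  refine ⟨fun q => Γ.maximalSub H c T₀ T₁ g q.1 q.2,
    EmbeddedNetwork.maximalSub_isSolution hH hT₁ hg,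
    fun v hv => hv.eqOn_maximalSub hH hT₁ hg,
    EmbeddedNetwork.uniformContinuousOn_maximalSub hH hg hT₁,
    fun hgL => EmbeddedNetwork.lipschitzSpaceTime_maximalSub hH hT₁ hg hgL⟩
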